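/- Functions on $S^1=\mathbb R/\mathbb Z$ are $1$-periodic functions on the line. Let $s\in(1/2,\infty]$, where $H^\infty=C^\infty$. Let $\mathrm{Dens}^s(S^1)=\{\rho\in H^s(S^1):\rho>0,\ \int\rho\,dx=1\}$ and $T^*\mathrm{Dens}^s(S^1)=\mathrm{Dens}^s(S^1)\times H^s(S^1)/\mathbb R$. A tangent vector of $T^*\mathrm{Dens}^s(S^1)$ at $(\rho,[\theta])$ is a pair $(\dot\rho,\dot\theta)\in H^s\times H^s$ with $\int\dot\rho\,dx=0$, where $\dot\theta$ is the representative of its coset modulo constants with $\int\dot\theta\rho\,dx=0$. The Sasaki–Fisher–Rao metric is $$\mathsf G^*_{(\rho,[\theta])}\big((\dot\rho,\dot\theta),(\dot\rho,\dot\theta)\big)=\frac14\int_{S^1}\Big(\frac{\dot\rho^2}{\rho}+\dot\theta^2\rho\Big)dx .$$ A geodesic of it is a $C^2$ curve that is a critical point of the energy on every compact time interval under variations with fixed end points. Let $\mathcal D$ be the set of pairs $(\varphi,\alpha)$, where $\varphi$ is (the lift to $\mathbb R$ of) an orientation preserving diffeomorphism of $S^1$ of class $H^{s+1}$ and $\alpha:S^1\to\mathbb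 R/2\pi\mathbb Z$ is a null-homotopic map of class $H^s$. It carries the product $(\varphi,\alpha)(\eta,\beta)=(\varphi\circ\eta,\beta+\alpha\circ\eta)$. For a prescribed point $x_0$ let $\mathcal G=\{(\varphi,\alpha)\in\mathcal D:\varphi(x_0)=x_0\}$. Let $\langle\cdot,\cdot\rangle_{\dot H^1}$ be the right-invariant form with $\langle (v,\sigma),(v,\sigma)\rangle_{\dot H^1}=\frac14\int((v')^2+\sigma^2)\,dx$ at the identity. Let $\Psi(\varphi,\alpha)=(\varphi',[\theta])\in T^*\mathrm{Dens}^s(S^1)$ with $\theta(x)=\int_0^x\alpha'$, that is, $\theta$ is a real lift of $\alpha$ up to a constant. Let $I$ be an open time interval and $t_0\in I$. A pair $(v,\sigma)$ of periodic functions on $I\times S^1$ is called the Eulerian velocity of a $C^2$ curve $(\varphi,\alpha)$ in $\mathcal D$ over $I$ if $\dot\varphi=v\circ\varphi$ and $\dot\alpha=\sigma\circ\varphi$. The two-component Hunter–Saxton equation is $$\dot v''=-2v'v''-vv'''+\sigma\sigma',\qquad \dot\sigma=-(\sigma v)' ,$$ understood in the sense of distributions on $I\times S^1$, with $2v'v''+vv'''=(vv')''-\frac12((v')^2)'$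 and $\sigma\sigma'=\frac12(\sigma^2)'$. **Proposition.** 1. If $t\mapsto g(t)=(\varphi,\alpha)$ is a $C^1$ curve in $\mathcal D$ over $I$, then $\Psi\circ g$ is a $C^1$ curve in $T^*\mathrm{Dens}^s(S^1)$, and at every time at which $\sigma=\dot\alpha\circ\varphi^{-1}$ satisfies $\int\sigma\,dx=0$ the squared length of its velocity in the metric $\mathsf G^*$ equals $\langle\dot g,\dot g\rangle_{\dot H^1}=\frac14\int((v')^2+\sigma^2)\,dx$, where $v=\dot\varphi\circ\varphi^{-1}$. Thus on vectors with $\int\sigma\,dx=0$ the $\dot H^1$-metric is the pullback of $\mathsf G^*$ by $\Psi$. 2. Let $(v,\sigma)$ be the Eulerian velocity of a $C^2$ curve $g$ in $\mathcal D$ over $I$. Then $(v,\sigma)$ solves the two-component Hunter–Saxton equation with $\int\sigma(t_0,x)\,dx=0$ if and only if $\Psi\circ g$ is a geodesic of $\mathsf G^*$ and $\int\sigma(t,x)\,dx=0$ for all $t\in I$. If $s>5/2$, then $(v,\sigma)$ solves the equation in the sense of distributions if and only if $v(t,\cdot)$ is $C^3$ and $\sigma(t,\cdot)$ is $C^1$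 for every $t\in I$ and the equation holds pointwise. 3. For every geodesic $\gamma$ of $\mathsf G^*$ over $I$ there is a $C^2$ curve $g$ in $\mathcal G$ with $\Psi\circ g=\gamma$ on $I$ whose Eulerian velocity $(v,\sigma)$ solves the two-component Hunter–Saxton equation and satisfies $\int\sigma(t,x)\,dx=0$ for all $t\in I$. The pair $(v,\sigma)$ is unique: it is the Eulerian velocity of every $C^2$ curve in $\mathcal G$ over $I$ that $\Psi$ maps to $\gamma$ and whose Eulerian velocity has $\int\sigma(t,x)\,dx=0$ for all $t\in I$. -/

import Mathlib

open MeasureTheory Set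

noncomputable section

namespace HunterSaxton

/-! ### Sobolev spaces on the circle `S¹ = ℝ/ℤ`

Functions on `S¹` are `1`-periodic functions on the line; for exponents above `1/2` a function of
class `H^r` is identified with its continuous representative. -/

/-- The `n`-th Fourier coefficient of a real function on `[0,1]`. -/
def coeff (f : ℝ → ℝ) (n : ℤ) : ℂ :=
  fourierCoeffOn (zero_lt_one' ℝ) (fun x => (f x : ℂ)) n

theorem coeff_add {f g : ℝ → ℝ} (hf : Continuous f) (hg : Continuous g) (n : ℤ) :
    coeff (f + g) n = coeff f n + coeff g n := by
  unfold coeff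
  simp only [fourierCoeffOn_eq_integral]
  rw [← smul_add, ← intervalIntegral.integral_add]
  · congr 2
    ext x
    simp [mul_add]
  · apply Continuous.intervalIntegrable
    simp only [fourier_coe_apply]
    fun_prop
  · apply Continuous.intervalIntegrable
    simp only [fourier_coe_apply]
    fun_prop

theorem coeff_smul (c : ℝ) (f : ℝ → ℝ) (n : ℤ) : coeff (c • f) n = c * coeff f n := by
  unfold coeff
  rw [← fourierCoeffOn.const_mul]
  congr 1
  ext x
  simp

/-- The weight `(1 + n²)^(r/2)` of the Fourier mode `n` in the norm of `H^r`. -/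
def weight (r : ℝ) (n : ℤ) : ℝ := (1 + (n : ℝ) ^ 2) ^ (r / 2)

theorem weight_pos (r : ℝ) (n : ℤ) : 0 < weight r n := by
  unfold weight; positivity

/-- The weighted sequence of Fourier coefficients. -/
def wcoeff (r : ℝ) (f : ℝ → ℝ) (n : ℤ) : ℂ := (weight r n : ℂ) * coeff f n

/-- The Sobolev space `H^r(S¹)`, for a finite real exponent: periodic (continuous) functions with
`∑ (1 + n²)^r |f̂(n)|² < ∞`. -/
def HsReal (r : ℝ) : Submodule ℝ (ℝ → ℝ) where
  carrier := {f | Continuous f ∧ Function.Periodic f 1 ∧ Memℓp (wcoeff r f) 2}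
  zero_mem' := by
    refine ⟨continuous_const, fun x => rfl, ?_⟩
    have : wcoeff r 0 = 0 := by
      ext n
      have := coeff_smul 0 0 n
      simp at this
      simp [wcoeff, this]
    rw [this]
    exact zero_memℓp
  add_mem' := by
    rintro f g ⟨hf, hfp, hfs⟩ ⟨hg, hgp, hgs⟩
    refine ⟨hf.add hg, hfp.add hgp, ?_⟩
    have : wcoeff r (f + g) = wcoeff r f + wcoeff r g := by
      ext n
      simp [wcoeff, coeff_add hf hg, mul_add]
    rw [this]
    exact hfs.add hgs
  smul_mem' := by
    rintro c f ⟨hf, hfp, hfs⟩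
    refine ⟨hf.const_smul c, hfp.smul c, ?_⟩
    have : wcoeff r (c • f) = c • wcoeff r f := by
      ext n
      simp [wcoeff, coeff_smul, mul_left_comm]
    rw [this]
    exact hfs.const_smul c

/-- The weighted Fourier coefficients as a linear map into `ℓ²`. -/
def toL2 (r : ℝ) : HsReal r →ₗ[ℝ] lp (fun _ : ℤ => ℂ) 2 where
  toFun f := ⟨wcoeff r f, f.2.2.2⟩
  map_add' f g := by
    ext n
    change wcoeff r ((f : ℝ → ℝ) + (g : ℝ → ℝ)) n = wcoeff r f n + wcoeff r g n
    simp [wcoeff, coeff_add f.2.1 g.2.1, mul_add]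
  map_smul' c f := by
    ext n
    change wcoeff r (c • (f : ℝ → ℝ)) n = c • wcoeff r f n
    simp [wcoeff, coeff_smul, mul_left_comm]

theorem toL2_injective (r : ℝ) : Function.Injective (toL2 r) := by
  rw [← LinearMap.ker_eq_bot, LinearMap.ker_eq_bot']
  rintro ⟨f, hc, hp, hs⟩ h0
  have hz : ∀ n, coeff f n = 0 := by
    intro n
    have h1 : wcoeff r f n = 0 := congrArg (fun u : lp (fun _ : ℤ => ℂ) 2 => u n) h0
    have h2 : (weight r n : ℂ) ≠ 0 := by exact_mod_cast (weight_pos r n).ne'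
    exact (mul_eq_zero.mp h1).resolve_left h2
  have hcc : Continuous (fun x => (f x : ℂ)) := by fun_prop
  have hm : MemLp (fun x => (f x : ℂ)) 2 (volume.restrict (Ioc (0 : ℝ) 1)) := by
    have hb := (isCompact_Icc (a := (0 : ℝ)) (b := 1)).exists_bound_of_continuousOn
      hcc.continuousOn
    obtain ⟨C, hC⟩ := hb
    refine MemLp.of_bound hcc.aestronglyMeasurable C ?_
    filter_upwards [ae_restrict_mem measurableSet_Ioc] with x hx
    exact hC x (Ioc_subset_Icc_self hx)
  have hP := tsum_sq_fourierCoeffOn (zero_lt_one' ℝ) hm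
  have hz' : ∀ n, fourierCoeffOn (zero_lt_one' ℝ) (fun x => (f x : ℂ)) n = 0 := hz
  simp only [hz'] at hP
  simp at hP
  have hzero : ∀ x ∈ Icc (0 : ℝ) 1, f x = 0 := by
    intro x hx
    by_contra hne
    have : 0 < ∫ y in (0 : ℝ)..1, f y ^ 2 :=
      intervalIntegral.integral_pos zero_lt_one (by fun_prop) (fun y _ => sq_nonneg _)
        ⟨x, hx, by positivity⟩
    linarith
  ext x
  obtain ⟨y, hy, hxy⟩ := hp.exists_mem_Ico₀ zero_lt_one x
  simp only [ZeroMemClass.coe_zero, Pi.zero_apply]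
  rw [hxy]
  exact hzero y (Ico_subset_Icc_self hy)

/-- `H^r(S¹)` as a normed space, with `‖f‖² = ∑ (1 + n²)^r |f̂(n)|²`. -/
def HsSpace (r : ℝ) : Type := HsReal r

instance (r : ℝ) : AddCommGroup (HsSpace r) := inferInstanceAs (AddCommGroup (HsReal r))

instance (r : ℝ) : Module ℝ (HsSpace r) := inferInstanceAs (Module ℝ (HsReal r))

/-- `toL2`, as a map on the type `HsSpace r`. -/
def HsSpace.toL2 (r : ℝ) : HsSpace r →ₗ[ℝ] lp (fun _ : ℤ => ℂ) 2 := HunterSaxton.toL2 r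

instance (r : ℝ) : NormedAddCommGroup (HsSpace r) :=
  NormedAddCommGroup.induced _ _ (HsSpace.toL2 r) (toL2_injective r)

instance (r : ℝ) : NormedSpace ℝ (HsSpace r) := NormedSpace.induced ℝ _ _ (HsSpace.toL2 r)

/-- The periodic function underlying an element of `H^r(S¹)`. -/
def HsSpace.toFun {r : ℝ} (f : HsSpace r) : ℝ → ℝ := f.1

/-- The space `H^s(S¹)` for `s` real or `s = ∞`; for real `s` it is `HsReal s`, and for `s = ⊤`
it is the intersection of all `H^r`, that is `C^∞(S¹)`. -/
def Hs (s : WithTop ℝ) : Submodule ℝ (ℝ → ℝ) := ⨅ (r : ℝ) (_ : (r : WithTop ℝ) ≤ s), HsReal r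

theorem mem_Hs {s : WithTop ℝ} {f : ℝ → ℝ} :
    f ∈ Hs s ↔ ∀ r : ℝ, (r : WithTop ℝ) ≤ s → f ∈ HsReal r := by
  simp [Hs, Submodule.mem_iInf]

theorem weight_mul_coeff_deriv_le {f : ℝ → ℝ} (hf : ContDiff ℝ 1 f) (hp : Function.Periodic f 1)
    (r : ℝ) (n : ℤ) :
    ‖wcoeff r (deriv f) n‖ ≤ ‖((2 * Real.pi : ℝ) : ℂ) * wcoeff (r + 1) f n‖ := by
  have hw : weight (r + 1) n = weight r n * (1 + (n : ℝ) ^ 2) ^ (1 / 2 : ℝ) := by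
    unfold weight
    rw [← Real.rpow_add (by positivity)]
    congr 1
    ring
  have hn : |(n : ℝ)| ≤ (1 + (n : ℝ) ^ 2) ^ (1 / 2 : ℝ) := by
    rw [← Real.sqrt_eq_rpow]
    apply Real.abs_le_sqrt
    linarith
  have hd : ∀ x, HasDerivAt f (deriv f x) x := fun x =>
    (hf.differentiable one_ne_zero x).hasDerivAt
  have hdc : Continuous (deriv f) := hf.continuous_deriv le_rfl
  have key : ‖coeff (deriv f) n‖ = 2 * Real.pi * |(n : ℝ)| * ‖coeff f n‖ := by
    have hper : f 1 = f 0 := by simpa using hp 0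
    by_cases h0 : n = 0
    · subst h0
      have hint : ∫ x in (0 : ℝ)..1, deriv f x = 0 := by
        rw [intervalIntegral.integral_eq_sub_of_hasDerivAt (fun x _ => hd x)
          (hdc.intervalIntegrable _ _), hper, sub_self]
      have : coeff (deriv f) 0 = 0 := by
        unfold coeff
        rw [fourierCoeffOn_eq_integral]
        simp [intervalIntegral.integral_ofReal, hint]
      simp [this]
    · have h := fourierCoeffOn_of_hasDerivAt (zero_lt_one' ℝ) (f := fun x => (f x : ℂ))
        (f' := fun x => ((deriv f x : ℝ) : ℂ)) (n := n) h0 (fun x _ => HasDerivAt.ofReal_comp (hd x))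
        ((Complex.continuous_ofReal.comp hdc).intervalIntegrable _ _)
      have h' : coeff f n = 1 / (-2 * Real.pi * Complex.I * n) * (-coeff (deriv f) n) := by
        unfold coeff
        rw [h, hper]
        simp
      have hn0 : (n : ℂ) ≠ 0 := by exact_mod_cast h0
      have hpi : (Real.pi : ℂ) ≠ 0 := by exact_mod_cast Real.pi_ne_zero
      have h'' : coeff (deriv f) n = 2 * Real.pi * Complex.I * n * coeff f n := by
        rw [h']
        have := Complex.I_ne_zero
        field_simp
      rw [h'']
      simp [abs_of_pos Real.pi_pos]
  have h1 : ‖wcoeff r (deriv f) n‖ = weight r n * ‖coeff (deriv f) n‖ := by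
    rw [wcoeff, norm_mul, Complex.norm_real, Real.norm_of_nonneg (weight_pos r n).le]
  have h2 : ‖((2 * Real.pi : ℝ) : ℂ) * wcoeff (r + 1) f n‖
      = 2 * Real.pi * (weight (r + 1) n * ‖coeff f n‖) := by
    rw [wcoeff, norm_mul, norm_mul, Complex.norm_real, Complex.norm_real,
      Real.norm_of_nonneg (weight_pos (r + 1) n).le, Real.norm_of_nonneg (by positivity)]
  rw [h1, h2, key, hw]
  have h0 : 0 ≤ weight r n * (2 * Real.pi) * ‖coeff f n‖ := by
    have := (weight_pos r n).le
    positivity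
  have h3 := mul_le_mul_of_nonneg_left hn h0
  calc weight r n * (2 * Real.pi * |(n : ℝ)| * ‖coeff f n‖)
      = weight r n * (2 * Real.pi) * ‖coeff f n‖ * |(n : ℝ)| := by ring
    _ ≤ weight r n * (2 * Real.pi) * ‖coeff f n‖ * (1 + (n : ℝ) ^ 2) ^ (1 / 2 : ℝ) := h3
    _ = _ := by ring

/-- The derivative maps `C¹` functions of class `H^(s+1)` to `H^s`. -/
theorem deriv_mem_Hs {s : WithTop ℝ} {f : ℝ → ℝ} (hf : ContDiff ℝ 1 f) (hp : Function.Periodic f 1)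
    (h : f ∈ Hs (s + 1)) : deriv f ∈ Hs s := by
  rw [mem_Hs] at h ⊢
  intro r hr
  have h1 := h (r + 1) (by
    rw [WithTop.coe_add, WithTop.coe_one]
    gcongr)
  refine ⟨hf.continuous_deriv le_rfl, fun x => ?_, ?_⟩
  · rw [← deriv_comp_add_const]
    congr 1
    ext y
    exact hp y
  · have h2 := h1.2.2
    have h3 : Memℓp (fun n => ((2 * Real.pi : ℝ) : ℂ) * wcoeff (r + 1) f n) 2 :=
      h2.const_mul _
    apply memℓp_gen
    have h4 := (memℓp_gen_iff (by norm_num)).mp h3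
    refine h4.of_nonneg_of_le (fun n => by positivity) (fun n => ?_)
    exact Real.rpow_le_rpow (norm_nonneg _) (weight_mul_coeff_deriv_le hf hp r n) (by norm_num)

/-! ### Time-dependent functions -/

/-- Partial derivative in time. -/
def dt (u : ℝ → ℝ → ℝ) (t x : ℝ) : ℝ := deriv (fun τ => u τ x) t

/-- Partial derivative in space. -/
def dx (u : ℝ → ℝ → ℝ) (t x : ℝ) : ℝ := deriv (u t) x

/-- `t ↦ u t` is a curve of class `C^k` in `H^s(S¹)` over the open interval `I`
(in the Fréchet sense, for `s = ∞`). -/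
def IsCurve (k : ℕ) (s : WithTop ℝ) (I : Set ℝ) (u : ℝ → ℝ → ℝ) : Prop :=
  ∀ r : ℝ, 1 / 2 < r → (r : WithTop ℝ) ≤ s →
    ∃ U : ℝ → HsSpace r, ContDiffOn ℝ k U I ∧ ∀ t ∈ I, (U t).toFun = u t

/-! ### The cotangent bundle of the space of densities -/

/-- The space `Dens^s(S¹)` of positive probability densities of class `H^s`. -/
def Dens (s : WithTop ℝ) : Set (Hs s) :=
  {ρ | (∀ x, 0 < (ρ : ℝ → ℝ) x) ∧ ∫ x in (0 : ℝ)..1, (ρ : ℝ → ℝ) x = 1}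

/-- The constant functions in `H^s(S¹)`. -/
def constants (s : WithTop ℝ) : Submodule ℝ (Hs s) :=
  (Submodule.span ℝ {fun _ : ℝ => (1 : ℝ)}).comap (Hs s).subtype

/-- `T*Dens^s(S¹) = Dens^s(S¹) × H^s(S¹)/ℝ`. -/
abbrev CotDens (s : WithTop ℝ) : Type := Dens s × (Hs s ⧸ constants s)

/-- The density component of a point of `T*Dens^s(S¹)`. -/
def CotDens.density {s : WithTop ℝ} (p : CotDens s) : ℝ → ℝ := ((p.1 : Hs s) : ℝ → ℝ)

/-- `Θ` is a lift of class `C^k` of the curve `γ = (ρ, [θ])`: `ρ` is a `C^k` curve in `H^s` and `Θ`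
is a `C^k` curve in `H^s` with `[Θ] = [θ]`. -/
def IsLift {s : WithTop ℝ} (k : ℕ) (I : Set ℝ) (γ : ℝ → CotDens s) (Θ : ℝ → Hs s) : Prop :=
  IsCurve k s I (fun t => (γ t).density) ∧ IsCurve k s I (fun t => (Θ t : ℝ → ℝ)) ∧
    ∀ t ∈ I, (constants s).mkQ (Θ t) = (γ t).2

/-- `γ` is a curve of class `C^k` in `T*Dens^s(S¹)`. -/
def IsCotCurve {s : WithTop ℝ} (k : ℕ) (I : Set ℝ) (γ : ℝ → CotDens s) : Prop :=
  ∃ Θ : ℝ → Hs s, IsLift k I γ Θ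

/-- The representative of the coset of `θd` whose integral against `ρ` vanishes (when `ρ` is a
probability density). -/
def normalize (ρ θd : ℝ → ℝ) : ℝ → ℝ := fun x => θd x - ∫ y in (0 : ℝ)..1, θd y * ρ y

/-- The Sasaki–Fisher–Rao metric (as a quadratic form) at a point over `ρ`, on a tangent vector
`(ρd, θd)` with `∫ ρd = 0` and `∫ θd ρ = 0`. -/
def sasaki (ρ ρd θd : ℝ → ℝ) : ℝ :=
  1 / 4 * ∫ x in (0 : ℝ)..1, (ρd x ^ 2 / ρ x + θd x ^ 2 * ρ x)

/-- `(ρd, θd)` is the velocity at time `t` of the `C¹` curve `γ` in `T*Dens^s(S¹)`, where `θd`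
is normalized by `∫ θd ρ = 0`. -/
def IsVelocity {s : WithTop ℝ} (I : Set ℝ) (γ : ℝ → CotDens s) (t : ℝ) (ρd θd : ℝ → ℝ) : Prop :=
  ∃ Θ : ℝ → Hs s, IsLift 1 I γ Θ ∧ ρd = dt (fun τ => (γ τ).density) t ∧
    θd = normalize (γ t).density (dt (fun τ => (Θ τ : ℝ → ℝ)) t)

/-- The energy over `[a, b]` of the curve `t ↦ (ρ t, [Θ t])` for the Sasaki–Fisher–Rao metric. -/
def energy (a b : ℝ) (ρ Θ : ℝ → ℝ → ℝ) : ℝ :=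
  ∫ t in a..b, sasaki (ρ t) (dt ρ t) (normalize (ρ t) (dt Θ t))

/-- `γ` is a geodesic of the Sasaki–Fisher–Rao metric on the open interval `I`: a `C²` curve which
is a critical point of the energy on every compact subinterval `[a, b]` under variations with fixed
end points.  As `T*Dens^s` is an open subset of an affine space (modulo constants in `θ`), a
variation is given by `(ρ + ε r, [Θ + ε h])` with `∫ r = 0`. -/
def IsGeodesic {s : WithTop ℝ} (I : Set ℝ) (γ : ℝ → CotDens s) : Prop :=
  ∃ Θ : ℝ → Hs s, IsLift 2 I γ Θ ∧
    ∀ a b : ℝ, a < b → Icc a b ⊆ I → ∀ r h : ℝ → ℝ → ℝ,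
      IsCurve 2 s I r → IsCurve 2 s I h → (∀ t ∈ I, ∫ x in (0 : ℝ)..1, r t x = 0) →
      r a = 0 → r b = 0 → h a = 0 → h b = 0 →
      HasDerivAt (fun ε : ℝ => energy a b (fun t x => (γ t).density x + ε * r t x)
        (fun t x => (Θ t : ℝ → ℝ) x + ε * h t x)) 0 0

/-! ### The semidirect product -/

/-- Pairs `(φ, α)` of an orientation preserving diffeomorphism `φ` of the circle of class `H^(s+1)`,
given by a lift to the line, and a null-homotopic map `α : S¹ → ℝ/2πℤ` of class `H^s`, which is
one that lifts to a function in `H^s(S¹)`.  A diffeomorphism of the circle fixing the point `x₀`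
has exactly one lift with `φ x₀ = x₀`.
The product is `(φ, α)(η, β) = (φ ∘ η, β + α ∘ η)`. -/
structure SemiDirect (s : WithTop ℝ) where
  φ : ℝ → ℝ
  contDiff_φ : ContDiff ℝ 1 φ
  periodic_φ : Function.Periodic (fun x => φ x - x) 1
  mem_φ : (fun x => φ x - x) ∈ Hs (s + 1)
  deriv_pos : ∀ x, 0 < deriv φ x
  α : ℝ → AddCircle (2 * Real.pi)
  exists_lift : ∃ a : Hs s, ∀ x, α x = (((a : ℝ → ℝ) x : ℝ) : AddCircle (2 * Real.pi))

/-- Constant functions are of class `H^s`. -/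
theorem const_mem_Hs (s : WithTop ℝ) (c : ℝ) : (fun _ : ℝ => c) ∈ Hs s := by
  rw [mem_Hs]
  intro r _
  refine ⟨continuous_const, fun _ => rfl, ?_⟩
  have hz : ∀ n : ℤ, n ≠ 0 → wcoeff r (fun _ => c) n = 0 := by
    intro n hn
    have h := fourierCoeffOn_of_hasDerivAt (zero_lt_one' ℝ) (f := fun _ => (c : ℂ))
      (f' := fun _ => 0) (n := n) hn (fun x _ => hasDerivAt_const x _)
      (continuous_const.intervalIntegrable _ _)
    have h0 : fourierCoeffOn (zero_lt_one' ℝ) (fun _ => (0 : ℂ)) n = 0 := by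
      rw [fourierCoeffOn_eq_integral]
      simp
    simp [wcoeff, coeff, h, h0]
  apply memℓp_gen
  refine summable_of_ne_finset_zero (s := {0}) (fun n hn => ?_)
  rw [hz n (by simpa using hn)]
  norm_num

/-- The density `π(φ) = φ^*(dx)`, that is `φ'`. -/
def SemiDirect.jac {s : WithTop ℝ} (g : SemiDirect s) : Dens s := by
  have hd : ∀ x, HasDerivAt g.φ (deriv g.φ x) x := fun x =>
    (g.contDiff_φ.differentiable one_ne_zero x).hasDerivAt
  refine ⟨⟨deriv g.φ, ?_⟩, g.deriv_pos, ?_⟩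
  · have h1 : deriv (fun x => g.φ x - x) ∈ Hs s :=
      deriv_mem_Hs (g.contDiff_φ.sub contDiff_id) g.periodic_φ g.mem_φ
    have h2 : deriv g.φ = deriv (fun x => g.φ x - x) + fun _ => 1 := by
      ext x
      have h3 : HasDerivAt (fun x => g.φ x - x) (deriv g.φ x - 1) x := (hd x).sub (hasDerivAt_id x)
      rw [Pi.add_apply, h3.deriv]
      ring
    rw [h2]
    exact (Hs s).add_mem h1 (const_mem_Hs s 1)
  · change ∫ x in (0 : ℝ)..1, deriv g.φ x = 1
    rw [intervalIntegral.integral_eq_sub_of_hasDerivAt (fun x _ => hd x)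
      ((g.contDiff_φ.continuous_deriv le_rfl).intervalIntegrable _ _)]
    have h := g.periodic_φ 0
    simp only [zero_add, sub_zero] at h
    linarith

/-- The map `(φ, α) ↦ (π(φ), [θ])`, where `θ` is a real lift of `α`; two such lifts differ by a
constant, and one of them is `x ↦ ∫₀ˣ α'`. -/
def SemiDirect.toCotDens {s : WithTop ℝ} (g : SemiDirect s) : CotDens s :=
  (g.jac, (constants s).mkQ g.exists_lift.choose)

/-- `g` is a curve of class `C^k` in the semidirect product over the open interval `I`, and `a` is
a `C^k` real lift of its second component. -/
def IsGroupCurve {s : WithTop ℝ} (k : ℕ) (I : Set ℝ) (g : ℝ → SemiDirect s) (a : ℝ → ℝ → ℝ) :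
    Prop :=
  IsCurve k (s + 1) I (fun t x => (g t).φ x - x) ∧ IsCurve k s I a ∧
    ∀ t ∈ I, ∀ x, (g t).α x = ((a t x : ℝ) : AddCircle (2 * Real.pi))

/-- The `Ḣ¹`-type inner product (as a quadratic form) at the identity. -/
def lenellsOne (v σ : ℝ → ℝ) : ℝ := 1 / 4 * ∫ x in (0 : ℝ)..1, (deriv v x ^ 2 + σ x ^ 2)

/-- The right-invariant `Ḣ¹`-type metric at a point over `φ`, on the tangent vector `(φd, αd)`:
right translation by the inverse element moves it to `(φd ∘ φ⁻¹, αd ∘ φ⁻¹)` at the identity. -/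
def lenells (φ φd αd : ℝ → ℝ) : ℝ :=
  lenellsOne (φd ∘ Function.invFun φ) (αd ∘ Function.invFun φ)

/-! ### The two-component Hunter–Saxton equation -/

/-- `(v, σ)` are the Eulerian velocities of the `C²` curve `g = (φ, α)` in the semidirect product
(with real lift `a` of `α`): `∂ₜφ = v ∘ φ` and `∂ₜα = σ ∘ φ`. -/
def IsEulerianVelocity {s : WithTop ℝ} (I : Set ℝ) (v σ : ℝ → ℝ → ℝ) (g : ℝ → SemiDirect s)
    (a : ℝ → ℝ → ℝ) : Prop :=
  IsGroupCurve 2 I g a ∧ ∀ t ∈ I, ∀ x,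
    dt (fun τ => (g τ).φ) t x = v t ((g t).φ x) ∧ dt a t x = σ t ((g t).φ x)

/-- Test functions: smooth, periodic in `x`, with support in `K × S¹`, `K ⊆ I` compact. -/
def IsTest (I : Set ℝ) (η : ℝ → ℝ → ℝ) : Prop :=
  ContDiff ℝ (⊤ : ℕ∞) (fun p : ℝ × ℝ => η p.1 p.2) ∧ (∀ t, Function.Periodic (η t) 1) ∧
    ∃ K : Set ℝ, IsCompact K ∧ K ⊆ I ∧ ∀ t, t ∉ K → ∀ x, η t x = 0

/-- `(v, σ)` solves `v̇'' = -2 v' v'' - v v''' + σ σ'`, `σ̇ = -(σ v)'` on `I × S¹` in the sense of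
distributions, where `2 v' v'' + v v''' = (v v')'' - (v'² / 2)'` and `σ σ' = (σ² / 2)'`. -/
def IsWeakSolution (I : Set ℝ) (v σ : ℝ → ℝ → ℝ) : Prop :=
  ∀ η : ℝ → ℝ → ℝ, IsTest I η →
    (∫ t in I, ∫ x in (0 : ℝ)..1, (dx v t x * dt (dx η) t x + v t x * dx v t x * dx (dx η) t x
      + (dx v t x ^ 2 / 2 + σ t x ^ 2 / 2) * dx η t x)) = 0 ∧
    (∫ t in I, ∫ x in (0 : ℝ)..1, (σ t x * dt η t x + σ t x * v t x * dx η t x)) = 0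

/-- `(v, σ)` solves the same equations pointwise on `I × S¹`. -/
def IsClassicalSolution (I : Set ℝ) (v σ : ℝ → ℝ → ℝ) : Prop :=
  ∀ t ∈ I, ContDiff ℝ 3 (v t) ∧ ContDiff ℝ 1 (σ t) ∧ ∀ x,
    HasDerivAt (fun τ => dx (dx v) τ x)
      (-2 * dx v t x * dx (dx v) t x - v t x * dx (dx (dx v)) t x + σ t x * dx σ t x) t ∧
    HasDerivAt (fun τ => σ τ x) (-deriv (fun y => σ t y * v t y) x) t

end HunterSaxton

end

open MeasureTheory Set

noncomputable section

namespace HunterSaxton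

open Filter Topology

/-! ### Fourier series of functions of class `H^r` -/

/-! In Lagrangian variables both sides of the correspondence become the same pair of pointwise
equations. Write `ρ = φ'` and let `θ` be a real lift of `α`. The Eulerian velocity satisfies `v' ∘ φ
= ρ̇/ρ` and `σ ∘ φ = θ̇`, so the substitution `x = φ(y)` turns `∫ (v'² + σ²) dx` into `∫ (ρ̇²/ρ +
θ̇²ρ) dy`, and `∫ σ dx` into `∫ θ̇ρ dy`. Thus mean zero of `σ` says that `θ̇` is the normalized
representative of its coset, and the pullback statement follows.

For a lift normalized in this way the Euler–Lagrange equations of the energy are `θ̇² + (ρ̇/ρ)² -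
2ρ̈/ρ = c(t)` and `(θ̇ρ)˙ = 0`. The function `c(t)` is undetermined because variations of `ρ` have
mean zero. These are `elDensity` and `elFibre`, and `isGeodesic_iff_eulerLagrange` derives them by
testing with products of a bump in time and a trigonometric function in space.

On the Eulerian side, `ζ_t + v ζ_x` is the time derivative of `ζ(t, φ(t, y))` along trajectories.
Changing variables and integrating by parts in time therefore rewrites the weak equations as
integrals of the same two expressions against test functions composed with `φ`
(`integral_weak_velocity`, `integral_weak_fibre`). The first equation is tested only with space
derivatives, again leaving a free `c(t)`. This gives `IsFlow.isWeakSolution_iff_eulerLagrange`. The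
second equation makes `θ̇ρ` constant in time at each point, so mean zero of `σ` propagates from one
time to all. When `s > 5/2`, the residuals of the pointwise equations are, up to factors of `ρ`, the
space derivative of `elDensity` and `elFibre` itself, so classical solutions satisfy the same
criterion.

For the reconstruction, the density is integrated to a diffeomorphism fixing `x₀` and a function of
time alone is subtracted from the lift to normalize it. The fixed point and the normalization leave
no freedom in the velocities.

The analytic basis is that for `r > 1/2` functions of class `H^r` have absolutely summable Fourier
series. Evaluation, differentiation, integration and the pairing are then bounded maps, so they
carry `C^k` curves in Sobolev spaces to `C^k` curves. -/

theorem coeff_eq_integral (f : ℝ → ℝ) (n : ℤ) :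
    coeff f n = ∫ x in (0 : ℝ)..1, fourier (-n) (x : AddCircle (1 : ℝ)) * (f x : ℂ) := by
  unfold coeff
  rw [fourierCoeffOn_eq_integral]
  norm_num

theorem weight_le_weight {r r' : ℝ} (h : r ≤ r') (n : ℤ) : weight r n ≤ weight r' n := by
  unfold weight
  apply Real.rpow_le_rpow_of_exponent_le
  · nlinarith [sq_nonneg (n : ℝ)]
  · linarith

theorem weight_add (r r' : ℝ) (n : ℤ) : weight (r + r') n = weight r n * weight r' n := by
  unfold weight
  rw [← Real.rpow_add (by positivity)]
  congr 1
  ring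

theorem weight_sq (r : ℝ) (n : ℤ) : weight r n ^ 2 = weight (2 * r) n := by
  rw [sq, ← weight_add, two_mul]

theorem norm_wcoeff (r : ℝ) (f : ℝ → ℝ) (n : ℤ) : ‖wcoeff r f n‖ = weight r n * ‖coeff f n‖ := by
  rw [wcoeff, norm_mul, Complex.norm_real, Real.norm_of_nonneg (weight_pos r n).le]

theorem abs_le_weight_one (n : ℤ) : |(n : ℝ)| ≤ weight 1 n := by
  unfold weight
  rw [← Real.sqrt_eq_rpow]
  apply Real.abs_le_sqrt
  linarith

theorem weight_one_le {n : ℤ} (hn : n ≠ 0) : weight 1 n ≤ 2 * |(n : ℝ)| := by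
  unfold weight
  rw [← Real.sqrt_eq_rpow]
  apply Real.sqrt_le_iff.mpr
  refine ⟨by positivity, ?_⟩
  have : (1 : ℝ) ≤ |(n : ℝ)| := by exact_mod_cast Int.one_le_abs hn
  nlinarith [sq_abs (n : ℝ)]

/-- Comparison with `|n|^r`. The power vanishes at `n = 0` by convention, while the weight is `1`
there, so the majorant needs an extra unit mass at `0`. -/
theorem summable_weight {r : ℝ} (hr : r < -1) : Summable (weight r) := by
  have h1 : Summable (fun n : ℤ => |(n : ℝ)| ^ r) := by
    have := Real.summable_abs_int_rpow (b := -r) (by linarith)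
    simpa using this
  have h2 : Summable (Pi.single (0 : ℤ) (1 : ℝ)) := by
    refine summable_of_ne_finset_zero (s := {0}) (fun n hn => ?_)
    exact Pi.single_eq_of_ne (by simpa using hn) _
  refine (h1.add h2).of_nonneg_of_le (fun n => (weight_pos r n).le) (fun n => ?_)
  rcases eq_or_ne n 0 with rfl | hn
  · simp [weight, Real.zero_rpow (show r ≠ 0 by linarith)]
  · rw [Pi.single_eq_of_ne hn, add_zero]
    unfold weight
    have h3 : 0 < |(n : ℝ)| := by positivity
    have h4 : |(n : ℝ)| ^ r = (|(n : ℝ)| ^ 2) ^ (r / 2) := by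
      rw [← Real.rpow_natCast, ← Real.rpow_mul h3.le]
      congr 1
      push_cast
      ring
    rw [h4, sq_abs]
    apply Real.rpow_le_rpow_of_nonpos (by positivity) (by linarith) (by linarith)

/-- The embedding constant of `H^r` into the Wiener algebra. -/
def embConst (r : ℝ) : ℝ := (∑' n, weight (-r) n ^ (2 : ℝ)) ^ (1 / 2 : ℝ)

theorem embConst_nonneg (r : ℝ) : 0 ≤ embConst r := by
  unfold embConst
  have : 0 ≤ ∑' n, weight (-r) n ^ (2 : ℝ) := tsum_nonneg fun n => (Real.rpow_nonneg (weight_pos _ n).le _)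
  positivity

theorem mem_HsReal_summable {r : ℝ} {f : ℝ → ℝ} (hf : f ∈ HsReal r) :
    Summable fun n => ‖wcoeff r f n‖ ^ (2 : ℝ) := by
  have := (memℓp_gen_iff (by norm_num)).mp hf.2.2
  simpa using this

theorem norm_eq {r : ℝ} (f : HsSpace r) :
    ‖f‖ = (∑' n, ‖wcoeff r f.toFun n‖ ^ (2 : ℝ)) ^ (1 / 2 : ℝ) := by
  change ‖HsSpace.toL2 r f‖ = _
  rw [lp.norm_eq_tsum_rpow (by norm_num)]
  norm_num
  rfl

/-- Cauchy–Schwarz applied to `weight (r' - r)` and `wcoeff r f`; the first is square summable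
because `2 (r' - r) < -1`. The case `r' = 0` gives continuity and `r' = 1` gives a continuous
derivative. -/
theorem summable_weight_mul_coeff {r r' : ℝ} (h : r' + 1 / 2 < r) {f : ℝ → ℝ}
    (hf : f ∈ HsReal r) : Summable fun n => weight r' n * ‖coeff f n‖ := by
  have h1 : Summable fun n => weight (r' - r) n ^ (2 : ℝ) := by
    norm_num [weight_sq]
    exact summable_weight (by linarith)
  have := Real.summable_mul_of_Lp_Lq_of_nonneg Real.HolderConjugate.two_two
    (fun n => (weight_pos _ n).le) (fun n => norm_nonneg _) h1 (mem_HsReal_summable hf)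
  refine this.congr fun n => ?_
  rw [norm_wcoeff, ← mul_assoc, ← weight_add]
  ring_nf

theorem summable_coeff {r : ℝ} (h : 1 / 2 < r) {f : ℝ → ℝ} (hf : f ∈ HsReal r) :
    Summable fun n => ‖coeff f n‖ := by
  have := summable_weight_mul_coeff (r' := 0) (by linarith) hf
  simpa [weight] using this

/-- The quantitative Cauchy–Schwarz inequality; through it the sup norm is controlled by the Sobolev
norm. -/
theorem tsum_norm_coeff_le {r : ℝ} (h : 1 / 2 < r) (f : HsSpace r) :
    ∑' n, ‖coeff f.toFun n‖ ≤ embConst r * ‖f‖ := by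
  have h1 : Summable fun n => weight (-r) n ^ (2 : ℝ) := by
    norm_num [weight_sq]
    exact summable_weight (by linarith)
  have := Real.inner_le_Lp_mul_Lq_tsum_of_nonneg Real.HolderConjugate.two_two
    (fun n => (weight_pos _ n).le) (fun n => norm_nonneg _) h1 (mem_HsReal_summable f.2)
  rw [norm_eq, embConst]
  refine le_trans (le_of_eq ?_) this
  congr 1
  ext n
  rw [norm_wcoeff, ← mul_assoc, ← weight_add]
  simp [weight, HsSpace.toFun]

/-- The function descends to a continuous function on `AddCircle 1`, where an absolutely summable
Fourier series converges pointwise to it. -/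
theorem hasSum_coeff {f : ℝ → ℝ} (hf : Continuous f) (hp : Function.Periodic f 1)
    (hs : Summable fun n => ‖coeff f n‖) (x : ℝ) :
    HasSum (fun n => coeff f n * fourier n (x : AddCircle (1 : ℝ))) (f x : ℂ) := by
  have hp' : Function.Periodic (fun y => (f y : ℂ)) 1 := fun y => by simp [hp y]
  have hc : Continuous hp'.lift := by
    exact continuous_coinduced_dom.mpr (Complex.continuous_ofReal.comp hf)
  let F : C(AddCircle (1 : ℝ), ℂ) := ⟨hp'.lift, hc⟩
  have hF : ∀ n, fourierCoeff F n = coeff f n := by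
    intro n
    rw [fourierCoeff_eq_intervalIntegral _ _ 0, coeff_eq_integral]
    simp [F]
  have hsF : Summable (fourierCoeff F) := by
    apply Summable.of_norm
    simpa [hF] using hs
  have := has_pointwise_sum_fourier_series_of_summable hsF (x : AddCircle (1 : ℝ))
  simp only [hF] at this
  exact this

theorem norm_fourier_coe (n : ℤ) (x : ℝ) : ‖fourier n (x : AddCircle (1 : ℝ))‖ = 1 := by
  rw [fourier_apply]
  exact Circle.norm_coe _

theorem abs_le_tsum_coeff {f : ℝ → ℝ} (hf : Continuous f) (hp : Function.Periodic f 1)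
    (hs : Summable fun n => ‖coeff f n‖) (x : ℝ) : |f x| ≤ ∑' n, ‖coeff f n‖ := by
  have h := hasSum_coeff hf hp hs x
  have h2 : ∀ n, ‖coeff f n * fourier n (x : AddCircle (1 : ℝ))‖ = ‖coeff f n‖ := by
    intro n
    rw [norm_mul, norm_fourier_coe, mul_one]
  have h3 := norm_tsum_le_tsum_norm (f := fun n => coeff f n * fourier n (x : AddCircle (1 : ℝ)))
    (by simpa only [h2] using hs)
  rw [h.tsum_eq] at h3
  simpa only [h2, Complex.norm_real, Real.norm_eq_abs] using h3

theorem HsSpace.abs_apply_le {r : ℝ} (h : 1 / 2 < r) (f : HsSpace r) (x : ℝ) :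
    |f.toFun x| ≤ embConst r * ‖f‖ :=
  (abs_le_tsum_coeff f.2.1 f.2.2.1 (summable_coeff h f.2) x).trans (tsum_norm_coeff_le h f)

/-- A continuous periodic function all of whose Fourier coefficients vanish is zero. -/
theorem eq_zero_of_coeff_eq_zero {f : ℝ → ℝ} (hf : Continuous f) (hp : Function.Periodic f 1)
    (h : ∀ n, coeff f n = 0) : f = 0 := by
  ext x
  have := hasSum_coeff hf hp (by simp [h]) x
  simp only [h, zero_mul] at this
  have h0 := this.unique hasSum_zero
  exact_mod_cast h0

/-- Termwise differentiation of the Fourier series: the differentiated terms have the summable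
majorant `2π · weight 1 n · ‖coeff f n‖`, uniformly in `x`. -/
theorem exists_hasDerivAt {r : ℝ} (h : 3 / 2 < r) {f : ℝ → ℝ} (hf : f ∈ HsReal r) :
    ∃ f' : ℝ → ℝ, Continuous f' ∧ ∀ x, HasDerivAt f (f' x) x := by
  have hs := summable_weight_mul_coeff (r' := 1) (by linarith) hf
  have hs0 := summable_coeff (by linarith) hf
  set g : ℤ → ℝ → ℂ := fun n x => coeff f n * fourier n (x : AddCircle (1 : ℝ)) with hg
  set g' : ℤ → ℝ → ℂ := fun n x =>
    coeff f n * (2 * Real.pi * Complex.I * n / (1 : ℝ) * fourier n (x : AddCircle (1 : ℝ))) with hg'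
  have hu : Summable fun n : ℤ => 2 * Real.pi * (weight 1 n * ‖coeff f n‖) := hs.mul_left _
  have hb : ∀ n x, ‖g' n x‖ ≤ 2 * Real.pi * (weight 1 n * ‖coeff f n‖) := by
    intro n x
    have : ‖g' n x‖ = 2 * Real.pi * (|(n : ℝ)| * ‖coeff f n‖) := by
      simp only [hg', norm_mul, norm_fourier_coe]
      simp [abs_of_pos Real.pi_pos]
      ring
    rw [this]
    have := abs_le_weight_one n
    have := Real.pi_pos
    gcongr
  have hd : ∀ n x, HasDerivAt (g n) (g' n x) x := fun n x =>
    (hasDerivAt_fourier 1 n x).const_mul (coeff f n)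
  have hsum : ∀ x, HasSum (fun n => g n x) (f x : ℂ) :=
    fun x => hasSum_coeff hf.1 hf.2.1 hs0 x
  refine ⟨fun x => (∑' n, g' n x).re, ?_, fun x => ?_⟩
  · refine Complex.continuous_re.comp (continuous_tsum (fun n => ?_) hu hb)
    simp only [hg', fourier_coe_apply]
    fun_prop
  · have h1 := hasDerivAt_tsum hu hd hb (hsum 0).summable x
    have h2 : (fun z => ∑' n, g n z) = fun z => (f z : ℂ) := by
      ext z
      exact (hsum z).tsum_eq
    rw [h2] at h1
    have h3 := (Complex.reCLM.hasFDerivAt.comp_hasDerivAt x h1)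
    simpa using! h3

theorem contDiff_one_of_mem {r : ℝ} (h : 3 / 2 < r) {f : ℝ → ℝ} (hf : f ∈ HsReal r) :
    ContDiff ℝ 1 f := by
  obtain ⟨f', hc, hd⟩ := exists_hasDerivAt h hf
  rw [contDiff_one_iff_deriv]
  refine ⟨fun x => (hd x).differentiableAt, ?_⟩
  have : deriv f = f' := funext fun x => (hd x).deriv
  rwa [this]

theorem HsReal_anti {r r' : ℝ} (h : r' ≤ r) {f : ℝ → ℝ} (hf : f ∈ HsReal r) : f ∈ HsReal r' := by
  refine ⟨hf.1, hf.2.1, ?_⟩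
  apply memℓp_gen
  have h4 := (memℓp_gen_iff (by norm_num)).mp hf.2.2
  refine h4.of_nonneg_of_le (fun n => by positivity) (fun n => ?_)
  refine Real.rpow_le_rpow (norm_nonneg _) ?_ (by norm_num)
  rw [norm_wcoeff, norm_wcoeff]
  have := weight_le_weight h n
  gcongr

theorem mem_Hs_coe {r : ℝ} {f : ℝ → ℝ} : f ∈ Hs (r : WithTop ℝ) ↔ f ∈ HsReal r := by
  rw [mem_Hs]
  exact ⟨fun h => h r le_rfl, fun h r' hr' => HsReal_anti (WithTop.coe_le_coe.mp hr') h⟩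

/-! ### Bounded operators between the Sobolev spaces -/

theorem norm_le_of_wcoeff_le {r r' C : ℝ} (hC : 0 ≤ C) {f : HsSpace r} {g : HsSpace r'}
    (h : ∀ n, ‖wcoeff r' g.toFun n‖ ≤ C * ‖wcoeff r f.toFun n‖) : ‖g‖ ≤ C * ‖f‖ := by
  have h1 : ‖HsSpace.toL2 r' g‖ ≤ ‖(C • HsSpace.toL2 r f : lp (fun _ : ℤ => ℂ) 2)‖ := by
    apply lp.norm_mono (by norm_num)
    intro n
    have := h n
    rw [lp.coeFn_smul, Pi.smul_apply, norm_smul, Real.norm_of_nonneg hC]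
    exact this
  rwa [norm_smul, Real.norm_of_nonneg hC] at h1

namespace HsSpace

/-- The element of `H^r` given by a function. -/
def ofMem {r : ℝ} (f : ℝ → ℝ) (hf : f ∈ HsReal r) : HsSpace r := (⟨f, hf⟩ : HsReal r)

@[simp] theorem toFun_ofMem {r : ℝ} (f : ℝ → ℝ) (hf : f ∈ HsReal r) : (ofMem f hf).toFun = f := rfl

theorem toFun_injective {r : ℝ} : Function.Injective (toFun (r := r)) := Subtype.val_injective

@[simp] theorem toFun_add {r : ℝ} (f g : HsSpace r) : (f + g).toFun = f.toFun + g.toFun := rfl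

@[simp] theorem toFun_sub {r : ℝ} (f g : HsSpace r) : (f - g).toFun = f.toFun - g.toFun := rfl

@[simp] theorem toFun_smul {r : ℝ} (c : ℝ) (f : HsSpace r) : (c • f).toFun = c • f.toFun := rfl

theorem mem {r : ℝ} (f : HsSpace r) : f.toFun ∈ HsReal r := f.2

theorem continuous {r : ℝ} (f : HsSpace r) : Continuous f.toFun := f.mem.1

theorem periodic {r : ℝ} (f : HsSpace r) : Function.Periodic f.toFun 1 := f.mem.2.1

/-- The bounded operator given by a linear map on functions. -/
def mkCLM {r r' : ℝ} (T : HsSpace r → ℝ → ℝ) (hT : ∀ f, T f ∈ HsReal r')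
    (hadd : ∀ f g, T (f + g) = T f + T g) (hsmul : ∀ (c : ℝ) f, T (c • f) = c • T f)
    (C : ℝ) (hC : 0 ≤ C) (h : ∀ f n, ‖wcoeff r' (T f) n‖ ≤ C * ‖wcoeff r f.toFun n‖) :
    HsSpace r →L[ℝ] HsSpace r' :=
  LinearMap.mkContinuous
    { toFun := fun f => ofMem (T f) (hT f)
      map_add' := fun f g => toFun_injective (by simp [hadd])
      map_smul' := fun c f => toFun_injective (by simp [hsmul]) } C
    (fun f => norm_le_of_wcoeff_le hC (h f))

theorem mkCLM_toFun {r r' : ℝ} (T : HsSpace r → ℝ → ℝ) (hT : ∀ f, T f ∈ HsReal r')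
    (hadd : ∀ f g, T (f + g) = T f + T g) (hsmul : ∀ (c : ℝ) f, T (c • f) = c • T f)
    (C : ℝ) (hC : 0 ≤ C) (h : ∀ f n, ‖wcoeff r' (T f) n‖ ≤ C * ‖wcoeff r f.toFun n‖)
    (f : HsSpace r) : (mkCLM T hT hadd hsmul C hC h f).toFun = T f := rfl

end HsSpace

open HsSpace

/-- Evaluation at a point. -/
def evalCLM {r : ℝ} (h : 1 / 2 < r) (x : ℝ) : HsSpace r →L[ℝ] ℝ :=
  LinearMap.mkContinuous
    { toFun := fun f => f.toFun x
      map_add' := fun _ _ => rfl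
      map_smul' := fun _ _ => rfl } (embConst r) (fun f => abs_apply_le h f x)

@[simp] theorem evalCLM_apply {r : ℝ} (h : 1 / 2 < r) (x : ℝ) (f : HsSpace r) :
    evalCLM h x f = f.toFun x := rfl

/-- The inclusion `H^r ⊆ H^r'` for `r' ≤ r`. -/
def inclCLM {r r' : ℝ} (h : r' ≤ r) : HsSpace r →L[ℝ] HsSpace r' :=
  mkCLM (fun f => f.toFun) (fun f => HsReal_anti h f.mem) (fun _ _ => rfl) (fun _ _ => rfl) 1
    zero_le_one (fun f n => by
      rw [one_mul, norm_wcoeff, norm_wcoeff]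
      have := weight_le_weight h n
      gcongr)

@[simp] theorem inclCLM_toFun {r r' : ℝ} (h : r' ≤ r) (f : HsSpace r) :
    (inclCLM h f).toFun = f.toFun := mkCLM_toFun _ _ _ _ _ _ _ _

theorem deriv_mem_HsReal {r : ℝ} (h : 1 / 2 < r) {f : ℝ → ℝ} (hf : f ∈ HsReal (r + 1)) :
    deriv f ∈ HsReal r := by
  have := deriv_mem_Hs (s := (r : WithTop ℝ)) (contDiff_one_of_mem (by linarith) hf) hf.2.1
    (by exact_mod_cast mem_Hs_coe.mpr hf)
  exact mem_Hs_coe.mp this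

theorem HsSpace.differentiable {r : ℝ} (h : 1 / 2 < r) (f : HsSpace (r + 1)) :
    Differentiable ℝ f.toFun :=
  (contDiff_one_of_mem (by linarith) f.mem).differentiable one_ne_zero

/-- The derivative as an operator `H^(r+1) → H^r`. -/
def derivCLM {r : ℝ} (h : 1 / 2 < r) : HsSpace (r + 1) →L[ℝ] HsSpace r :=
  mkCLM (fun f => deriv f.toFun) (fun f => deriv_mem_HsReal h f.mem)
    (fun f g => funext fun x => deriv_add (f.differentiable h x) (g.differentiable h x))
    (fun c f => funext fun x => deriv_const_smul c (f.differentiable h x)) (2 * Real.pi)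
    (by positivity) (fun f n => by
      have := weight_mul_coeff_deriv_le (contDiff_one_of_mem (by linarith) f.mem) f.periodic r n
      rwa [norm_mul, Complex.norm_real, Real.norm_of_nonneg (by positivity)] at this)

@[simp] theorem derivCLM_toFun {r : ℝ} (h : 1 / 2 < r) (f : HsSpace (r + 1)) :
    (derivCLM h f).toFun = deriv f.toFun := mkCLM_toFun _ _ _ _ _ _ _ _

/-- Integration by parts on one period. The mode `0` is separate: there the claim is that a
derivative of a periodic function has mean zero. -/
theorem coeff_of_hasDerivAt {f f' : ℝ → ℝ} (hd : ∀ x, HasDerivAt f (f' x) x) (hc : Continuous f')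
    (hp : Function.Periodic f 1) (n : ℤ) :
    coeff f' n = 2 * Real.pi * Complex.I * n * coeff f n := by
  have hper : f 1 = f 0 := by simpa using hp 0
  by_cases h0 : n = 0
  · subst h0
    have hint : ∫ x in (0 : ℝ)..1, f' x = 0 := by
      rw [intervalIntegral.integral_eq_sub_of_hasDerivAt (fun x _ => hd x)
        (hc.intervalIntegrable _ _), hper, sub_self]
    rw [coeff_eq_integral]
    simp [intervalIntegral.integral_ofReal, hint]
  · have h := fourierCoeffOn_of_hasDerivAt (zero_lt_one' ℝ) (f := fun x => (f x : ℂ))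
      (f' := fun x => (f' x : ℂ)) (n := n) h0 (fun x _ => HasDerivAt.ofReal_comp (hd x))
      ((Complex.continuous_ofReal.comp hc).intervalIntegrable _ _)
    have h' : coeff f n = 1 / (-2 * Real.pi * Complex.I * n) * (-coeff f' n) := by
      unfold coeff
      rw [h, hper]
      simp
    have hn0 : (n : ℂ) ≠ 0 := by exact_mod_cast h0
    have hpi : (Real.pi : ℂ) ≠ 0 := by exact_mod_cast Real.pi_ne_zero
    rw [h']
    have := Complex.I_ne_zero
    field_simp

theorem coeff_zero_eq (f : ℝ → ℝ) : coeff f 0 = ((∫ x in (0 : ℝ)..1, f x : ℝ) : ℂ) := by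
  rw [coeff_eq_integral]
  simp [intervalIntegral.integral_ofReal]

theorem coeff_const (c : ℝ) {n : ℤ} (hn : n ≠ 0) : coeff (fun _ => c) n = 0 := by
  have h := coeff_of_hasDerivAt (f := fun _ => c) (f' := fun _ => 0)
    (fun x => hasDerivAt_const x c) continuous_const (fun _ => rfl) n
  have h0 : coeff (fun _ => 0) n = 0 := by
    rw [coeff_eq_integral]
    simp
  rw [h0] at h
  have hn0 : (n : ℂ) ≠ 0 := by exact_mod_cast hn
  have hpi : (Real.pi : ℂ) ≠ 0 := by exact_mod_cast Real.pi_ne_zero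
  simpa [hn0, hpi, eq_comm] using h

/-- The primitive of mean zero of `f` minus its mean. -/
def primitive (f : ℝ → ℝ) (x : ℝ) : ℝ :=
  (∫ y in (0 : ℝ)..x, (f y - ∫ z in (0 : ℝ)..1, f z)) -
    ∫ w in (0 : ℝ)..1, ∫ y in (0 : ℝ)..w, (f y - ∫ z in (0 : ℝ)..1, f z)

theorem hasDerivAt_primitive {f : ℝ → ℝ} (hf : Continuous f) (x : ℝ) :
    HasDerivAt (primitive f) (f x - ∫ z in (0 : ℝ)..1, f z) x := by
  have hc : Continuous fun y => f y - ∫ z in (0 : ℝ)..1, f z := by fun_prop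
  exact (hc.integral_hasStrictDerivAt 0 x).hasDerivAt.sub_const _

theorem continuous_primitive {f : ℝ → ℝ} (hf : Continuous f) : Continuous (primitive f) :=
  continuous_iff_continuousAt.mpr fun x => (hasDerivAt_primitive hf x).continuousAt

theorem periodic_primitive {f : ℝ → ℝ} (hf : Continuous f) (hp : Function.Periodic f 1) :
    Function.Periodic (primitive f) 1 := by
  intro x
  have hi : ∀ a b, IntervalIntegrable (fun y => f y - ∫ z in (0 : ℝ)..1, f z) volume a b :=
    fun a b => by apply Continuous.intervalIntegrable; fun_prop
  have hp' : Function.Periodic (fun y => f y - ∫ z in (0 : ℝ)..1, f z) 1 := fun y => by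
    simp [hp y]
  have h1 := intervalIntegral.integral_add_adjacent_intervals (hi 0 x) (hi x (x + 1))
  have h2 := hp'.intervalIntegral_add_eq x 0
  rw [zero_add] at h2
  have h3 : ∫ y in (0 : ℝ)..1, (f y - ∫ z in (0 : ℝ)..1, f z) = 0 := by
    rw [intervalIntegral.integral_sub (hf.intervalIntegrable _ _) (by simp)]
    simp
  unfold primitive
  rw [← h1, h2, h3, add_zero]

theorem integral_primitive {f : ℝ → ℝ} (hf : Continuous f) :
    ∫ x in (0 : ℝ)..1, primitive f x = 0 := by
  have h : Continuous fun x => ∫ y in (0 : ℝ)..x, (f y - ∫ z in (0 : ℝ)..1, f z) :=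
    intervalIntegral.continuous_primitive
      (fun a b => by apply Continuous.intervalIntegrable; fun_prop) 0
  unfold primitive
  rw [intervalIntegral.integral_sub (h.intervalIntegrable _ _) (by simp)]
  simp

/-- The constant `1` suffices because `weight 1 n ≤ 2|n| ≤ 2π|n|` for `n ≠ 0`, and the mode `0`
vanishes thanks to the mean-zero normalization of `primitive`. -/
theorem norm_wcoeff_primitive_le {f : ℝ → ℝ} (hf : Continuous f) (hp : Function.Periodic f 1)
    (r : ℝ) (n : ℤ) : ‖wcoeff (r + 1) (primitive f) n‖ ≤ 1 * ‖wcoeff r f n‖ := by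
  rw [one_mul, norm_wcoeff, norm_wcoeff]
  rcases eq_or_ne n 0 with rfl | hn
  · rw [coeff_zero_eq (primitive f), integral_primitive hf]
    simp only [Complex.ofReal_zero, norm_zero, mul_zero]
    exact mul_nonneg (weight_pos r 0).le (norm_nonneg _)
  · set c := ∫ z in (0 : ℝ)..1, f z with hcdef
    have h1 := coeff_of_hasDerivAt (hasDerivAt_primitive hf) (by fun_prop)
      (periodic_primitive hf hp) n
    have h2 : (fun x => f x - c) = f + fun _ => -c := by ext x; simp [sub_eq_add_neg]
    rw [← hcdef, h2, coeff_add hf continuous_const, coeff_const _ hn, add_zero] at h1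
    have h3 : ‖coeff f n‖ = 2 * Real.pi * |(n : ℝ)| * ‖coeff (primitive f) n‖ := by
      rw [h1]
      simp [abs_of_pos Real.pi_pos]
    rw [h3, weight_add]
    have h4 := weight_one_le hn
    have h5 := Real.pi_gt_three
    have h6 : weight 1 n ≤ 2 * Real.pi * |(n : ℝ)| := by
      nlinarith [abs_nonneg (n : ℝ)]
    have := (weight_pos r n).le
    calc weight r n * weight 1 n * ‖coeff (primitive f) n‖
        ≤ weight r n * (2 * Real.pi * |(n : ℝ)|) * ‖coeff (primitive f) n‖ := by gcongr
      _ = _ := by ring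

theorem primitive_mem {r : ℝ} {f : ℝ → ℝ} (hf : f ∈ HsReal r) : primitive f ∈ HsReal (r + 1) := by
  refine ⟨continuous_primitive hf.1, periodic_primitive hf.1 hf.2.1, ?_⟩
  apply memℓp_gen
  have h4 := (memℓp_gen_iff (by norm_num)).mp hf.2.2
  refine h4.of_nonneg_of_le (fun n => by positivity) (fun n => ?_)
  refine Real.rpow_le_rpow (norm_nonneg _) ?_ (by norm_num)
  simpa using norm_wcoeff_primitive_le hf.1 hf.2.1 r n

theorem primitive_add {f g : ℝ → ℝ} (hf : Continuous f) (hg : Continuous g) :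
    primitive (f + g) = primitive f + primitive g := by
  have hi : ∀ {f : ℝ → ℝ}, Continuous f → ∀ (c a b : ℝ),
      IntervalIntegrable (fun y => f y - c) volume a b :=
    fun hf c a b => by apply Continuous.intervalIntegrable; fun_prop
  have hj : ∀ {f : ℝ → ℝ}, Continuous f → ∀ (c a b : ℝ),
      IntervalIntegrable (fun w => ∫ y in (0 : ℝ)..w, (f y - c)) volume a b :=
    fun hf c a b => (intervalIntegral.continuous_primitive (hi hf c) 0).intervalIntegrable _ _
  have h : ∀ x, ∫ y in (0 : ℝ)..x, ((f + g) y - ∫ z in (0 : ℝ)..1, (f + g) z) =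
      (∫ y in (0 : ℝ)..x, (f y - ∫ z in (0 : ℝ)..1, f z)) +
        ∫ y in (0 : ℝ)..x, (g y - ∫ z in (0 : ℝ)..1, g z) := by
    intro x
    rw [← intervalIntegral.integral_add (hi hf _ _ _) (hi hg _ _ _)]
    simp only [Pi.add_apply]
    rw [intervalIntegral.integral_add (hf.intervalIntegrable _ _) (hg.intervalIntegrable _ _)]
    congr 1
    ext y
    ring
  ext x
  simp only [primitive, Pi.add_apply]
  simp only [Pi.add_apply] at h
  simp only [h]
  rw [intervalIntegral.integral_add (hj hf _ _ _) (hj hg _ _ _)]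
  ring

theorem primitive_smul (c : ℝ) (f : ℝ → ℝ) : primitive (c • f) = c • primitive f := by
  ext x
  simp only [primitive, Pi.smul_apply, smul_eq_mul, intervalIntegral.integral_const_mul, ← mul_sub]

/-- The primitive of mean zero as an operator `H^r → H^(r+1)`. -/
def primitiveCLM (r : ℝ) : HsSpace r →L[ℝ] HsSpace (r + 1) :=
  mkCLM (fun f => primitive f.toFun) (fun f => primitive_mem f.mem)
    (fun f g => primitive_add f.continuous g.continuous) (fun c f => primitive_smul c f.toFun) 1
    zero_le_one (fun f n => norm_wcoeff_primitive_le f.continuous f.periodic r n)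

@[simp] theorem primitiveCLM_toFun {r : ℝ} (f : HsSpace r) :
    (primitiveCLM r f).toFun = primitive f.toFun := mkCLM_toFun _ _ _ _ _ _ _ _

/-! ### Trigonometric functions -/

/-- The equation `f'' = -(2πk)² f` gives `(n² - k²) f̂(n) = 0`, so only the modes `±k` survive and
every weighted sum is finite. -/
theorem mem_HsReal_of_hasDerivAt {f g : ℝ → ℝ} {k : ℤ} (hf : ∀ x, HasDerivAt f (g x) x)
    (hg : ∀ x, HasDerivAt g (-(2 * Real.pi * k) ^ 2 * f x) x) (hp : Function.Periodic f 1)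
    (r : ℝ) : f ∈ HsReal r := by
  have hfc : Continuous f := continuous_iff_continuousAt.mpr fun x => (hf x).continuousAt
  have hgc : Continuous g := continuous_iff_continuousAt.mpr fun x => (hg x).continuousAt
  have hgp : Function.Periodic g 1 := fun x => by
    have h1 := (hf (x + 1)).comp_add_const x 1
    have h2 : (fun y => f (y + 1)) = f := funext hp
    rw [h2] at h1
    exact h1.unique (hf x)
  refine ⟨hfc, hp, ?_⟩
  apply memℓp_gen
  refine summable_of_ne_finset_zero (s := {k, -k}) (fun n hn => ?_)
  have h1 := coeff_of_hasDerivAt hf hgc hp n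
  have h2 := coeff_of_hasDerivAt hg (by fun_prop) hgp n
  have h3 : (fun x => -(2 * Real.pi * k) ^ 2 * f x) = (-(2 * Real.pi * k) ^ 2 : ℝ) • f := rfl
  rw [h3, coeff_smul, h1] at h2
  have hpi : (Real.pi : ℂ) ≠ 0 := by exact_mod_cast Real.pi_ne_zero
  have h4 : (2 * (Real.pi : ℂ)) ^ 2 * (((n : ℂ) - k) * ((n : ℂ) + k) * coeff f n) = 0 := by
    push_cast at h2
    linear_combination h2 + (2 * (Real.pi : ℂ)) ^ 2 * n ^ 2 * coeff f n * Complex.I_sq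
  simp only [Finset.mem_insert, Finset.mem_singleton, not_or] at hn
  have h5 : (n : ℂ) - k ≠ 0 := by
    rw [sub_ne_zero]
    exact_mod_cast hn.1
  have h6 : (n : ℂ) + k ≠ 0 := by
    rw [← sub_neg_eq_add, sub_ne_zero]
    exact_mod_cast hn.2
  have h7 : coeff f n = 0 := by simpa [hpi, h5, h6] using h4
  simp [wcoeff, h7]

/-- The function `cos (2πkx)`. -/
def cosFun (k : ℤ) (x : ℝ) : ℝ := Real.cos (2 * Real.pi * k * x)

/-- The function `sin (2πkx)`. -/
def sinFun (k : ℤ) (x : ℝ) : ℝ := Real.sin (2 * Real.pi * k * x)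

theorem periodic_cosFun (k : ℤ) : Function.Periodic (cosFun k) 1 := fun x => by
  unfold cosFun
  rw [show 2 * Real.pi * k * (x + 1) = 2 * Real.pi * k * x + k * (2 * Real.pi) by ring,
    Real.cos_add_int_mul_two_pi]

theorem periodic_sinFun (k : ℤ) : Function.Periodic (sinFun k) 1 := fun x => by
  unfold sinFun
  rw [show 2 * Real.pi * k * (x + 1) = 2 * Real.pi * k * x + k * (2 * Real.pi) by ring,
    Real.sin_add_int_mul_two_pi]

theorem hasDerivAt_cosFun (k : ℤ) (x : ℝ) :
    HasDerivAt (cosFun k) (-(2 * Real.pi * k) * sinFun k x) x := by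
  have h := ((hasDerivAt_id x).const_mul (2 * Real.pi * k)).cos
  convert! h using 1
  simp [sinFun]
  ring

theorem hasDerivAt_sinFun (k : ℤ) (x : ℝ) :
    HasDerivAt (sinFun k) ((2 * Real.pi * k) * cosFun k x) x := by
  have h := ((hasDerivAt_id x).const_mul (2 * Real.pi * k)).sin
  convert! h using 1
  simp [cosFun]
  ring

theorem cosFun_mem (k : ℤ) (r : ℝ) : cosFun k ∈ HsReal r := by
  refine mem_HsReal_of_hasDerivAt (k := k) (hasDerivAt_cosFun k) (fun x => ?_) (periodic_cosFun k) r
  convert! (hasDerivAt_sinFun k x).const_mul (-(2 * Real.pi * k)) using 1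
  ring

theorem sinFun_mem (k : ℤ) (r : ℝ) : sinFun k ∈ HsReal r := by
  refine mem_HsReal_of_hasDerivAt (k := k) (hasDerivAt_sinFun k) (fun x => ?_) (periodic_sinFun k) r
  convert! (hasDerivAt_cosFun k x).const_mul (2 * Real.pi * k) using 1
  ring

theorem contDiff_cosFun (k : ℤ) {n : WithTop ℕ∞} : ContDiff ℝ n (cosFun k) := by
  unfold cosFun
  fun_prop

theorem contDiff_sinFun (k : ℤ) {n : WithTop ℕ∞} : ContDiff ℝ n (sinFun k) := by
  unfold sinFun
  fun_prop

/-- Variations and test functions are real, so vanishing of complex coefficients has to be read off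
from real integrals. -/
theorem coeff_eq_cos_sin {f : ℝ → ℝ} (hf : Continuous f) (n : ℤ) :
    coeff f n = ((∫ x in (0 : ℝ)..1, f x * cosFun n x : ℝ) : ℂ) -
      Complex.I * ((∫ x in (0 : ℝ)..1, f x * sinFun n x : ℝ) : ℂ) := by
  have hc := (contDiff_cosFun n (n := 0)).continuous
  have hs := (contDiff_sinFun n (n := 0)).continuous
  rw [coeff_eq_integral, ← intervalIntegral.integral_ofReal, ← intervalIntegral.integral_ofReal,
    ← intervalIntegral.integral_const_mul, ← intervalIntegral.integral_sub]
  · congr 1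
    ext x
    rw [fourier_coe_apply]
    have : 2 * Real.pi * Complex.I * ((-n : ℤ) : ℂ) * x / (1 : ℝ) =
        ((-(2 * Real.pi * n * x) : ℝ) : ℂ) * Complex.I := by
      push_cast
      ring
    rw [this, Complex.exp_mul_I, ← Complex.ofReal_cos, ← Complex.ofReal_sin, Real.cos_neg,
      Real.sin_neg]
    simp only [cosFun, sinFun]
    push_cast
    ring
  · apply Continuous.intervalIntegrable
    fun_prop
  · apply Continuous.intervalIntegrable
    fun_prop

/-- A continuous periodic function orthogonal to all nonconstant trigonometric functions is
constant. -/
theorem eq_mean_of_orthogonal {f : ℝ → ℝ} (hf : Continuous f) (hp : Function.Periodic f 1)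
    (hcos : ∀ n : ℤ, n ≠ 0 → ∫ x in (0 : ℝ)..1, f x * cosFun n x = 0)
    (hsin : ∀ n : ℤ, n ≠ 0 → ∫ x in (0 : ℝ)..1, f x * sinFun n x = 0) (x : ℝ) :
    f x = ∫ y in (0 : ℝ)..1, f y := by
  set c := ∫ y in (0 : ℝ)..1, f y with hc
  have h : f + (fun _ => -c) = 0 := by
    refine eq_zero_of_coeff_eq_zero (hf.add continuous_const) (hp.add fun _ => rfl) fun n => ?_
    rcases eq_or_ne n 0 with rfl | hn
    · rw [coeff_zero_eq]
      simp only [Pi.add_apply]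
      rw [intervalIntegral.integral_add (hf.intervalIntegrable _ _) (by simp)]
      simp [hc]
    · rw [coeff_add hf continuous_const, coeff_const _ hn, coeff_eq_cos_sin hf, hcos n hn,
        hsin n hn]
      simp
  have h2 := congrFun h x
  simp only [Pi.add_apply, Pi.zero_apply] at h2
  linarith

/-! ### Curves in Sobolev spaces -/

/-- Provides one finite exponent to work in, so that `s = ∞` needs no separate treatment. -/
theorem exists_exponent {s : WithTop ℝ} {c : ℝ} (hs : (c : WithTop ℝ) < s) :
    ∃ r : ℝ, c < r ∧ (r : WithTop ℝ) ≤ s := by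
  induction s using WithTop.recTopCoe with
  | top => exact ⟨c + 1, by linarith, le_top⟩
  | coe a => exact ⟨a, WithTop.coe_lt_coe.mp hs, le_rfl⟩

theorem coe_sub_one_le {s : WithTop ℝ} {r : ℝ} (h : (r : WithTop ℝ) ≤ s + 1) :
    ((r - 1 : ℝ) : WithTop ℝ) ≤ s := by
  induction s using WithTop.recTopCoe with
  | top => exact le_top
  | coe a =>
    have h' : r ≤ a + 1 := by exact_mod_cast h
    exact WithTop.coe_le_coe.mpr (by linarith)

theorem coe_add_one_le {s : WithTop ℝ} {r : ℝ} (h : (r : WithTop ℝ) ≤ s) :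
    ((r + 1 : ℝ) : WithTop ℝ) ≤ s + 1 := by
  rw [WithTop.coe_add, WithTop.coe_one]
  gcongr

theorem mem_Hs_of_forall {s : WithTop ℝ} (hs : ((1 / 2 : ℝ) : WithTop ℝ) < s) {f : ℝ → ℝ}
    (h : ∀ r : ℝ, 1 / 2 < r → (r : WithTop ℝ) ≤ s → f ∈ HsReal r) : f ∈ Hs s := by
  obtain ⟨r₀, h₀, hr₀⟩ := exists_exponent hs
  rw [mem_Hs]
  intro r hr
  rcases lt_or_ge (1 / 2) r with hlt | hle
  · exact h r hlt hr
  · exact HsReal_anti (by linarith) (h r₀ h₀ hr₀)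

theorem primitive_mem_Hs {s : WithTop ℝ} {f : ℝ → ℝ} (hf : f ∈ Hs s) :
    primitive f ∈ Hs (s + 1) := by
  rw [mem_Hs] at hf ⊢
  intro r hr
  have := primitive_mem (hf (r - 1) (coe_sub_one_le hr))
  rwa [sub_add_cancel] at this

section

variable {k : ℕ} {s : WithTop ℝ} {I : Set ℝ} {u w : ℝ → ℝ → ℝ}

theorem IsCurve.of_le {k' : ℕ} (h : IsCurve k s I u) (hk : k' ≤ k) : IsCurve k' s I u := by
  intro r h1 h2
  obtain ⟨U, hU, hu⟩ := h r h1 h2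
  exact ⟨U, hU.of_le (by exact_mod_cast hk), hu⟩

theorem IsCurve.anti {s' : WithTop ℝ} (h : IsCurve k s I u) (hs : s' ≤ s) : IsCurve k s' I u :=
  fun r h1 h2 => h r h1 (h2.trans hs)

theorem IsCurve.congr (h : IsCurve k s I u) (hw : ∀ t ∈ I, w t = u t) : IsCurve k s I w := by
  intro r h1 h2
  obtain ⟨U, hU, hu⟩ := h r h1 h2
  exact ⟨U, hU, fun t ht => (hu t ht).trans (hw t ht).symm⟩

theorem IsCurve.add (h : IsCurve k s I u) (h' : IsCurve k s I w) :
    IsCurve k s I (fun t x => u t x + w t x) := by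
  intro r h1 h2
  obtain ⟨U, hU, hu⟩ := h r h1 h2
  obtain ⟨W, hW, hw⟩ := h' r h1 h2
  refine ⟨fun t => U t + W t, hU.add hW, fun t ht => ?_⟩
  rw [toFun_add, hu t ht, hw t ht]
  rfl

theorem isCurve_smul {c : ℝ → ℝ} (hc : ContDiffOn ℝ k c I) {f : ℝ → ℝ}
    (hf : ∀ r : ℝ, 1 / 2 < r → (r : WithTop ℝ) ≤ s → f ∈ HsReal r) :
    IsCurve k s I (fun t x => c t * f x) := by
  intro r h1 h2
  exact ⟨fun t => c t • ofMem f (hf r h1 h2), hc.smul contDiffOn_const, fun t _ => rfl⟩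

theorem isCurve_scalar {c : ℝ → ℝ} (hc : ContDiffOn ℝ k c I) :
    IsCurve k s I (fun t _ => c t) := by
  have := isCurve_smul (s := s) hc (f := fun _ => 1) (fun r _ _ => mem_Hs_coe.mp (const_mem_Hs r 1))
  simpa using this

theorem IsCurve.comp_clm (h : IsCurve k s I u) {r r' : ℝ} (hr : 1 / 2 < r)
    (hrs : (r : WithTop ℝ) ≤ s) (T : HsSpace r →L[ℝ] HsSpace r')
    {w : ℝ → ℝ → ℝ} (hw : ∀ t ∈ I, ∀ f : HsSpace r, f.toFun = u t → (T f).toFun = w t) :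
    ∃ W : ℝ → HsSpace r', ContDiffOn ℝ k W I ∧ ∀ t ∈ I, (W t).toFun = w t := by
  obtain ⟨U, hU, hu⟩ := h r hr hrs
  exact ⟨fun t => T (U t), T.contDiff.comp_contDiffOn hU, fun t ht => hw t ht _ (hu t ht)⟩

theorem IsCurve.periodic (hs : ((1 / 2 : ℝ) : WithTop ℝ) < s) (h : IsCurve k s I u) {t : ℝ}
    (ht : t ∈ I) : Function.Periodic (u t) 1 := by
  obtain ⟨r, h1, h2⟩ := exists_exponent hs
  obtain ⟨U, -, hu⟩ := h r h1 h2
  rw [← hu t ht]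
  exact (U t).periodic

theorem IsCurve.continuous (hs : ((1 / 2 : ℝ) : WithTop ℝ) < s) (h : IsCurve k s I u) {t : ℝ}
    (ht : t ∈ I) : Continuous (u t) := by
  obtain ⟨r, h1, h2⟩ := exists_exponent hs
  obtain ⟨U, -, hu⟩ := h r h1 h2
  rw [← hu t ht]
  exact (U t).continuous

theorem IsCurve.mem_Hs (hs : ((1 / 2 : ℝ) : WithTop ℝ) < s) (h : IsCurve k s I u) {t : ℝ}
    (ht : t ∈ I) : u t ∈ Hs s := by
  refine mem_Hs_of_forall hs fun r h1 h2 => ?_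
  obtain ⟨U, -, hu⟩ := h r h1 h2
  rw [← hu t ht]
  exact (U t).mem

/-- A continuous curve in `H^s` is jointly continuous. -/
theorem IsCurve.continuousOn (hs : ((1 / 2 : ℝ) : WithTop ℝ) < s) (h : IsCurve k s I u) :
    ContinuousOn (fun p : ℝ × ℝ => u p.1 p.2) (I ×ˢ univ) := by
  obtain ⟨r, h1, h2⟩ := exists_exponent hs
  obtain ⟨U, hU, hu⟩ := h r h1 h2
  have hUc := hU.continuousOn
  rintro ⟨t, x⟩ ⟨ht, -⟩
  simp only at ht
  -- The change in time is small uniformly in space by the sup-norm bound; what remains is the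
  -- continuity of the single function `U t`.
  have hlim : Tendsto (fun p : ℝ × ℝ => (U p.1 - U t).toFun p.2 + (U t).toFun p.2)
      (𝓝[I ×ˢ univ] (t, x)) (𝓝 (0 + (U t).toFun x)) := by
    refine Tendsto.add ?_ ?_
    · have hfst : Tendsto (fun p : ℝ × ℝ => p.1) (𝓝[I ×ˢ univ] (t, x)) (𝓝[I] t) :=
        tendsto_nhdsWithin_iff.mpr ⟨(continuous_fst.tendsto (t, x)).mono_left nhdsWithin_le_nhds,
          eventually_nhdsWithin_of_forall fun p hp => hp.1⟩
      have h3 : Tendsto (fun p : ℝ × ℝ => embConst r * ‖U p.1 - U t‖) (𝓝[I ×ˢ univ] (t, x))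
          (𝓝 0) := by
        have h4 : Tendsto (fun τ => embConst r * ‖U τ - U t‖) (𝓝[I] t) (𝓝 0) := by
          have := ((hUc t ht).tendsto.sub_const (U t)).norm.const_mul (embConst r)
          simpa using this
        exact h4.comp hfst
      exact squeeze_zero_norm (fun p => (U p.1 - U t).abs_apply_le h1 p.2) h3
    · exact (((U t).continuous.tendsto x).comp (continuous_snd.tendsto (t, x))).mono_left
        nhdsWithin_le_nhds
  have heq : ∀ p ∈ I ×ˢ (univ : Set ℝ), u p.1 p.2 = (U p.1 - U t).toFun p.2 + (U t).toFun p.2 := by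
    rintro p ⟨hp, -⟩
    rw [toFun_sub, ← hu p.1 hp]
    simp
  rw [zero_add] at hlim
  rw [hu t ht] at hlim heq
  exact hlim.congr' (eventually_nhdsWithin_of_forall fun p hp => (heq p hp).symm)

theorem hasDerivAt_toFun {r : ℝ} (hr : 1 / 2 < r) {U : ℝ → HsSpace r} {U' : HsSpace r} {t : ℝ}
    (hU : HasDerivAt U U' t) (x : ℝ) : HasDerivAt (fun τ => (U τ).toFun x) (U'.toFun x) t :=
  (evalCLM hr x).hasFDerivAt.comp_hasDerivAt t hU

/-- Point evaluation is a bounded functional, so it commutes with the derivative of a Banach-valued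
curve; this identifies that derivative with the partial derivative in time. -/
theorem deriv_toFun_eq_dt (hI : IsOpen I) {r : ℝ} (hr : 1 / 2 < r) {U : ℝ → HsSpace r}
    (hU : ContDiffOn ℝ (k + 1 : ℕ) U I) (hu : ∀ t ∈ I, (U t).toFun = u t) {t : ℝ} (ht : t ∈ I) :
    (∀ x, HasDerivAt (fun τ => u τ x) ((deriv U t).toFun x) t) ∧ (deriv U t).toFun = dt u t := by
  have hd : HasDerivAt U (deriv U t) t :=
    ((hU.differentiableOn (by simp)).differentiableAt (hI.mem_nhds ht)).hasDerivAt
  have key : ∀ x, HasDerivAt (fun τ => u τ x) ((deriv U t).toFun x) t := by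
    intro x
    refine (hasDerivAt_toFun hr hd x).congr_of_eventuallyEq ?_
    filter_upwards [hI.mem_nhds ht] with τ hτ
    rw [hu τ hτ]
  exact ⟨key, funext fun x => (key x).deriv.symm⟩

theorem IsCurve.hasDerivAt (hI : IsOpen I) (hs : ((1 / 2 : ℝ) : WithTop ℝ) < s)
    (h : IsCurve (k + 1) s I u) {t : ℝ} (ht : t ∈ I) (x : ℝ) :
    HasDerivAt (fun τ => u τ x) (dt u t x) t := by
  obtain ⟨r, h1, h2⟩ := exists_exponent hs
  obtain ⟨U, hU, hu⟩ := h r h1 h2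
  obtain ⟨h3, h4⟩ := deriv_toFun_eq_dt hI h1 hU hu ht
  rw [← h4]
  exact h3 x

theorem IsCurve.dt (hI : IsOpen I) (h : IsCurve (k + 1) s I u) : IsCurve k s I (dt u) := by
  intro r h1 h2
  obtain ⟨U, hU, hu⟩ := h r h1 h2
  refine ⟨deriv U, ?_, fun t ht => (deriv_toFun_eq_dt hI h1 hU hu ht).2⟩
  exact hU.deriv_of_isOpen hI (by simp)

theorem IsCurve.dx (h : IsCurve k (s + 1) I u) : IsCurve k s I (dx u) := by
  intro r h1 h2
  refine h.comp_clm (r := r + 1) (by linarith) (coe_add_one_le h2) (derivCLM h1) ?_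
  rintro t - f hf
  rw [derivCLM_toFun, hf]
  rfl

theorem half_lt_add_one (hs : ((1 / 2 : ℝ) : WithTop ℝ) < s) :
    ((1 / 2 : ℝ) : WithTop ℝ) < s + 1 := by
  obtain ⟨r, h1, h2⟩ := exists_exponent hs
  refine lt_of_lt_of_le (WithTop.coe_lt_coe.mpr ?_) (coe_add_one_le h2)
  linarith

theorem IsCurve.contDiff (hs : ((1 / 2 : ℝ) : WithTop ℝ) < s) (h : IsCurve k (s + 1) I u)
    {t : ℝ} (ht : t ∈ I) : ContDiff ℝ 1 (u t) := by
  obtain ⟨r, h1, h2⟩ := exists_exponent hs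
  obtain ⟨U, -, hu⟩ := h (r + 1) (by linarith) (coe_add_one_le h2)
  rw [← hu t ht]
  exact contDiff_one_of_mem (by linarith) (U t).mem

theorem IsCurve.hasDerivAt_space (hs : ((1 / 2 : ℝ) : WithTop ℝ) < s) (h : IsCurve k (s + 1) I u)
    {t : ℝ} (ht : t ∈ I) (x : ℝ) : HasDerivAt (u t) (HunterSaxton.dx u t x) x :=
  ((h.contDiff hs ht).differentiable one_ne_zero x).hasDerivAt

/-- Mixed partials commute because `d/dx : H^(r+1) → H^r` is a bounded operator and hence passes
through the time derivative; no second-order joint smoothness is involved. -/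
theorem IsCurve.dt_dx (hI : IsOpen I) (hs : ((1 / 2 : ℝ) : WithTop ℝ) < s)
    (h : IsCurve (k + 1) (s + 1) I u) {t : ℝ} (ht : t ∈ I) :
    HunterSaxton.dt (HunterSaxton.dx u) t = HunterSaxton.dx (HunterSaxton.dt u) t := by
  obtain ⟨r, h1, h2⟩ := exists_exponent hs
  obtain ⟨U, hU, hu⟩ := h (r + 1) (by linarith) (coe_add_one_le h2)
  have h3 := (deriv_toFun_eq_dt hI (by linarith) hU hu ht).2
  have hd : HasDerivAt U (deriv U t) t :=
    ((hU.differentiableOn (by simp)).differentiableAt (hI.mem_nhds ht)).hasDerivAt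
  have h4 := (derivCLM h1).hasFDerivAt.comp_hasDerivAt t hd
  ext x
  have h5 := hasDerivAt_toFun h1 h4 x
  rw [derivCLM_toFun, h3] at h5
  refine HasDerivAt.deriv (h5.congr_of_eventuallyEq ?_)
  filter_upwards [hI.mem_nhds ht] with τ hτ
  simp only [Function.comp_apply, derivCLM_toFun]
  rw [hu τ hτ]
  rfl

theorem IsCurve.primitive (hs : ((1 / 2 : ℝ) : WithTop ℝ) < s) (h : IsCurve k s I u) :
    IsCurve k (s + 1) I (fun t => primitive (u t)) := by
  obtain ⟨r₀, h₀, hr₀⟩ := exists_exponent hs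
  intro r h1 h2
  -- The exponent `r - 1` may be at most `1/2`, where `IsCurve` says nothing, so the primitive is
  -- taken at a possibly larger exponent and the result included into `H^r`.
  have h3 : ((max (r - 1) r₀ : ℝ) : WithTop ℝ) ≤ s := by
    rcases max_choice (r - 1) r₀ with h | h <;> rw [h]
    exacts [coe_sub_one_le h2, hr₀]
  have h4 : r ≤ max (r - 1) r₀ + 1 := by linarith [le_max_left (r - 1) r₀]
  refine h.comp_clm (lt_of_lt_of_le h₀ (le_max_right _ _)) h3
    ((inclCLM h4).comp (primitiveCLM _)) ?_
  rintro t - f hf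
  rw [ContinuousLinearMap.comp_apply, inclCLM_toFun, primitiveCLM_toFun, hf]

theorem IsCurve.eval (hs : ((1 / 2 : ℝ) : WithTop ℝ) < s) (h : IsCurve k s I u) (x : ℝ) :
    ContDiffOn ℝ k (fun t => u t x) I := by
  obtain ⟨r, h1, h2⟩ := exists_exponent hs
  obtain ⟨U, hU, hu⟩ := h r h1 h2
  refine ((evalCLM h1 x).contDiff.comp_contDiffOn hU).congr fun t ht => ?_
  simp [hu t ht]

/-- The pairing `∫ f g` on `H^r`. -/
def pairing {r : ℝ} (hr : 1 / 2 < r) : HsSpace r →L[ℝ] HsSpace r →L[ℝ] ℝ :=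
  LinearMap.mkContinuous₂
    (LinearMap.mk₂ ℝ (fun f g : HsSpace r => ∫ x in (0 : ℝ)..1, f.toFun x * g.toFun x)
      (fun f f' g => by
        simp only [toFun_add, Pi.add_apply, add_mul]
        exact intervalIntegral.integral_add
          ((f.continuous.mul g.continuous).intervalIntegrable _ _)
          ((f'.continuous.mul g.continuous).intervalIntegrable _ _))
      (fun c f g => by
        simp only [toFun_smul, Pi.smul_apply, smul_eq_mul, mul_assoc]
        exact intervalIntegral.integral_const_mul _ _)
      (fun f g g' => by
        simp only [toFun_add, Pi.add_apply, mul_add]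
        exact intervalIntegral.integral_add
          ((f.continuous.mul g.continuous).intervalIntegrable _ _)
          ((f.continuous.mul g'.continuous).intervalIntegrable _ _))
      (fun c f g => by
        simp only [toFun_smul, Pi.smul_apply, smul_eq_mul, mul_left_comm]
        exact intervalIntegral.integral_const_mul _ _)) (embConst r * embConst r)
    (fun f g => by
      have h : ∀ x ∈ uIoc (0 : ℝ) 1, ‖f.toFun x * g.toFun x‖ ≤
          embConst r * ‖f‖ * (embConst r * ‖g‖) := fun x _ => by
        rw [norm_mul]
        have := embConst_nonneg r
        exact mul_le_mul (f.abs_apply_le hr x) (g.abs_apply_le hr x) (norm_nonneg _)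
          (by positivity)
      have h2 := intervalIntegral.norm_integral_le_of_norm_le_const h
      rw [sub_zero, abs_one, mul_one] at h2
      refine h2.trans (le_of_eq ?_)
      ring)

theorem pairing_apply {r : ℝ} (hr : 1 / 2 < r) (f g : HsSpace r) :
    pairing hr f g = ∫ x in (0 : ℝ)..1, f.toFun x * g.toFun x := rfl

/-- The pairing is bounded and bilinear, so it preserves `C^k` regularity in time. This will make
the normalizing function of time as smooth as needed. -/
theorem IsCurve.integral_mul (hs : ((1 / 2 : ℝ) : WithTop ℝ) < s) (h : IsCurve k s I u)
    (h' : IsCurve k s I w) : ContDiffOn ℝ k (fun t => ∫ x in (0 : ℝ)..1, u t x * w t x) I := by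
  obtain ⟨r, h1, h2⟩ := exists_exponent hs
  obtain ⟨U, hU, hu⟩ := h r h1 h2
  obtain ⟨W, hW, hw⟩ := h' r h1 h2
  have h3 : ContDiffOn ℝ k (fun t => pairing h1 (U t) (W t)) I :=
    ((pairing h1).contDiff.comp_contDiffOn hU).clm_apply hW
  refine h3.congr fun t ht => ?_
  rw [pairing_apply, hu t ht, hw t ht]

/-- A `C¹` curve in `H^(s+1)`, `s > 1/2`, is jointly strictly differentiable. -/
theorem IsCurve.hasStrictFDerivAt (hI : IsOpen I) (hs : ((1 / 2 : ℝ) : WithTop ℝ) < s)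
    (h : IsCurve (k + 1) (s + 1) I u) {t : ℝ} (ht : t ∈ I) (x : ℝ) :
    HasStrictFDerivAt (fun p : ℝ × ℝ => u p.1 p.2)
      ((ContinuousLinearMap.toSpanSingleton ℝ (HunterSaxton.dt u t x)).coprod
        (ContinuousLinearMap.toSpanSingleton ℝ (HunterSaxton.dx u t x))) (t, x) := by
  have hs' := half_lt_add_one hs
  have hopen : IsOpen (I ×ˢ (univ : Set ℝ)) := hI.prod isOpen_univ
  have hmem : I ×ˢ (univ : Set ℝ) ∈ 𝓝 (t, x) := hopen.mem_nhds ⟨ht, mem_univ _⟩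
  have hc : Continuous fun c : ℝ => ContinuousLinearMap.toSpanSingleton ℝ c :=
    (ContinuousLinearMap.toSpanSingletonCLE (𝕜 := ℝ) (E := ℝ)).continuous
  -- Strict differentiability comes from the joint continuity of both partial derivatives.
  refine hasStrictFDerivAt_uncurry_coprod (u := (t, x)) (f := u)
    (f₁ := fun t x => ContinuousLinearMap.toSpanSingleton ℝ (HunterSaxton.dt u t x))
    (f₂ := fun t x => ContinuousLinearMap.toSpanSingleton ℝ (HunterSaxton.dx u t x)) ?_ ?_ ?_ ?_
  · filter_upwards [hmem] with v hv
    exact (h.hasDerivAt hI hs' hv.1 v.2).hasFDerivAt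
  · filter_upwards [hmem] with v hv
    exact (h.hasDerivAt_space hs hv.1 v.2).hasFDerivAt
  · have := ((h.dt hI).continuousOn hs').continuousAt hmem
    exact hc.continuousAt.comp this
  · have := (h.dx.continuousOn hs).continuousAt hmem
    exact hc.continuousAt.comp this

end

/-! ### Integrals over space and time -/

/-- Joint continuity over `I × ℝ`. -/
abbrev JointCont (I : Set ℝ) (f : ℝ → ℝ → ℝ) : Prop :=
  ContinuousOn (fun p : ℝ × ℝ => f p.1 p.2) (I ×ˢ univ)

theorem JointCont.space {I : Set ℝ} {f : ℝ → ℝ → ℝ} (h : JointCont I f) {t : ℝ} (ht : t ∈ I) :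
    Continuous (f t) := by
  rw [← continuousOn_univ]
  exact h.comp (f := fun x => (t, x)) (by fun_prop) (fun x _ => ⟨ht, mem_univ _⟩)

theorem JointCont.time {I : Set ℝ} {f : ℝ → ℝ → ℝ} (h : JointCont I f) (x : ℝ) :
    ContinuousOn (fun t => f t x) I :=
  h.comp (f := fun t => (t, x)) (by fun_prop) (fun t ht => ⟨ht, mem_univ _⟩)

theorem JointCont.integral {I : Set ℝ} {f : ℝ → ℝ → ℝ} (h : JointCont I f) (a b : ℝ) :
    ContinuousOn (fun t => ∫ x in a..b, f t x) I := by
  rw [continuousOn_iff_continuous_domRestrict]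
  have : Continuous (Function.uncurry fun (t : I) (x : ℝ) => f t x) :=
    h.comp_continuous (f := fun p : I × ℝ => ((p.1 : ℝ), p.2)) (by fun_prop)
      (fun p => ⟨p.1.2, mem_univ _⟩)
  exact intervalIntegral.continuous_parametric_intervalIntegral_of_continuous' this a b

theorem JointCont.mono {I J : Set ℝ} {f : ℝ → ℝ → ℝ} (h : JointCont I f) (hJ : J ⊆ I) :
    JointCont J f := ContinuousOn.mono h (prod_mono hJ subset_rfl)

/-- Freezing time outside `[a, b]` gives globally continuous data with the same values on `[a, b]`,
as differentiation under the integral sign requires. -/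
theorem JointCont.clamp {I : Set ℝ} {f : ℝ → ℝ → ℝ} (h : JointCont I f) {a b : ℝ} (hab : a ≤ b)
    (hI : Icc a b ⊆ I) : Continuous fun p : ℝ × ℝ => f (projIcc a b hab p.1) p.2 :=
  h.comp_continuous (f := fun p : ℝ × ℝ => ((projIcc a b hab p.1 : ℝ), p.2))
    ((continuous_subtype_val.comp (continuous_projIcc.comp continuous_fst)).prodMk continuous_snd)
    (fun p => ⟨hI (projIcc a b hab p.1).2, mem_univ _⟩)

theorem JointCont.swap {f : ℝ → ℝ → ℝ} {a b c d : ℝ} (hab : a ≤ b) (hcd : c ≤ d)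
    (h : JointCont (Icc a b) f) :
    ∫ t in a..b, ∫ x in c..d, f t x = ∫ x in c..d, ∫ t in a..b, f t x := by
  apply intervalIntegral_intervalIntegral_swap
  rw [uIoc_of_le hab, uIoc_of_le hcd]
  have h1 : IntegrableOn (fun p : ℝ × ℝ => f p.1 p.2) (Icc a b ×ˢ Icc c d) :=
    (ContinuousOn.mono h (prod_mono subset_rfl (subset_univ _))).integrableOn_compact
      (isCompact_Icc.prod isCompact_Icc)
  exact h1.mono_set (prod_mono Ioc_subset_Icc_self Ioc_subset_Icc_self)

/-- Integration by parts in time. -/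
theorem integral_integral_mul_deriv {a b : ℝ} (hab : a ≤ b) {u u' w w' : ℝ → ℝ → ℝ}
    (hu : JointCont (Icc a b) u) (hu' : JointCont (Icc a b) u') (hw : JointCont (Icc a b) w)
    (hw' : JointCont (Icc a b) w')
    (hdu : ∀ t ∈ Icc a b, ∀ x, HasDerivAt (fun τ => u τ x) (u' t x) t)
    (hdw : ∀ t ∈ Icc a b, ∀ x, HasDerivAt (fun τ => w τ x) (w' t x) t)
    (ha : ∀ x, w a x = 0) (hb : ∀ x, w b x = 0) :
    ∫ t in a..b, ∫ x in (0 : ℝ)..1, u t x * w' t x =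
      -∫ t in a..b, ∫ x in (0 : ℝ)..1, u' t x * w t x := by
  -- Fubini puts time innermost, so that the one-dimensional formula applies at each fixed `x`.
  rw [JointCont.swap (f := fun t x => u t x * w' t x) hab zero_le_one (hu.mul hw'),
    JointCont.swap (f := fun t x => u' t x * w t x) hab zero_le_one (hu'.mul hw),
    ← intervalIntegral.integral_neg]
  congr 1
  ext x
  have hIcc : uIcc a b = Icc a b := uIcc_of_le hab
  rw [intervalIntegral.integral_mul_deriv_eq_deriv_mul (u := fun t => u t x) (v := fun t => w t x)
    (u' := fun t => u' t x) (v' := fun t => w' t x)]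
  · simp [ha, hb]
  · exact fun t ht => hdu t (hIcc ▸ ht) x
  · exact fun t ht => hdw t (hIcc ▸ ht) x
  · exact (hIcc ▸ hu'.time x).intervalIntegrable
  · exact (hIcc ▸ hw'.time x).intervalIntegrable

/-- Differentiation under the integral sign. -/
theorem hasDerivAt_integral_of_continuous {F F' : ℝ → ℝ → ℝ} {a b δ ε : ℝ} (hab : a ≤ b)
    (hε : ε ∈ Ioo (-δ) δ) (hF : Continuous fun p : ℝ × ℝ => F p.1 p.2)
    (hF' : Continuous fun p : ℝ × ℝ => F' p.1 p.2)
    (hd : ∀ e ∈ Ioo (-δ) δ, ∀ t ∈ Icc a b, HasDerivAt (fun e => F e t) (F' e t) e) :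
    HasDerivAt (fun e => ∫ t in a..b, F e t) (∫ t in a..b, F' ε t) ε := by
  -- Compactness of the parameter rectangle supplies a constant dominating function.
  obtain ⟨C, hC⟩ := ((isCompact_Icc (a := -δ) (b := δ)).prod
    (isCompact_Icc (a := a) (b := b))).exists_bound_of_continuousOn hF'.continuousOn
  have hI : uIoc a b ⊆ Icc a b := by
    rw [uIoc_of_le hab]
    exact Ioc_subset_Icc_self
  refine (intervalIntegral.hasDerivAt_integral_of_dominated_loc_of_deriv_le
    (s := Ioo (-δ) δ) (bound := fun _ => C) (Ioo_mem_nhds hε.1 hε.2) ?_ ?_ ?_ ?_ ?_ ?_).2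
  · refine Eventually.of_forall fun e => ?_
    exact (hF.comp (by fun_prop : Continuous fun t : ℝ => (e, t))).aestronglyMeasurable
  · exact (hF.comp (by fun_prop : Continuous fun t : ℝ => (ε, t))).intervalIntegrable _ _
  · exact (hF'.comp (by fun_prop : Continuous fun t : ℝ => (ε, t))).aestronglyMeasurable
  · exact Eventually.of_forall fun t ht e he => hC (e, t) ⟨Ioo_subset_Icc_self he, hI ht⟩
  · simp
  · exact Eventually.of_forall fun t ht e he => hd e he t (hI ht)

/-- Differentiation under a double integral. -/
theorem hasDerivAt_integral_integral {F F' : ℝ → ℝ → ℝ → ℝ} {a b δ : ℝ} (hab : a ≤ b)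
    (hδ : 0 < δ) (hF : Continuous fun p : ℝ × ℝ × ℝ => F p.1 p.2.1 p.2.2)
    (hF' : Continuous fun p : ℝ × ℝ × ℝ => F' p.1 p.2.1 p.2.2)
    (hd : ∀ e ∈ Ioo (-δ) δ, ∀ t ∈ Icc a b, ∀ x ∈ Icc (0 : ℝ) 1,
      HasDerivAt (fun e => F e t x) (F' e t x) e) :
    HasDerivAt (fun e => ∫ t in a..b, ∫ x in (0 : ℝ)..1, F e t x)
      (∫ t in a..b, ∫ x in (0 : ℝ)..1, F' 0 t x) 0 := by
  have key : ∀ {G : ℝ → ℝ → ℝ → ℝ}, (Continuous fun p : ℝ × ℝ × ℝ => G p.1 p.2.1 p.2.2) →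
      Continuous fun p : ℝ × ℝ => ∫ x in (0 : ℝ)..1, G p.1 p.2 x := fun {G} hG => by
    have : Continuous (Function.uncurry fun (p : ℝ × ℝ) (x : ℝ) => G p.1 p.2 x) :=
      hG.comp (by fun_prop : Continuous fun q : (ℝ × ℝ) × ℝ => (q.1.1, q.1.2, q.2))
    exact intervalIntegral.continuous_parametric_intervalIntegral_of_continuous' this 0 1
  refine hasDerivAt_integral_of_continuous (F := fun e t => ∫ x in (0 : ℝ)..1, F e t x)
    (F' := fun e t => ∫ x in (0 : ℝ)..1, F' e t x) hab (δ := δ) (by simpa using hδ) (key hF)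
    (key hF') fun e he t ht => ?_
  exact hasDerivAt_integral_of_continuous (F := fun e x => F e t x) (F' := fun e x => F' e t x)
    zero_le_one he (hF.comp (by fun_prop : Continuous fun q : ℝ × ℝ => (q.1, t, q.2)))
    (hF'.comp (by fun_prop : Continuous fun q : ℝ × ℝ => (q.1, t, q.2)))
    (fun e he x hx => hd e he t ht x hx)

/-- The fundamental lemma of the calculus of variations. -/
theorem eq_zero_of_integral_mul_eq_zero {I : Set ℝ} (hI : IsOpen I) {G : ℝ → ℝ}
    (hG : ContinuousOn G I)
    (h : ∀ χ : ℝ → ℝ, ContDiff ℝ (⊤ : ℕ∞) χ → HasCompactSupport χ → tsupport χ ⊆ I →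
      ∫ t in I, χ t * G t = 0) {t : ℝ} (ht : t ∈ I) : G t = 0 := by
  have h1 : ∀ᵐ t, t ∈ I → G t = 0 := by
    refine hI.ae_eq_zero_of_integral_contDiff_smul_eq_zero
      (hG.locallyIntegrableOn hI.measurableSet) fun χ h1 h2 h3 => ?_
    rw [← h χ h1 h2 h3, setIntegral_eq_integral_of_forall_compl_eq_zero]
    · rfl
    · intro x hx
      rw [image_eq_zero_of_notMem_tsupport fun h => hx (h3 h), zero_mul]
  have h2 : G =ᵐ[volume.restrict I] fun _ => 0 := by
    rw [EventuallyEq, ae_restrict_iff' hI.measurableSet]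
    exact h1
  exact Measure.eqOn_open_of_ae_eq h2 hI hG continuousOn_const ht

theorem exists_Icc_subset {I K : Set ℝ} (hI : IsOpen I) (hI' : I.OrdConnected) (hne : I.Nonempty)
    (hK : IsCompact K) (hKI : K ⊆ I) : ∃ a b, a < b ∧ K ⊆ Ioo a b ∧ Icc a b ⊆ I := by
  obtain ⟨t₀, ht₀⟩ := hne
  -- Adding `t₀` covers the case where `K` is empty.
  have hK' : IsCompact (insert t₀ K) := hK.insert t₀
  have hsub : insert t₀ K ⊆ I := insert_subset ht₀ hKI
  obtain ⟨c, hc, hcle⟩ := hK'.exists_isLeast ⟨t₀, mem_insert _ _⟩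
  obtain ⟨d, hd, hdle⟩ := hK'.exists_isGreatest ⟨t₀, mem_insert _ _⟩
  obtain ⟨ε, hε, hball⟩ := Metric.isOpen_iff.mp hI c (hsub hc)
  obtain ⟨ε', hε', hball'⟩ := Metric.isOpen_iff.mp hI d (hsub hd)
  have hcd : c ≤ d := hcle hd
  refine ⟨c - ε / 2, d + ε' / 2, by linarith, fun t ht => ⟨?_, ?_⟩, ?_⟩
  · have := hcle (mem_insert_of_mem _ ht)
    linarith
  · have := hdle (mem_insert_of_mem _ ht)
    linarith
  · apply hI'.out
    · apply hball
      rw [Metric.mem_ball, Real.dist_eq, abs_lt]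
      constructor <;> linarith
    · apply hball'
      rw [Metric.mem_ball, Real.dist_eq, abs_lt]
      constructor <;> linarith

theorem setIntegral_eq_intervalIntegral {I K : Set ℝ} {a b : ℝ} (hab : a ≤ b)
    (hK : K ⊆ Ioo a b) (hIcc : Icc a b ⊆ I) {F : ℝ → ℝ} (hF : ∀ t, t ∉ K → F t = 0) :
    ∫ t in I, F t = ∫ t in a..b, F t := by
  rw [setIntegral_eq_integral_of_forall_compl_eq_zero, intervalIntegral.integral_of_le hab,
    setIntegral_eq_integral_of_forall_compl_eq_zero]
  · exact fun t ht => hF t fun h => ht (Ioo_subset_Ioc_self (hK h))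
  · exact fun t ht => hF t fun h => ht (hIcc (Ioo_subset_Icc_self (hK h)))

/-- Change of variables under a diffeomorphism of the circle. -/
theorem integral_comp_mul_deriv_circle {φ φ' F : ℝ → ℝ} (hφ : ∀ x, HasDerivAt φ (φ' x) x)
    (hφ' : Continuous φ') (hp : φ 1 = φ 0 + 1) (hF : Continuous F) (hFp : Function.Periodic F 1) :
    ∫ x in (0 : ℝ)..1, F x = ∫ y in (0 : ℝ)..1, F (φ y) * φ' y := by
  have h := intervalIntegral.integral_comp_mul_deriv (a := 0) (b := 1) (f := φ) (f' := φ') (g := F)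
    (fun x _ => hφ x) hφ'.continuousOn hF
  simp only [Function.comp_apply] at h
  rw [h, hp, hFp.intervalIntegral_add_eq (φ 0) 0, zero_add]

/-! ### The first variation of the energy -/

/-- The Euler–Lagrange expression in the direction of the density. -/
def elDensity (ρ θ : ℝ → ℝ → ℝ) (t x : ℝ) : ℝ :=
  dt θ t x ^ 2 + (dt ρ t x / ρ t x) ^ 2 - 2 * dt (dt ρ) t x / ρ t x

/-- The Euler–Lagrange expression in the direction of the fibre. -/
def elFibre (ρ θ : ℝ → ℝ → ℝ) (t x : ℝ) : ℝ :=
  dt (dt θ) t x * ρ t x + dt θ t x * dt ρ t x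

/-- The Euler–Lagrange equations of the energy. -/
def EulerLagrange (I : Set ℝ) (ρ θ : ℝ → ℝ → ℝ) : Prop :=
  ∀ t ∈ I, (∃ c, ∀ x, elDensity ρ θ t x = c) ∧ ∀ x, elFibre ρ θ t x = 0

/-- A `C²` curve of densities together with a `C²` curve of functions. -/
structure IsPair (s : WithTop ℝ) (I : Set ℝ) (ρ θ : ℝ → ℝ → ℝ) : Prop where
  isOpen : IsOpen I
  lt : ((1 / 2 : ℝ) : WithTop ℝ) < s
  density : IsCurve 2 s I ρ
  fibre : IsCurve 2 s I θ
  pos : ∀ t ∈ I, ∀ x, 0 < ρ t x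

namespace IsPair

variable {s : WithTop ℝ} {I : Set ℝ} {ρ θ : ℝ → ℝ → ℝ}

theorem jointCont_density (h : IsPair s I ρ θ) : JointCont I ρ := h.density.continuousOn h.lt

theorem jointCont_dt_density (h : IsPair s I ρ θ) : JointCont I (dt ρ) :=
  (h.density.dt h.isOpen).continuousOn h.lt

theorem jointCont_dt_dt_density (h : IsPair s I ρ θ) : JointCont I (dt (dt ρ)) :=
  ((h.density.dt h.isOpen).dt h.isOpen).continuousOn h.lt

theorem jointCont_dt_fibre (h : IsPair s I ρ θ) : JointCont I (dt θ) :=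
  (h.fibre.dt h.isOpen).continuousOn h.lt

theorem jointCont_dt_dt_fibre (h : IsPair s I ρ θ) : JointCont I (dt (dt θ)) :=
  ((h.fibre.dt h.isOpen).dt h.isOpen).continuousOn h.lt

theorem jointCont_quotient (h : IsPair s I ρ θ) : JointCont I (fun t x => dt ρ t x / ρ t x) :=
  h.jointCont_dt_density.div h.jointCont_density fun p hp => (h.pos p.1 hp.1 p.2).ne'

theorem jointCont_elDensity (h : IsPair s I ρ θ) : JointCont I (elDensity ρ θ) := by
  refine ((h.jointCont_dt_fibre.pow 2).add (h.jointCont_quotient.pow 2)).sub ?_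
  exact (continuousOn_const.mul h.jointCont_dt_dt_density).div h.jointCont_density
    fun p hp => (h.pos p.1 hp.1 p.2).ne'

theorem jointCont_elFibre (h : IsPair s I ρ θ) : JointCont I (elFibre ρ θ) :=
  (h.jointCont_dt_dt_fibre.mul h.jointCont_density).add
    (h.jointCont_dt_fibre.mul h.jointCont_dt_density)

theorem hasDerivAt_density (h : IsPair s I ρ θ) {t : ℝ} (ht : t ∈ I) (x : ℝ) :
    HasDerivAt (fun τ => ρ τ x) (dt ρ t x) t := h.density.hasDerivAt h.isOpen h.lt ht x

theorem hasDerivAt_dt_density (h : IsPair s I ρ θ) {t : ℝ} (ht : t ∈ I) (x : ℝ) :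
    HasDerivAt (fun τ => dt ρ τ x) (dt (dt ρ) t x) t :=
  (h.density.dt h.isOpen).hasDerivAt h.isOpen h.lt ht x

theorem hasDerivAt_dt_fibre (h : IsPair s I ρ θ) {t : ℝ} (ht : t ∈ I) (x : ℝ) :
    HasDerivAt (fun τ => dt θ τ x) (dt (dt θ) t x) t :=
  (h.fibre.dt h.isOpen).hasDerivAt h.isOpen h.lt ht x

theorem hasDerivAt_momentum (h : IsPair s I ρ θ) {t : ℝ} (ht : t ∈ I) (x : ℝ) :
    HasDerivAt (fun τ => dt θ τ x * ρ τ x) (elFibre ρ θ t x) t :=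
  (h.hasDerivAt_dt_fibre ht x).mul (h.hasDerivAt_density ht x)

end IsPair

theorem continuous_uncurry_slice {f : ℝ → ℝ → ℝ} (h : Continuous fun p : ℝ × ℝ => f p.1 p.2) :
    Continuous (fun q : ℝ × ℝ × ℝ => f q.2.1 q.2.2) :=
  h.comp (by fun_prop : Continuous fun q : ℝ × ℝ × ℝ => (q.2.1, q.2.2))

/-- The derivative of the energy density along a straight line, for jointly continuous data. -/
theorem hasDerivAt_integral_energy {a b c δ : ℝ} (hab : a ≤ b) (hδ : 0 < δ) (hc : 0 < c)
    {P A T r B H : ℝ → ℝ → ℝ} {m₁ m₂ : ℝ → ℝ}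
    (hP : Continuous fun p : ℝ × ℝ => P p.1 p.2) (hA : Continuous fun p : ℝ × ℝ => A p.1 p.2)
    (hT : Continuous fun p : ℝ × ℝ => T p.1 p.2) (hr : Continuous fun p : ℝ × ℝ => r p.1 p.2)
    (hB : Continuous fun p : ℝ × ℝ => B p.1 p.2) (hH : Continuous fun p : ℝ × ℝ => H p.1 p.2)
    (hm₁ : Continuous m₁) (hm₂ : Continuous m₂)
    (hlow : ∀ e ∈ Ioo (-δ) δ, ∀ t ∈ Icc a b, ∀ x ∈ Icc (0 : ℝ) 1, c < P t x + e * r t x) :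
    HasDerivAt (fun e => ∫ t in a..b, ∫ x in (0 : ℝ)..1,
        ((A t x + e * B t x) ^ 2 / (P t x + e * r t x) +
          (T t x + e * H t x - (e * m₁ t + e ^ 2 * m₂ t)) ^ 2 * (P t x + e * r t x)))
      (∫ t in a..b, ∫ x in (0 : ℝ)..1, (2 * (A t x / P t x) * B t x - (A t x / P t x) ^ 2 * r t x +
        2 * T t x * (H t x - m₁ t) * P t x + T t x ^ 2 * r t x)) 0 := by
  have hP' := continuous_uncurry_slice hP
  have hA' := continuous_uncurry_slice hA
  have hT' := continuous_uncurry_slice hT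
  have hr' := continuous_uncurry_slice hr
  have hB' := continuous_uncurry_slice hB
  have hH' := continuous_uncurry_slice hH
  -- Truncating the denominator from below keeps the integrand continuous everywhere; on the range
  -- of parameters that matters it equals the perturbed density.
  set N : ℝ → ℝ → ℝ → ℝ := fun e t x => max (P t x + e * r t x) c with hN
  have hNc : Continuous fun q : ℝ × ℝ × ℝ => N q.1 q.2.1 q.2.2 := by
    simp only [hN]
    fun_prop
  have hNpos : ∀ e t x, N e t x ≠ 0 := fun e t x => (lt_of_lt_of_le hc (le_max_right _ _)).ne'
  have hNeq : ∀ e ∈ Ioo (-δ) δ, ∀ t ∈ Icc a b, ∀ x ∈ Icc (0 : ℝ) 1,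
      N e t x = P t x + e * r t x := fun e he t ht x hx => max_eq_left (hlow e he t ht x hx).le
  have h0 : (0 : ℝ) ∈ Ioo (-δ) δ := by simpa using hδ
  -- The subtracted polynomial stands for the mean of the perturbed fibre velocity against the
  -- perturbed density.
  set X : ℝ → ℝ → ℝ → ℝ := fun e t x => T t x + e * H t x - (e * m₁ t + e ^ 2 * m₂ t) with hX
  set X' : ℝ → ℝ → ℝ → ℝ := fun e t x => H t x - (m₁ t + 2 * e * m₂ t) with hX'
  have hXc : Continuous fun q : ℝ × ℝ × ℝ => X q.1 q.2.1 q.2.2 := by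
    simp only [hX]
    fun_prop
  have hXc' : Continuous fun q : ℝ × ℝ × ℝ => X' q.1 q.2.1 q.2.2 := by
    simp only [hX']
    fun_prop
  have main := hasDerivAt_integral_integral (a := a) (b := b) (δ := δ)
    (F := fun e t x => (A t x + e * B t x) ^ 2 / N e t x + X e t x ^ 2 * (P t x + e * r t x))
    (F' := fun e t x => (2 * (A t x + e * B t x) * B t x * N e t x -
      (A t x + e * B t x) ^ 2 * r t x) / N e t x ^ 2 +
      (2 * X e t x * X' e t x * (P t x + e * r t x) + X e t x ^ 2 * r t x)) hab hδ ?_ ?_ ?_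
  · have hI : ∀ {t : ℝ}, t ∈ uIcc a b → t ∈ Icc a b := fun {t} ht => uIcc_of_le hab ▸ ht
    have hJ : ∀ {x : ℝ}, x ∈ uIcc (0 : ℝ) 1 → x ∈ Icc (0 : ℝ) 1 :=
      fun {x} hx => uIcc_of_le (zero_le_one' ℝ) ▸ hx
    have heq : (∫ t in a..b, ∫ x in (0 : ℝ)..1,
        (2 * (A t x / P t x) * B t x - (A t x / P t x) ^ 2 * r t x +
          2 * T t x * (H t x - m₁ t) * P t x + T t x ^ 2 * r t x)) =
        ∫ t in a..b, ∫ x in (0 : ℝ)..1, ((2 * (A t x + 0 * B t x) * B t x * N 0 t x -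
          (A t x + 0 * B t x) ^ 2 * r t x) / N 0 t x ^ 2 +
          (2 * X 0 t x * X' 0 t x * (P t x + 0 * r t x) + X 0 t x ^ 2 * r t x)) := by
      refine intervalIntegral.integral_congr fun t ht =>
        intervalIntegral.integral_congr fun x hx => ?_
      have h1 := hNeq 0 h0 t (hI ht) x (hJ hx)
      have h2 := hNpos 0 t x
      rw [zero_mul, add_zero] at h1
      simp only [hX, hX', h1]
      rw [h1] at h2
      field_simp
      ring
    rw [heq]
    refine main.congr_of_eventuallyEq ?_
    filter_upwards [Ioo_mem_nhds h0.1 h0.2] with e he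
    refine intervalIntegral.integral_congr fun t ht =>
      intervalIntegral.integral_congr fun x hx => ?_
    simp only [hX, hNeq e he t (hI ht) x (hJ hx)]
  · refine Continuous.add (Continuous.div ?_ hNc fun q => hNpos _ _ _) ?_ <;> fun_prop
  · refine Continuous.add (Continuous.div ?_ (hNc.pow 2) fun q => pow_ne_zero 2 (hNpos _ _ _)) ?_
      <;> fun_prop
  · intro e he t ht x hx
    have hpos : P t x + e * r t x ≠ 0 := (hc.trans (hlow e he t ht x hx)).ne'
    have d1 : HasDerivAt (fun e => A t x + e * B t x) (B t x) e := by
      simpa using ((hasDerivAt_id e).mul_const (B t x)).const_add (A t x)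
    have d2 : HasDerivAt (fun e => P t x + e * r t x) (r t x) e := by
      simpa using ((hasDerivAt_id e).mul_const (r t x)).const_add (P t x)
    have d3 : HasDerivAt (fun e => X e t x) (X' e t x) e := by
      have h1 := ((hasDerivAt_id e).mul_const (H t x)).const_add (T t x)
      have h2 := ((hasDerivAt_id e).mul_const (m₁ t)).add
        (((hasDerivAt_id e).pow 2).mul_const (m₂ t))
      convert! h1.sub h2 using 1
      simp [hX']
    have d4 := ((d1.pow 2).div d2 hpos).add ((d3.pow 2).mul d2)
    rw [hNeq e he t ht x hx]
    refine (d4.congr_deriv ?_).congr_of_eventuallyEq ?_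
    · simp
    · filter_upwards [Ioo_mem_nhds he.1 he.2] with e' he'
      simp [hNeq e' he' t ht x hx]

theorem dt_add_mul {s : WithTop ℝ} {I : Set ℝ} {u w : ℝ → ℝ → ℝ} (hI : IsOpen I)
    (hs : ((1 / 2 : ℝ) : WithTop ℝ) < s) (hu : IsCurve 2 s I u) (hw : IsCurve 2 s I w) (e : ℝ)
    {t : ℝ} (ht : t ∈ I) (x : ℝ) :
    dt (fun t x => u t x + e * w t x) t x = dt u t x + e * dt w t x :=
  ((hu.hasDerivAt hI hs ht x).add ((hw.hasDerivAt hI hs ht x).const_mul e)).deriv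

/-- The first variation of the energy at a normalized pair. -/
theorem IsPair.hasDerivAt_energy {s : WithTop ℝ} {I : Set ℝ} {ρ θ : ℝ → ℝ → ℝ}
    (hp : IsPair s I ρ θ) (hnorm : ∀ t ∈ I, ∫ x in (0 : ℝ)..1, dt θ t x * ρ t x = 0) {a b : ℝ}
    (hab : a ≤ b) (hIcc : Icc a b ⊆ I) {r η : ℝ → ℝ → ℝ} (hr : IsCurve 2 s I r)
    (hη : IsCurve 2 s I η) :
    HasDerivAt (fun e : ℝ => energy a b (fun t x => ρ t x + e * r t x)
        (fun t x => θ t x + e * η t x))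
      (1 / 4 * ∫ t in a..b, ∫ x in (0 : ℝ)..1, (2 * (dt ρ t x / ρ t x) * dt r t x -
        (dt ρ t x / ρ t x) ^ 2 * r t x + 2 * (dt θ t x * ρ t x) * dt η t x +
        dt θ t x ^ 2 * r t x)) 0 := by
  have hI := hp.isOpen
  have hs := hp.lt
  have cr : JointCont I r := hr.continuousOn hs
  have crt : JointCont I (dt r) := (hr.dt hI).continuousOn hs
  have cηt : JointCont I (dt η) := (hη.dt hI).continuousOn hs
  have hne : (Icc a b ×ˢ Icc (0 : ℝ) 1).Nonempty :=
    ⟨(a, 0), ⟨le_rfl, hab⟩, ⟨le_rfl, zero_le_one⟩⟩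
  have hK : IsCompact (Icc a b ×ˢ Icc (0 : ℝ) 1) := isCompact_Icc.prod isCompact_Icc
  have hsub : Icc a b ×ˢ Icc (0 : ℝ) 1 ⊆ I ×ˢ univ := prod_mono hIcc (subset_univ _)
  obtain ⟨p₀, hp₀, hmin⟩ := hK.exists_isMinOn hne (hp.jointCont_density.mono (hIcc.trans subset_rfl)
    |>.comp continuousOn_id (fun p hp => ⟨hp.1, mem_univ _⟩))
  obtain ⟨C, hC⟩ := hK.exists_bound_of_continuousOn (ContinuousOn.mono cr hsub)
  set c₀ := ρ p₀.1 p₀.2 with hc₀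
  have hc₀pos : 0 < c₀ := hp.pos _ (hIcc hp₀.1) _
  have hC0 : 0 ≤ C := (norm_nonneg _).trans (hC p₀ hp₀)
  -- With `|e| < δ` the perturbation of the density is at most half of its minimum `c₀`, which
  -- leaves the strict lower bound `c₀ / 3`. Adding `1` to `C` avoids division by zero.
  have hδ : 0 < c₀ / (2 * (C + 1)) := by positivity
  set δ := c₀ / (2 * (C + 1)) with hδdef
  set P : ℝ → ℝ → ℝ := fun t x => ρ (projIcc a b hab t) x with hP
  set A : ℝ → ℝ → ℝ := fun t x => dt ρ (projIcc a b hab t) x with hA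
  set T : ℝ → ℝ → ℝ := fun t x => dt θ (projIcc a b hab t) x with hT
  set r' : ℝ → ℝ → ℝ := fun t x => r (projIcc a b hab t) x with hr'
  set B : ℝ → ℝ → ℝ := fun t x => dt r (projIcc a b hab t) x with hB
  set H : ℝ → ℝ → ℝ := fun t x => dt η (projIcc a b hab t) x with hH
  have cP : Continuous fun p : ℝ × ℝ => P p.1 p.2 := hp.jointCont_density.clamp hab hIcc
  have cA : Continuous fun p : ℝ × ℝ => A p.1 p.2 := hp.jointCont_dt_density.clamp hab hIcc
  have cT : Continuous fun p : ℝ × ℝ => T p.1 p.2 := hp.jointCont_dt_fibre.clamp hab hIcc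
  have cr' : Continuous fun p : ℝ × ℝ => r' p.1 p.2 := cr.clamp hab hIcc
  have cB : Continuous fun p : ℝ × ℝ => B p.1 p.2 := crt.clamp hab hIcc
  have cH : Continuous fun p : ℝ × ℝ => H p.1 p.2 := cηt.clamp hab hIcc
  set m₁ : ℝ → ℝ := fun t => ∫ x in (0 : ℝ)..1, (H t x * P t x + T t x * r' t x) with hm₁
  set m₂ : ℝ → ℝ := fun t => ∫ x in (0 : ℝ)..1, H t x * r' t x with hm₂
  have cm₁ : Continuous m₁ :=
    intervalIntegral.continuous_parametric_intervalIntegral_of_continuous'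
      (f := fun t x => H t x * P t x + T t x * r' t x) ((cH.mul cP).add (cT.mul cr')) 0 1
  have cm₂ : Continuous m₂ :=
    intervalIntegral.continuous_parametric_intervalIntegral_of_continuous'
      (f := fun t x => H t x * r' t x) (cH.mul cr') 0 1
  have hproj : ∀ t ∈ Icc a b, (projIcc a b hab t : ℝ) = t := fun t ht => by
    rw [projIcc_of_mem hab ht]
  have hI' : ∀ {t : ℝ}, t ∈ uIcc a b → t ∈ Icc a b := fun {t} ht => uIcc_of_le hab ▸ ht
  have hlow : ∀ e ∈ Ioo (-δ) δ, ∀ t ∈ Icc a b, ∀ x ∈ Icc (0 : ℝ) 1,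
      c₀ / 3 < P t x + e * r' t x := by
    intro e he t ht x hx
    have h1 : c₀ ≤ P t x := by
      simp only [hP, hproj t ht]
      exact hmin (show (t, x) ∈ Icc a b ×ˢ Icc (0 : ℝ) 1 from ⟨ht, hx⟩)
    have h2 : |r' t x| ≤ C := by
      simp only [hr', hproj t ht]
      exact hC (t, x) ⟨ht, hx⟩
    have h3 : |e| ≤ δ := (abs_lt.mpr ⟨he.1, he.2⟩).le
    have h4 : |e * r' t x| ≤ c₀ / 2 := by
      rw [abs_mul]
      calc |e| * |r' t x| ≤ δ * (C + 1) := by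
            apply mul_le_mul h3 (by linarith) (abs_nonneg _) hδ.le
        _ = c₀ / 2 := by
            rw [hδdef]
            field_simp
    have := (abs_le.mp h4).1
    linarith
  have hTP : ∀ t ∈ Icc a b, ∫ x in (0 : ℝ)..1, T t x * P t x = 0 := by
    intro t ht
    simp only [hT, hP, hproj t ht]
    exact hnorm t (hIcc ht)
  have sl : ∀ {f : ℝ → ℝ → ℝ}, (Continuous fun p : ℝ × ℝ => f p.1 p.2) → ∀ t, Continuous (f t) :=
    fun {f} hf t => hf.comp (by fun_prop : Continuous fun x : ℝ => (t, x))
  have main := (hasDerivAt_integral_energy (c := c₀ / 3) hab hδ (by positivity) cP cA cT cr' cB cH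
    cm₁ cm₂ hlow).const_mul (1 / 4)
  refine (main.congr_deriv ?_).congr_of_eventuallyEq ?_
  · congr 1
    refine intervalIntegral.integral_congr fun t ht => ?_
    have ht' := hI' ht
    -- The variation `m₁` of the normalizing constant multiplies `∫ T P`, which is zero for a
    -- normalized lift, so the normalization does not contribute to first order.
    have e1 : (∫ x in (0 : ℝ)..1, (2 * (A t x / P t x) * B t x - (A t x / P t x) ^ 2 * r' t x +
        2 * T t x * (H t x - m₁ t) * P t x + T t x ^ 2 * r' t x)) =
        (∫ x in (0 : ℝ)..1, (2 * (A t x / P t x) * B t x - (A t x / P t x) ^ 2 * r' t x +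
        2 * (T t x * P t x) * H t x + T t x ^ 2 * r' t x)) -
        ∫ x in (0 : ℝ)..1, 2 * m₁ t * (T t x * P t x) := by
      have cP1 := sl cP t
      have cA1 := sl cA t
      have cT1 := sl cT t
      have cr1 := sl cr' t
      have cB1 := sl cB t
      have cH1 := sl cH t
      have hne : ∀ x, P t x ≠ 0 := fun x => (hp.pos _ (hIcc (projIcc a b hab t).2) x).ne'
      have cq : Continuous fun x => A t x / P t x := cA1.div cP1 hne
      rw [← intervalIntegral.integral_sub]
      · congr 1
        ext x
        ring
      · apply Continuous.intervalIntegrable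
        fun_prop
      · apply Continuous.intervalIntegrable
        fun_prop
    rw [e1, intervalIntegral.integral_const_mul, hTP t ht', mul_zero, sub_zero]
    simp only [hP, hA, hT, hr', hB, hH, hproj t ht']
  · filter_upwards with e
    unfold energy sasaki
    rw [intervalIntegral.integral_const_mul]
    congr 1
    refine intervalIntegral.integral_congr fun t ht => ?_
    have ht' := hI' ht
    have htI := hIcc ht'
    -- There is no term of order zero in `e`, again because the unperturbed lift is normalized.
    have e2 : ∫ y in (0 : ℝ)..1, (T t y + e * H t y) * (P t y + e * r' t y) =
        e * m₁ t + e ^ 2 * m₂ t := by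
      have cP1 := sl cP t
      have cT1 := sl cT t
      have cr1 := sl cr' t
      have cH1 := sl cH t
      have e3 : (fun y => (T t y + e * H t y) * (P t y + e * r' t y)) = fun y =>
          T t y * P t y + (e * (H t y * P t y + T t y * r' t y) + e ^ 2 * (H t y * r' t y)) := by
        ext y
        ring
      rw [e3, intervalIntegral.integral_add, intervalIntegral.integral_add,
        intervalIntegral.integral_const_mul, intervalIntegral.integral_const_mul, hTP t ht',
        zero_add]
      all_goals
        apply Continuous.intervalIntegrable
        fun_prop
    refine intervalIntegral.integral_congr fun x _ => ?_
    simp only [normalize, dt_add_mul hI hs hp.density hr e htI,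
      dt_add_mul hI hs hp.fibre hη e htI]
    simp only [hP, hT, hr', hH, hproj t ht'] at e2
    simp only [hP, hA, hT, hr', hB, hH, hproj t ht', e2]

/-- The first variation of the energy, integrated by parts. -/
theorem IsPair.hasDerivAt_energy_eulerLagrange {s : WithTop ℝ} {I : Set ℝ} {ρ θ : ℝ → ℝ → ℝ}
    (hp : IsPair s I ρ θ) (hnorm : ∀ t ∈ I, ∫ x in (0 : ℝ)..1, dt θ t x * ρ t x = 0) {a b : ℝ}
    (hab : a ≤ b) (hIcc : Icc a b ⊆ I) {r η : ℝ → ℝ → ℝ} (hr : IsCurve 2 s I r)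
    (hη : IsCurve 2 s I η) (hra : r a = 0) (hrb : r b = 0) (hηa : η a = 0) (hηb : η b = 0) :
    HasDerivAt (fun e : ℝ => energy a b (fun t x => ρ t x + e * r t x)
        (fun t x => θ t x + e * η t x))
      (1 / 4 * ∫ t in a..b, ∫ x in (0 : ℝ)..1,
        (elDensity ρ θ t x * r t x - 2 * (elFibre ρ θ t x * η t x))) 0 := by
  have hI := hp.isOpen
  have hs := hp.lt
  refine (hp.hasDerivAt_energy hnorm hab hIcc hr hη).congr_deriv ?_
  congr 1
  have cr : JointCont I r := hr.continuousOn hs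
  have crt : JointCont I (dt r) := (hr.dt hI).continuousOn hs
  have cη : JointCont I η := hη.continuousOn hs
  have cηt : JointCont I (dt η) := (hη.dt hI).continuousOn hs
  have hρ0 : ∀ t ∈ I, ∀ x, ρ t x ≠ 0 := fun t ht x => (hp.pos t ht x).ne'
  have cq := hp.jointCont_quotient
  have cq' : JointCont I (fun t x =>
      (dt (dt ρ) t x * ρ t x - dt ρ t x * dt ρ t x) / ρ t x ^ 2) :=
    ((hp.jointCont_dt_dt_density.mul hp.jointCont_density).sub
      (hp.jointCont_dt_density.mul hp.jointCont_dt_density)).div (hp.jointCont_density.pow 2)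
      fun p h => pow_ne_zero 2 (hρ0 p.1 h.1 p.2)
  have hra' : ∀ x, r a x = 0 := fun x => congrFun hra x
  have hrb' : ∀ x, r b x = 0 := fun x => congrFun hrb x
  have hηa' : ∀ x, η a x = 0 := fun x => congrFun hηa x
  have hηb' : ∀ x, η b x = 0 := fun x => congrFun hηb x
  -- The time derivatives are moved off the variations; the boundary terms vanish because the end
  -- points are fixed.
  have p1 := integral_integral_mul_deriv (u := fun t x => dt ρ t x / ρ t x) (w := r)
    (w' := dt r) hab (cq.mono hIcc) (cq'.mono hIcc) (cr.mono hIcc) (crt.mono hIcc)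
    (fun t ht x => (hp.hasDerivAt_dt_density (hIcc ht) x).div (hp.hasDerivAt_density (hIcc ht) x)
      (hρ0 t (hIcc ht) x))
    (fun t ht x => hr.hasDerivAt hI hs (hIcc ht) x) hra' hrb'
  have p2 := integral_integral_mul_deriv (u := fun t x => dt θ t x * ρ t x) (w := η)
    (w' := dt η) hab
    (JointCont.mono (f := fun t x => dt θ t x * ρ t x)
      (hp.jointCont_dt_fibre.mul hp.jointCont_density) hIcc)
    (hp.jointCont_elFibre.mono hIcc) (cη.mono hIcc) (cηt.mono hIcc)
    (fun t ht x => hp.hasDerivAt_momentum (hIcc ht) x)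
    (fun t ht x => hη.hasDerivAt hI hs (hIcc ht) x) hηa' hηb'
  have ii : ∀ {f : ℝ → ℝ → ℝ}, JointCont I f → ∀ t ∈ I, IntervalIntegrable (f t) volume 0 1 :=
    fun {f} hf t ht => (hf.space ht).intervalIntegrable _ _
  have jj : ∀ {f : ℝ → ℝ → ℝ}, JointCont I f →
      IntervalIntegrable (fun t => ∫ x in (0 : ℝ)..1, f t x) volume a b :=
    fun {f} hf => ((hf.integral 0 1).mono (by rwa [uIcc_of_le hab])).intervalIntegrable
  have hI' : ∀ {t : ℝ}, t ∈ uIcc a b → t ∈ I := fun {t} ht => hIcc (uIcc_of_le hab ▸ ht)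
  have j1 : JointCont I (fun t x => dt ρ t x / ρ t x * dt r t x) := cq.mul crt
  have j2 : JointCont I (fun t x => dt θ t x * ρ t x * dt η t x) :=
    (hp.jointCont_dt_fibre.mul hp.jointCont_density).mul cηt
  have j3 : JointCont I (fun t x => (dt θ t x ^ 2 - (dt ρ t x / ρ t x) ^ 2) * r t x) :=
    ((hp.jointCont_dt_fibre.pow 2).sub (cq.pow 2)).mul cr
  have j4 : JointCont I (fun t x =>
      (dt (dt ρ) t x * ρ t x - dt ρ t x * dt ρ t x) / ρ t x ^ 2 * r t x) := cq'.mul cr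
  have j5 : JointCont I (fun t x => elFibre ρ θ t x * η t x) := hp.jointCont_elFibre.mul cη
  have split : ∀ {f g k : ℝ → ℝ → ℝ}, JointCont I f → JointCont I g → JointCont I k →
      ∫ t in a..b, ∫ x in (0 : ℝ)..1, (2 * f t x + 2 * g t x + k t x) =
      2 * (∫ t in a..b, ∫ x in (0 : ℝ)..1, f t x) + 2 * (∫ t in a..b, ∫ x in (0 : ℝ)..1, g t x) +
        ∫ t in a..b, ∫ x in (0 : ℝ)..1, k t x := by
    intro f g k hf hg hk
    rw [← intervalIntegral.integral_const_mul, ← intervalIntegral.integral_const_mul,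
      ← intervalIntegral.integral_add ((jj hf).const_mul 2) ((jj hg).const_mul 2),
      ← intervalIntegral.integral_add (((jj hf).const_mul 2).add ((jj hg).const_mul 2)) (jj hk)]
    refine intervalIntegral.integral_congr fun t ht => ?_
    have h1 := (ii hf t (hI' ht)).const_mul 2
    have h2 := (ii hg t (hI' ht)).const_mul 2
    rw [intervalIntegral.integral_add (h1.add h2) (ii hk t (hI' ht)),
      intervalIntegral.integral_add h1 h2, intervalIntegral.integral_const_mul,
      intervalIntegral.integral_const_mul]
  have l1 := split j1 j2 j3
  -- The same splitting is used in reverse to reassemble the terms after integration by parts.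
  have l2 := split (f := fun t x =>
      -((dt (dt ρ) t x * ρ t x - dt ρ t x * dt ρ t x) / ρ t x ^ 2 * r t x))
    (g := fun t x => -(elFibre ρ θ t x * η t x)) j4.neg j5.neg j3
  simp only [intervalIntegral.integral_neg] at l2
  rw [p1, p2, ← l2] at l1
  calc _ = _ := by
        refine intervalIntegral.integral_congr fun t _ =>
          intervalIntegral.integral_congr fun x _ => ?_
        ring
    _ = _ := l1
    _ = _ := by
        refine intervalIntegral.integral_congr fun t ht =>
          intervalIntegral.integral_congr fun x _ => ?_
        have := hρ0 t (hI' ht) x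
        simp only [elDensity]
        field_simp
        ring

/-! ### Geodesics and the Euler–Lagrange equations -/

theorem integral_cosFun {n : ℤ} (hn : n ≠ 0) : ∫ x in (0 : ℝ)..1, cosFun n x = 0 := by
  have h : ∀ x, HasDerivAt (fun x => sinFun n x / (2 * Real.pi * n)) (cosFun n x) x := by
    intro x
    have hn' : (n : ℝ) ≠ 0 := by exact_mod_cast hn
    have := Real.pi_ne_zero
    refine ((hasDerivAt_sinFun n x).div_const _).congr_deriv ?_
    field_simp
  rw [intervalIntegral.integral_eq_sub_of_hasDerivAt (fun x _ => h x)
    ((contDiff_cosFun n (n := 0)).continuous.intervalIntegrable _ _)]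
  have := periodic_sinFun n 0
  rw [zero_add] at this
  rw [this, sub_self]

theorem integral_sinFun {n : ℤ} (hn : n ≠ 0) : ∫ x in (0 : ℝ)..1, sinFun n x = 0 := by
  have h : ∀ x, HasDerivAt (fun x => -cosFun n x / (2 * Real.pi * n)) (sinFun n x) x := by
    intro x
    have hn' : (n : ℝ) ≠ 0 := by exact_mod_cast hn
    have := Real.pi_ne_zero
    refine ((hasDerivAt_cosFun n x).neg.div_const _).congr_deriv ?_
    field_simp
  rw [intervalIntegral.integral_eq_sub_of_hasDerivAt (fun x _ => h x)
    ((contDiff_sinFun n (n := 0)).continuous.intervalIntegrable _ _)]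
  have := periodic_cosFun n 0
  rw [zero_add] at this
  rw [this, sub_self]

theorem IsPair.periodic_density {s : WithTop ℝ} {I : Set ℝ} {ρ θ : ℝ → ℝ → ℝ}
    (hp : IsPair s I ρ θ) {t : ℝ} (ht : t ∈ I) : Function.Periodic (ρ t) 1 :=
  hp.density.periodic hp.lt ht

theorem IsPair.periodic_elDensity {s : WithTop ℝ} {I : Set ℝ} {ρ θ : ℝ → ℝ → ℝ}
    (hp : IsPair s I ρ θ) {t : ℝ} (ht : t ∈ I) : Function.Periodic (elDensity ρ θ t) 1 := by
  intro x
  have h1 := hp.density.periodic hp.lt ht x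
  have h2 := (hp.density.dt hp.isOpen).periodic hp.lt ht x
  have h3 := ((hp.density.dt hp.isOpen).dt hp.isOpen).periodic hp.lt ht x
  have h4 := (hp.fibre.dt hp.isOpen).periodic hp.lt ht x
  simp only [elDensity, h1, h2, h3, h4]

theorem IsPair.periodic_elFibre {s : WithTop ℝ} {I : Set ℝ} {ρ θ : ℝ → ℝ → ℝ}
    (hp : IsPair s I ρ θ) {t : ℝ} (ht : t ∈ I) : Function.Periodic (elFibre ρ θ t) 1 := by
  intro x
  have h1 := hp.density.periodic hp.lt ht x
  have h2 := (hp.density.dt hp.isOpen).periodic hp.lt ht x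
  have h3 := ((hp.fibre.dt hp.isOpen).dt hp.isOpen).periodic hp.lt ht x
  have h4 := (hp.fibre.dt hp.isOpen).periodic hp.lt ht x
  simp only [elFibre, h1, h2, h3, h4]

theorem mem_constants_iff {s : WithTop ℝ} {f : Hs s} :
    f ∈ constants s ↔ ∃ c : ℝ, ∀ x, (f : ℝ → ℝ) x = c := by
  rw [constants, Submodule.mem_comap, Submodule.mem_span_singleton]
  constructor
  · rintro ⟨c, hc⟩
    exact ⟨c, fun x => by
      have := congrFun hc x
      simpa using this.symm⟩
  · rintro ⟨c, hc⟩
    exact ⟨c, funext fun x => by simp [hc]⟩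

theorem mkQ_eq_iff {s : WithTop ℝ} {f g : Hs s} :
    (constants s).mkQ f = (constants s).mkQ g ↔
      ∃ c : ℝ, ∀ x, (f : ℝ → ℝ) x = (g : ℝ → ℝ) x + c := by
  rw [Submodule.mkQ_apply, Submodule.mkQ_apply, Submodule.Quotient.eq, mem_constants_iff]
  refine exists_congr fun c => forall_congr' fun x => ?_
  simp only [Submodule.coe_sub, Pi.sub_apply]
  constructor <;> intro h <;> linarith

/-- Since the total mass is `1`, a constant is its own mean against `ρ`. Hence the metric is well
defined on cosets modulo constants. -/
theorem normalize_add_const {ρ f : ℝ → ℝ} (hρ : Continuous ρ) (hf : Continuous f)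
    (h1 : ∫ x in (0 : ℝ)..1, ρ x = 1) (c : ℝ) :
    normalize ρ (fun x => f x + c) = normalize ρ f := by
  ext x
  unfold normalize
  have : (fun y => (f y + c) * ρ y) = fun y => f y * ρ y + c * ρ y := by
    ext y
    ring
  rw [this, intervalIntegral.integral_add, intervalIntegral.integral_const_mul, h1]
  · ring
  all_goals
    apply Continuous.intervalIntegrable
    fun_prop

section

variable {s : WithTop ℝ} {I : Set ℝ} {γ : ℝ → CotDens s}

theorem IsLift.isPair (hI : IsOpen I) (hs : ((1 / 2 : ℝ) : WithTop ℝ) < s) {Θ : ℝ → Hs s}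
    (h : IsLift 2 I γ Θ) :
    IsPair s I (fun t => (γ t).density) (fun t => (Θ t : ℝ → ℝ)) where
  isOpen := hI
  lt := hs
  density := h.1
  fibre := h.2.1
  pos := fun t _ => (γ t).1.2.1

/-- Two lifts of the same curve have velocities that differ by constants. -/
theorem IsLift.exists_dt_eq {k : ℕ} (hI : IsOpen I) (hs : ((1 / 2 : ℝ) : WithTop ℝ) < s)
    {Θ Θ' : ℝ → Hs s} (h : IsLift (k + 1) I γ Θ) (h' : IsLift (k + 1) I γ Θ') {t : ℝ}
    (ht : t ∈ I) :
    ∃ c, ∀ x, dt (fun τ => (Θ' τ : ℝ → ℝ)) t x = dt (fun τ => (Θ τ : ℝ → ℝ)) t x + c := by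
  -- Reading the time-dependent constant between the lifts at `x = 0` shows that it is
  -- differentiable in time.
  refine ⟨dt (fun τ => (Θ' τ : ℝ → ℝ)) t 0 - dt (fun τ => (Θ τ : ℝ → ℝ)) t 0, fun x => ?_⟩
  have d := fun x => h.2.1.hasDerivAt hI hs ht x
  have d' := fun x => h'.2.1.hasDerivAt hI hs ht x
  have h1 := (d x).add ((d' 0).sub (d 0))
  refine (d' x).unique (h1.congr_of_eventuallyEq ?_)
  filter_upwards [hI.mem_nhds ht] with τ hτ
  obtain ⟨c, hc⟩ := mkQ_eq_iff.mp ((h'.2.2 τ hτ).trans (h.2.2 τ hτ).symm)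
  simp only [Pi.add_apply, Pi.sub_apply, hc]
  ring

/-- The condition `∫ r = 0` keeps the perturbed density of mass `1`, so normalization still removes
the difference of the lifts. Criticality may therefore be tested on a normalized lift, although
`IsGeodesic` only provides some lift. -/
theorem energy_congr_lift (hI : IsOpen I) (hs : ((1 / 2 : ℝ) : WithTop ℝ) < s) {Θ Θ' : ℝ → Hs s}
    (h : IsLift 2 I γ Θ) (h' : IsLift 2 I γ Θ') {a b : ℝ} (hab : a ≤ b) (hIcc : Icc a b ⊆ I)
    {r η : ℝ → ℝ → ℝ} (hr : IsCurve 2 s I r) (hη : IsCurve 2 s I η)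
    (hr0 : ∀ t ∈ I, ∫ x in (0 : ℝ)..1, r t x = 0) (e : ℝ) :
    energy a b (fun t x => (γ t).density x + e * r t x)
      (fun t x => (Θ' t : ℝ → ℝ) x + e * η t x) =
    energy a b (fun t x => (γ t).density x + e * r t x)
      (fun t x => (Θ t : ℝ → ℝ) x + e * η t x) := by
  refine intervalIntegral.integral_congr fun t ht => ?_
  have htI : t ∈ I := hIcc (uIcc_of_le hab ▸ ht)
  obtain ⟨c, hc⟩ := h.exists_dt_eq hI hs h' htI
  simp only
  congr 1
  have cρ : Continuous (γ t).density := h.1.continuous hs htI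
  have cr : Continuous (r t) := hr.continuous hs htI
  have cθ : Continuous (dt (fun τ => (Θ τ : ℝ → ℝ)) t) :=
    (h.2.1.dt (k := 1) hI).continuous hs htI
  have cη : Continuous (dt η t) := (hη.dt (k := 1) hI).continuous hs htI
  have e1 : dt (fun t x => (Θ' t : ℝ → ℝ) x + e * η t x) t =
      fun x => (dt (fun τ => (Θ τ : ℝ → ℝ)) t x + e * dt η t x) + c := by
    ext x
    rw [dt_add_mul (u := fun t => (Θ' t : ℝ → ℝ)) hI hs h'.2.1 hη e htI, hc]
    ring
  have e2 : dt (fun t x => (Θ t : ℝ → ℝ) x + e * η t x) t =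
      fun x => (dt (fun τ => (Θ τ : ℝ → ℝ)) t x + e * dt η t x) := by
    ext x
    rw [dt_add_mul (u := fun t => (Θ t : ℝ → ℝ)) hI hs h.2.1 hη e htI]
  rw [e1, e2, normalize_add_const]
  · fun_prop
  · fun_prop
  · rw [intervalIntegral.integral_add, intervalIntegral.integral_const_mul, hr0 t htI, mul_zero,
      add_zero]
    · exact (γ t).1.2.2
    all_goals
      apply Continuous.intervalIntegrable
      fun_prop

/-- A curve with a normalized lift is a geodesic if and only if it satisfies the Euler–Lagrange
equations. -/
theorem isGeodesic_iff_eulerLagrange (hI : IsOpen I) (hI' : I.OrdConnected)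
    (hs : ((1 / 2 : ℝ) : WithTop ℝ) < s) {Θ : ℝ → Hs s} (h : IsLift 2 I γ Θ)
    (hnorm : ∀ t ∈ I, ∫ x in (0 : ℝ)..1, dt (fun τ => (Θ τ : ℝ → ℝ)) t x * (γ t).density x = 0) :
    IsGeodesic I γ ↔ EulerLagrange I (fun t => (γ t).density) (fun t => (Θ t : ℝ → ℝ)) := by
  have hp := h.isPair hI hs
  constructor
  · rintro ⟨Θ', h', hcrit⟩
    have key : ∀ {a b : ℝ}, a < b → Icc a b ⊆ I → ∀ {r η : ℝ → ℝ → ℝ}, IsCurve 2 s I r →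
        IsCurve 2 s I η → (∀ t ∈ I, ∫ x in (0 : ℝ)..1, r t x = 0) → r a = 0 → r b = 0 →
        η a = 0 → η b = 0 → ∫ t in a..b, ∫ x in (0 : ℝ)..1,
          (elDensity (fun t => (γ t).density) (fun t => (Θ t : ℝ → ℝ)) t x * r t x -
            2 * (elFibre (fun t => (γ t).density) (fun t => (Θ t : ℝ → ℝ)) t x * η t x)) = 0 := by
      intro a b hab hIcc r η hr hη hr0 hra hrb hηa hηb
      have h1 := hp.hasDerivAt_energy_eulerLagrange hnorm hab.le hIcc hr hη hra hrb hηa hηb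
      have h2 := hcrit a b hab hIcc r η hr hη hr0 hra hrb hηa hηb
      have h3 := h1.unique (h2.congr_of_eventuallyEq (Eventually.of_forall fun e =>
        (energy_congr_lift hI hs h h' hab.le hIcc hr hη hr0 e).symm))
      linarith
    have hχ : ∀ {χ : ℝ → ℝ}, ContDiff ℝ (⊤ : ℕ∞) χ → ContDiffOn ℝ (2 : ℕ) χ I :=
      fun {χ} h => (h.of_le (WithTop.coe_le_coe.mpr le_top)).contDiffOn
    have hzero : IsCurve 2 s I (fun _ _ => (0 : ℝ)) :=
      isCurve_scalar (c := fun _ => 0) contDiffOn_const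
    -- Variations of the form `χ(t) f(x)` separate time from space: the fundamental lemma in time
    -- leaves an orthogonality relation at each `t`.
    have density_orth : ∀ {f : ℝ → ℝ}, (∀ r, f ∈ HsReal r) → ∫ x in (0 : ℝ)..1, f x = 0 →
        ∀ t ∈ I, ∫ x in (0 : ℝ)..1,
          elDensity (fun t => (γ t).density) (fun t => (Θ t : ℝ → ℝ)) t x * f x = 0 := by
      intro f hf hf0 t ht
      have hfc : Continuous f := (hf 1).1
      have hj : JointCont I (fun t x =>
          elDensity (fun t => (γ t).density) (fun t => (Θ t : ℝ → ℝ)) t x * f x) :=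
        hp.jointCont_elDensity.mul (hfc.comp continuous_snd).continuousOn
      refine eq_zero_of_integral_mul_eq_zero hI (hj.integral 0 1) (fun χ h1 h2 h3 => ?_) ht
      obtain ⟨a, b, hab, hK, hIcc⟩ := exists_Icc_subset hI hI' ⟨t, ht⟩ h2 h3
      have hχ0 : ∀ τ, τ ∉ tsupport χ → χ τ = 0 := fun τ => image_eq_zero_of_notMem_tsupport
      have ha : χ a = 0 := hχ0 a fun h => (hK h).1.false
      have hb : χ b = 0 := hχ0 b fun h => (hK h).2.false
      rw [setIntegral_eq_intervalIntegral hab.le hK hIcc fun τ hτ => by rw [hχ0 τ hτ, zero_mul]]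
      refine Eq.trans ?_ (key hab hIcc (isCurve_smul (hχ h1) fun r _ _ => hf r) hzero
        (fun τ _ => by rw [intervalIntegral.integral_const_mul, hf0, mul_zero])
        (funext fun x => by simp [ha]) (funext fun x => by simp [hb]) rfl rfl)
      refine intervalIntegral.integral_congr fun τ _ => ?_
      rw [← intervalIntegral.integral_const_mul]
      congr 1
      ext x
      ring
    have fibre_orth : ∀ {f : ℝ → ℝ}, (∀ r, f ∈ HsReal r) →
        ∀ t ∈ I, ∫ x in (0 : ℝ)..1,
          elFibre (fun t => (γ t).density) (fun t => (Θ t : ℝ → ℝ)) t x * f x = 0 := by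
      intro f hf t ht
      have hfc : Continuous f := (hf 1).1
      have hj : JointCont I (fun t x =>
          elFibre (fun t => (γ t).density) (fun t => (Θ t : ℝ → ℝ)) t x * f x) :=
        hp.jointCont_elFibre.mul (hfc.comp continuous_snd).continuousOn
      refine eq_zero_of_integral_mul_eq_zero hI (hj.integral 0 1) (fun χ h1 h2 h3 => ?_) ht
      obtain ⟨a, b, hab, hK, hIcc⟩ := exists_Icc_subset hI hI' ⟨t, ht⟩ h2 h3
      have hχ0 : ∀ τ, τ ∉ tsupport χ → χ τ = 0 := fun τ => image_eq_zero_of_notMem_tsupport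
      have ha : χ a = 0 := hχ0 a fun h => (hK h).1.false
      have hb : χ b = 0 := hχ0 b fun h => (hK h).2.false
      have h4 := key hab hIcc hzero (isCurve_smul (hχ h1) fun r _ _ => hf r)
          (fun τ _ => by simp) rfl rfl
          (funext fun x => by simp [ha]) (funext fun x => by simp [hb])
      rw [setIntegral_eq_intervalIntegral hab.le hK hIcc fun τ hτ => by rw [hχ0 τ hτ, zero_mul]]
      have h5 : (-2) * ∫ τ in a..b, χ τ * ∫ x in (0 : ℝ)..1,
          elFibre (fun t => (γ t).density) (fun t => (Θ t : ℝ → ℝ)) τ x * f x = 0 := by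
        rw [← h4, ← intervalIntegral.integral_const_mul]
        refine intervalIntegral.integral_congr fun τ _ => ?_
        rw [← intervalIntegral.integral_const_mul, ← intervalIntegral.integral_const_mul]
        congr 1
        ext x
        ring
      linarith
    intro t ht
    -- In the density direction only mean-zero functions are admissible, so the conclusion is
    -- constancy. In the fibre direction the constant `cosFun 0` is admissible as well and removes
    -- the mean.
    refine ⟨⟨_, fun x => eq_mean_of_orthogonal (hp.jointCont_elDensity.space ht)
      (hp.periodic_elDensity ht)
      (fun n hn => density_orth (cosFun_mem n) (integral_cosFun hn) t ht)
      (fun n hn => density_orth (sinFun_mem n) (integral_sinFun hn) t ht) x⟩, fun x => ?_⟩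
    rw [eq_mean_of_orthogonal (hp.jointCont_elFibre.space ht) (hp.periodic_elFibre ht)
      (fun n _ => fibre_orth (cosFun_mem n) t ht) (fun n _ => fibre_orth (sinFun_mem n) t ht) x]
    have := fibre_orth (cosFun_mem 0) t ht
    simpa [cosFun] using this
  · intro hEL
    refine ⟨Θ, h, fun a b hab hIcc r η hr hη hr0 hra hrb hηa hηb => ?_⟩
    refine (hp.hasDerivAt_energy_eulerLagrange hnorm hab.le hIcc hr hη hra hrb hηa
      hηb).congr_deriv ?_
    have : ∀ t ∈ uIcc a b, ∫ x in (0 : ℝ)..1,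
        (elDensity (fun t => (γ t).density) (fun t => (Θ t : ℝ → ℝ)) t x * r t x -
          2 * (elFibre (fun t => (γ t).density) (fun t => (Θ t : ℝ → ℝ)) t x * η t x)) = 0 := by
      intro t ht
      have htI : t ∈ I := hIcc (uIcc_of_le hab.le ▸ ht)
      obtain ⟨⟨c, hc⟩, hW⟩ := hEL t htI
      simp only [hc, hW, zero_mul, mul_zero, sub_zero]
      rw [intervalIntegral.integral_const_mul, hr0 t htI, mul_zero]
    rw [intervalIntegral.integral_congr (g := fun _ => 0) this]
    simp

end

/-! ### Diffeomorphisms of the circle -/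

/-- A lift of an orientation preserving `C¹` diffeomorphism of the circle, with derivative `φ'`. -/
structure IsCircleDiffeo (φ φ' : ℝ → ℝ) : Prop where
  hasDerivAt : ∀ x, HasDerivAt φ (φ' x) x
  continuous_deriv : Continuous φ'
  pos : ∀ x, 0 < φ' x
  periodic : Function.Periodic (fun x => φ x - x) 1

namespace IsCircleDiffeo

variable {φ φ' : ℝ → ℝ}

theorem continuous (h : IsCircleDiffeo φ φ') : Continuous φ :=
  continuous_iff_continuousAt.mpr fun x => (h.hasDerivAt x).continuousAt

theorem strictMono (h : IsCircleDiffeo φ φ') : StrictMono φ :=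
  strictMono_of_deriv_pos fun x => by
    rw [(h.hasDerivAt x).deriv]
    exact h.pos x

theorem add_one (h : IsCircleDiffeo φ φ') (x : ℝ) : φ (x + 1) = φ x + 1 := by
  have := h.periodic x
  simp only at this
  linarith

/-- From `φ n = φ 0 + n`, every `y` lies between the values at two consecutive integers, and the
intermediate value theorem applies. -/
theorem surjective (h : IsCircleDiffeo φ φ') : Function.Surjective φ := by
  intro y
  have hn : ∀ n : ℤ, φ n = φ 0 + n := fun n => by
    have := (h.periodic.int_mul n) 0
    simp only [mul_one, zero_add, sub_zero] at this
    linarith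
  set n := ⌊y - φ 0⌋ with hndef
  have h1 : φ n ≤ y := by
    rw [hn]
    linarith [Int.floor_le (y - φ 0)]
  have h2 : y ≤ φ ((n + 1 : ℤ) : ℝ) := by
    rw [hn]
    push_cast
    linarith [Int.lt_floor_add_one (y - φ 0)]
  obtain ⟨x, -, hx⟩ := intermediate_value_Icc (by push_cast; linarith) h.continuous.continuousOn
    ⟨h1, h2⟩
  exact ⟨x, hx⟩

theorem invFun_apply (h : IsCircleDiffeo φ φ') (x : ℝ) : Function.invFun φ (φ x) = x :=
  Function.leftInverse_invFun h.strictMono.injective x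

theorem apply_invFun (h : IsCircleDiffeo φ φ') (x : ℝ) : φ (Function.invFun φ x) = x :=
  Function.rightInverse_invFun h.surjective x

theorem continuous_invFun (h : IsCircleDiffeo φ φ') : Continuous (Function.invFun φ) := by
  have h1 : Function.invFun φ = (h.strictMono.orderIsoOfSurjective φ h.surjective).symm := by
    ext x
    apply h.strictMono.injective
    rw [h.apply_invFun]
    exact ((h.strictMono.orderIsoOfSurjective φ h.surjective).apply_symm_apply x).symm
  rw [h1]
  exact OrderIso.continuous _

theorem invFun_add_one (h : IsCircleDiffeo φ φ') (x : ℝ) :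
    Function.invFun φ (x + 1) = Function.invFun φ x + 1 := by
  apply h.strictMono.injective
  rw [h.add_one, h.apply_invFun, h.apply_invFun]

theorem hasDerivAt_invFun (h : IsCircleDiffeo φ φ') (x : ℝ) :
    HasDerivAt (Function.invFun φ) (φ' (Function.invFun φ x))⁻¹ x :=
  HasDerivAt.of_local_left_inverse h.continuous_invFun.continuousAt (h.hasDerivAt _)
    (h.pos _).ne' (Eventually.of_forall h.apply_invFun)

theorem integral_comp (h : IsCircleDiffeo φ φ') {F : ℝ → ℝ} (hF : Continuous F)
    (hp : Function.Periodic F 1) :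
    ∫ x in (0 : ℝ)..1, F x = ∫ y in (0 : ℝ)..1, F (φ y) * φ' y :=
  integral_comp_mul_deriv_circle h.hasDerivAt h.continuous_deriv
    (by simpa using h.add_one 0) hF hp

theorem periodic_comp_invFun (h : IsCircleDiffeo φ φ') {G : ℝ → ℝ} (hp : Function.Periodic G 1) :
    Function.Periodic (fun x => G (Function.invFun φ x)) 1 := fun x => by
  simp only [h.invFun_add_one, hp _]

theorem integral_comp_invFun (h : IsCircleDiffeo φ φ') {G : ℝ → ℝ} (hG : Continuous G)
    (hp : Function.Periodic G 1) :
    ∫ x in (0 : ℝ)..1, G (Function.invFun φ x) = ∫ y in (0 : ℝ)..1, G y * φ' y := by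
  rw [h.integral_comp (F := fun x => G (Function.invFun φ x)) (hG.comp h.continuous_invFun)
    (h.periodic_comp_invFun hp)]
  simp only [h.invFun_apply]

/-- A periodic function which is orthogonal to the nonconstant trigonometric functions, after a
change of variables, is constant. -/
theorem eq_mean_of_orthogonal (h : IsCircleDiffeo φ φ') {G : ℝ → ℝ} (hG : Continuous G)
    (hp : Function.Periodic G 1)
    (hcos : ∀ n : ℤ, n ≠ 0 → ∫ y in (0 : ℝ)..1, G y * φ' y * cosFun n (φ y) = 0)
    (hsin : ∀ n : ℤ, n ≠ 0 → ∫ y in (0 : ℝ)..1, G y * φ' y * sinFun n (φ y) = 0) (y : ℝ) :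
    G y = ∫ y in (0 : ℝ)..1, G y * φ' y := by
  have hc : Continuous fun x => G (Function.invFun φ x) := hG.comp h.continuous_invFun
  have hper := h.periodic_comp_invFun hp
  have key : ∀ {f : ℝ → ℝ}, Continuous f → Function.Periodic f 1 →
      ∫ x in (0 : ℝ)..1, G (Function.invFun φ x) * f x =
        ∫ y in (0 : ℝ)..1, G y * φ' y * f (φ y) := by
    intro f hf hfp
    rw [h.integral_comp (F := fun x => G (Function.invFun φ x) * f x) (hc.mul hf) (hper.mul hfp)]
    simp only [h.invFun_apply]
    congr 1
    ext y
    ring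
  have h1 := HunterSaxton.eq_mean_of_orthogonal hc hper
    (fun n hn => by
      rw [key (contDiff_cosFun n (n := 0)).continuous (periodic_cosFun n)]
      exact hcos n hn)
    (fun n hn => by
      rw [key (contDiff_sinFun n (n := 0)).continuous (periodic_sinFun n)]
      exact hsin n hn) (φ y)
  rw [h.invFun_apply, h.integral_comp_invFun hG hp] at h1
  exact h1

end IsCircleDiffeo

/-! ### Flows and their Eulerian velocities -/

/-- A `C²` curve of circle diffeomorphisms and of functions, with its Eulerian velocity. -/
structure IsFlow (s : WithTop ℝ) (I : Set ℝ) (φ a v σ : ℝ → ℝ → ℝ) : Prop where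
  isOpen : IsOpen I
  lt : ((1 / 2 : ℝ) : WithTop ℝ) < s
  curve : IsCurve 2 (s + 1) I (fun t x => φ t x - x)
  curve_fibre : IsCurve 2 s I a
  pos : ∀ t ∈ I, ∀ x, 0 < dx φ t x
  velocity : ∀ t ∈ I, ∀ x, dt φ t x = v t (φ t x)
  velocity_fibre : ∀ t ∈ I, ∀ x, dt a t x = σ t (φ t x)

theorem dt_sub_id (φ : ℝ → ℝ → ℝ) : dt (fun t x => φ t x - x) = dt φ := by
  ext t x
  simp [dt]

theorem hasDerivAt_of_curve {k : ℕ} {s : WithTop ℝ} {I : Set ℝ} {φ : ℝ → ℝ → ℝ}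
    (hs : ((1 / 2 : ℝ) : WithTop ℝ) < s) (h : IsCurve k (s + 1) I (fun t x => φ t x - x)) {t : ℝ}
    (ht : t ∈ I) (x : ℝ) :
    HasDerivAt (φ t) (dx (fun t x => φ t x - x) t x + 1) x := by
  have h1 := (h.hasDerivAt_space hs ht x).add (hasDerivAt_id x)
  refine h1.congr_of_eventuallyEq (Eventually.of_forall fun y => ?_)
  simp

theorem dx_eq_of_curve {k : ℕ} {s : WithTop ℝ} {I : Set ℝ} {φ : ℝ → ℝ → ℝ}
    (hs : ((1 / 2 : ℝ) : WithTop ℝ) < s) (h : IsCurve k (s + 1) I (fun t x => φ t x - x)) {t : ℝ}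
    (ht : t ∈ I) (x : ℝ) : dx φ t x = dx (fun t x => φ t x - x) t x + 1 :=
  (hasDerivAt_of_curve hs h ht x).deriv

theorem isCurve_dx_of_curve {k : ℕ} {s : WithTop ℝ} {I : Set ℝ} {φ : ℝ → ℝ → ℝ}
    (hs : ((1 / 2 : ℝ) : WithTop ℝ) < s) (h : IsCurve k (s + 1) I (fun t x => φ t x - x)) :
    IsCurve k s I (dx φ) := by
  have h1 : IsCurve k s I (fun _ _ => (1 : ℝ)) := isCurve_scalar (c := fun _ => 1) contDiffOn_const
  exact (h.dx.add h1).congr fun t ht => funext fun x => dx_eq_of_curve hs h ht x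

theorem dt_dx_of_curve {k : ℕ} {s : WithTop ℝ} {I : Set ℝ} {φ : ℝ → ℝ → ℝ} (hI : IsOpen I)
    (hs : ((1 / 2 : ℝ) : WithTop ℝ) < s) (h : IsCurve (k + 1) (s + 1) I (fun t x => φ t x - x))
    {t : ℝ} (ht : t ∈ I) : dt (dx φ) t = dx (dt φ) t := by
  have h1 := h.dt_dx hI hs ht
  rw [dt_sub_id] at h1
  rw [← h1]
  ext x
  have h2 := (h.dx.hasDerivAt hI hs ht x).add_const 1
  refine HasDerivAt.deriv (h2.congr_of_eventuallyEq ?_)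
  filter_upwards [hI.mem_nhds ht] with τ hτ
  exact dx_eq_of_curve hs h hτ x

theorem isCircleDiffeo_of_curve {k : ℕ} {s : WithTop ℝ} {I : Set ℝ} {φ : ℝ → ℝ → ℝ}
    (hs : ((1 / 2 : ℝ) : WithTop ℝ) < s) (h : IsCurve k (s + 1) I (fun t x => φ t x - x)) {t : ℝ}
    (ht : t ∈ I) (hpos : ∀ x, 0 < dx φ t x) : IsCircleDiffeo (φ t) (dx φ t) where
  hasDerivAt x := by
    rw [dx_eq_of_curve hs h ht]
    exact hasDerivAt_of_curve hs h ht x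
  continuous_deriv := (isCurve_dx_of_curve hs h).continuous hs ht
  pos := hpos
  periodic := h.periodic (half_lt_add_one hs) ht

namespace IsFlow

variable {s : WithTop ℝ} {I : Set ℝ} {φ a v σ : ℝ → ℝ → ℝ}

theorem isCircleDiffeo (h : IsFlow s I φ a v σ) {t : ℝ} (ht : t ∈ I) :
    IsCircleDiffeo (φ t) (dx φ t) := isCircleDiffeo_of_curve h.lt h.curve ht (h.pos t ht)

theorem isPair (h : IsFlow s I φ a v σ) : IsPair s I (dx φ) a where
  isOpen := h.isOpen
  lt := h.lt
  density := isCurve_dx_of_curve h.lt h.curve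
  fibre := h.curve_fibre
  pos := h.pos

theorem curve_dt (h : IsFlow s I φ a v σ) : IsCurve 1 (s + 1) I (dt φ) := by
  rw [← dt_sub_id]
  exact h.curve.dt h.isOpen

theorem hasDerivAt_time (h : IsFlow s I φ a v σ) {t : ℝ} (ht : t ∈ I) (x : ℝ) :
    HasDerivAt (fun τ => φ τ x) (v t (φ t x)) t := by
  have h1 := h.curve.hasDerivAt h.isOpen (half_lt_add_one h.lt) ht x
  rw [dt_sub_id, h.velocity t ht] at h1
  simpa using h1.add_const x

theorem velocity_eq (h : IsFlow s I φ a v σ) {t : ℝ} (ht : t ∈ I) (x : ℝ) :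
    v t x = dt φ t (Function.invFun (φ t) x) := by
  rw [h.velocity t ht, (h.isCircleDiffeo ht).apply_invFun]

theorem velocity_fibre_eq (h : IsFlow s I φ a v σ) {t : ℝ} (ht : t ∈ I) (x : ℝ) :
    σ t x = dt a t (Function.invFun (φ t) x) := by
  rw [h.velocity_fibre t ht, (h.isCircleDiffeo ht).apply_invFun]

/-- Chain rule for `v = φ̇ ∘ φ⁻¹`, with the mixed derivatives of `φ` interchanged: `v' ∘ φ` is the
logarithmic time derivative of the density. -/
theorem hasDerivAt_velocity (h : IsFlow s I φ a v σ) {t : ℝ} (ht : t ∈ I) (x : ℝ) :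
    HasDerivAt (v t) (dt (dx φ) t (Function.invFun (φ t) x) / dx φ t (Function.invFun (φ t) x))
      x := by
  have h1 : v t = dt φ t ∘ Function.invFun (φ t) := funext fun x => h.velocity_eq ht x
  rw [h1, div_eq_mul_inv, dt_dx_of_curve h.isOpen h.lt h.curve ht]
  exact (h.curve_dt.hasDerivAt_space h.lt ht _).comp x ((h.isCircleDiffeo ht).hasDerivAt_invFun x)

theorem dx_velocity (h : IsFlow s I φ a v σ) {t : ℝ} (ht : t ∈ I) :
    dx v t = fun x =>
      dt (dx φ) t (Function.invFun (φ t) x) / dx φ t (Function.invFun (φ t) x) :=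
  funext fun x => (h.hasDerivAt_velocity ht x).deriv

theorem dx_velocity_apply (h : IsFlow s I φ a v σ) {t : ℝ} (ht : t ∈ I) (y : ℝ) :
    dx v t (φ t y) = dt (dx φ) t y / dx φ t y := by
  simp only [h.dx_velocity ht, (h.isCircleDiffeo ht).invFun_apply]

theorem continuous_velocity (h : IsFlow s I φ a v σ) {t : ℝ} (ht : t ∈ I) : Continuous (v t) :=
  continuous_iff_continuousAt.mpr fun x => (h.hasDerivAt_velocity ht x).continuousAt

theorem continuous_dx_velocity (h : IsFlow s I φ a v σ) {t : ℝ} (ht : t ∈ I) :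
    Continuous (dx v t) := by
  rw [h.dx_velocity ht]
  exact (h.isPair.jointCont_quotient.space ht).comp (h.isCircleDiffeo ht).continuous_invFun

theorem continuous_velocity_fibre (h : IsFlow s I φ a v σ) {t : ℝ} (ht : t ∈ I) :
    Continuous (σ t) := by
  have h1 : σ t = dt a t ∘ Function.invFun (φ t) := funext fun x => h.velocity_fibre_eq ht x
  rw [h1]
  exact (h.isPair.jointCont_dt_fibre.space ht).comp (h.isCircleDiffeo ht).continuous_invFun

theorem periodic_velocity (h : IsFlow s I φ a v σ) {t : ℝ} (ht : t ∈ I) :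
    Function.Periodic (v t) 1 := by
  have h1 : v t = fun x => dt φ t (Function.invFun (φ t) x) := funext fun x => h.velocity_eq ht x
  rw [h1]
  exact (h.isCircleDiffeo ht).periodic_comp_invFun (h.curve_dt.periodic (half_lt_add_one h.lt) ht)

theorem periodic_velocity_fibre (h : IsFlow s I φ a v σ) {t : ℝ} (ht : t ∈ I) :
    Function.Periodic (σ t) 1 := by
  have h1 : σ t = fun x => dt a t (Function.invFun (φ t) x) :=
    funext fun x => h.velocity_fibre_eq ht x
  rw [h1]
  exact (h.isCircleDiffeo ht).periodic_comp_invFun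
    ((h.curve_fibre.dt h.isOpen).periodic h.lt ht)

theorem periodic_dx {u : ℝ → ℝ} (h : Function.Periodic u 1) : Function.Periodic (deriv u) 1 := by
  intro x
  rw [← deriv_comp_add_const]
  congr 1
  ext y
  exact h y

/-- Translates mean zero of `σ` into normalization of the lift `a`. -/
theorem integral_velocity_fibre (h : IsFlow s I φ a v σ) {t : ℝ} (ht : t ∈ I) :
    ∫ x in (0 : ℝ)..1, σ t x = ∫ y in (0 : ℝ)..1, dt a t y * dx φ t y := by
  rw [(h.isCircleDiffeo ht).integral_comp (h.continuous_velocity_fibre ht)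
    (h.periodic_velocity_fibre ht)]
  simp only [h.velocity_fibre t ht]

end IsFlow

/-! ### Test functions -/

section

variable {η : ℝ → ℝ → ℝ}

theorem hasFDerivAt_uncurry (h : ContDiff ℝ (⊤ : ℕ∞) fun p : ℝ × ℝ => η p.1 p.2) (t x : ℝ) :
    HasFDerivAt (fun p : ℝ × ℝ => η p.1 p.2) (fderiv ℝ (fun p : ℝ × ℝ => η p.1 p.2) (t, x))
      (t, x) :=
  (h.differentiable (by simp) (t, x)).hasFDerivAt

theorem hasDerivAt_dt (h : ContDiff ℝ (⊤ : ℕ∞) fun p : ℝ × ℝ => η p.1 p.2) (t x : ℝ) :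
    HasDerivAt (fun τ => η τ x) (fderiv ℝ (fun p : ℝ × ℝ => η p.1 p.2) (t, x) (1, 0)) t :=
  (hasFDerivAt_uncurry h t x).comp_hasDerivAt (f := fun τ => (τ, x)) t
    ((hasDerivAt_id t).prodMk (hasDerivAt_const t x))

theorem hasDerivAt_dx (h : ContDiff ℝ (⊤ : ℕ∞) fun p : ℝ × ℝ => η p.1 p.2) (t x : ℝ) :
    HasDerivAt (η t) (fderiv ℝ (fun p : ℝ × ℝ => η p.1 p.2) (t, x) (0, 1)) x :=
  (hasFDerivAt_uncurry h t x).comp_hasDerivAt (f := fun y => (t, y)) x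
    ((hasDerivAt_const x t).prodMk (hasDerivAt_id x))

theorem contDiff_dt (h : ContDiff ℝ (⊤ : ℕ∞) fun p : ℝ × ℝ => η p.1 p.2) :
    ContDiff ℝ (⊤ : ℕ∞) fun p : ℝ × ℝ => dt η p.1 p.2 := by
  have h1 : (fun p : ℝ × ℝ => dt η p.1 p.2) =
      fun p => fderiv ℝ (fun p : ℝ × ℝ => η p.1 p.2) p (1, 0) :=
    funext fun p => (hasDerivAt_dt h p.1 p.2).deriv
  rw [h1]
  exact (h.fderiv_right (m := (⊤ : ℕ∞)) (by simp)).clm_apply contDiff_const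

theorem contDiff_dx (h : ContDiff ℝ (⊤ : ℕ∞) fun p : ℝ × ℝ => η p.1 p.2) :
    ContDiff ℝ (⊤ : ℕ∞) fun p : ℝ × ℝ => dx η p.1 p.2 := by
  have h1 : (fun p : ℝ × ℝ => dx η p.1 p.2) =
      fun p => fderiv ℝ (fun p : ℝ × ℝ => η p.1 p.2) p (0, 1) :=
    funext fun p => (hasDerivAt_dx h p.1 p.2).deriv
  rw [h1]
  exact (h.fderiv_right (m := (⊤ : ℕ∞)) (by simp)).clm_apply contDiff_const

/-- For a trajectory `c = φ(·, y)` this is the material derivative `η_t + v η_x`, the combination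
occurring in both weak equations. -/
theorem hasDerivAt_along (h : ContDiff ℝ (⊤ : ℕ∞) fun p : ℝ × ℝ => η p.1 p.2) {c : ℝ → ℝ}
    {c' t : ℝ} (hc : HasDerivAt c c' t) :
    HasDerivAt (fun τ => η τ (c τ)) (dt η t (c t) + dx η t (c t) * c') t := by
  have h1 := (hasFDerivAt_uncurry h t (c t)).comp_hasDerivAt (f := fun τ => (τ, c τ)) t
    ((hasDerivAt_id t).prodMk hc)
  refine h1.congr_deriv ?_
  have h2 : ((1 : ℝ), c') = (1, 0) + c' • (0, 1) := by simp
  rw [h2, map_add, map_smul, smul_eq_mul, ← (hasDerivAt_dt h t (c t)).deriv,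
    ← (hasDerivAt_dx h t (c t)).deriv, mul_comm c']
  rfl

theorem IsTest.dx {I : Set ℝ} (h : IsTest I η) : IsTest I (dx η) := by
  obtain ⟨h1, h2, K, hK, hKI, h3⟩ := h
  refine ⟨contDiff_dx h1, fun t => IsFlow.periodic_dx (h2 t), K, hK, hKI, fun t ht x => ?_⟩
  have : η t = fun _ => 0 := funext fun y => h3 t ht y
  simp [HunterSaxton.dx, this]

theorem isTest_mul {I : Set ℝ} {χ f : ℝ → ℝ} (h1 : ContDiff ℝ (⊤ : ℕ∞) χ)
    (h2 : HasCompactSupport χ) (h3 : tsupport χ ⊆ I) (hf : ContDiff ℝ (⊤ : ℕ∞) f)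
    (hp : Function.Periodic f 1) : IsTest I (fun t x => χ t * f x) :=
  ⟨(h1.comp contDiff_fst).mul (hf.comp contDiff_snd), fun t x => by simp [hp x], tsupport χ, h2,
    h3, fun t ht x => by
      simp only [image_eq_zero_of_notMem_tsupport ht, zero_mul]⟩

end

/-! ### Weak solutions and the Euler–Lagrange equations -/

theorem dt_eq_zero_of_notMem {K : Set ℝ} (hK : IsCompact K) {ζ : ℝ → ℝ → ℝ}
    (h : ∀ t, t ∉ K → ∀ x, ζ t x = 0) {t : ℝ} (ht : t ∉ K) (x : ℝ) : dt ζ t x = 0 := by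
  have hev : (fun τ => ζ τ x) =ᶠ[𝓝 t] fun _ => 0 := by
    filter_upwards [hK.isClosed.isOpen_compl.mem_nhds ht] with τ hτ
    exact h τ hτ x
  rw [dt, hev.deriv_eq]
  simp

namespace IsFlow

variable {s : WithTop ℝ} {I : Set ℝ} {φ a v σ : ℝ → ℝ → ℝ}

theorem jointCont_time (h : IsFlow s I φ a v σ) : JointCont I φ := by
  have h1 := (h.curve.continuousOn (half_lt_add_one h.lt)).add continuous_snd.continuousOn
  refine h1.congr fun p _ => ?_
  simp

theorem jointCont_comp (h : IsFlow s I φ a v σ) {ζ : ℝ → ℝ → ℝ}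
    (hζ : Continuous fun p : ℝ × ℝ => ζ p.1 p.2) : JointCont I (fun t y => ζ t (φ t y)) :=
  hζ.comp_continuousOn (continuousOn_fst.prodMk h.jointCont_time)

theorem jointCont_dt (h : IsFlow s I φ a v σ) : JointCont I (dt φ) :=
  h.curve_dt.continuousOn (half_lt_add_one h.lt)

theorem jointCont_dt_along (h : IsFlow s I φ a v σ) {ζ : ℝ → ℝ → ℝ}
    (hζ : ContDiff ℝ (⊤ : ℕ∞) fun p : ℝ × ℝ => ζ p.1 p.2) :
    JointCont I (fun t y => dt ζ t (φ t y) + dx ζ t (φ t y) * v t (φ t y)) := by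
  refine ((h.jointCont_comp (contDiff_dt hζ).continuous).add
    ((h.jointCont_comp (contDiff_dx hζ).continuous).mul h.jointCont_dt)).congr fun p hp => ?_
  simp only [Pi.add_apply, Pi.mul_apply, h.velocity p.1 hp.1]

/-- A space-time integral along the flow, integrated by parts in time. -/
theorem integral_mul_along (h : IsFlow s I φ a v σ) {b c : ℝ} {P Q : ℝ → ℝ → ℝ}
    (hbc : b ≤ c) (hIcc : Icc b c ⊆ I) (cP : JointCont I P) (cQ : JointCont I Q)
    (hd : ∀ t ∈ I, ∀ x, HasDerivAt (fun τ => P τ x) (Q t x) t) {ζ : ℝ → ℝ → ℝ}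
    (hζ : ContDiff ℝ (⊤ : ℕ∞) fun p : ℝ × ℝ => ζ p.1 p.2) (hb : ∀ x, ζ b x = 0)
    (hc : ∀ x, ζ c x = 0) :
    ∫ t in b..c, ∫ y in (0 : ℝ)..1,
        P t y * (dt ζ t (φ t y) + dx ζ t (φ t y) * v t (φ t y)) =
      -∫ t in b..c, ∫ y in (0 : ℝ)..1, Q t y * ζ t (φ t y) := by
  have cw : JointCont I (fun t y => ζ t (φ t y)) := h.jointCont_comp hζ.continuous
  have cw' := h.jointCont_dt_along hζ
  exact integral_integral_mul_deriv hbc (cP.mono hIcc) (cQ.mono hIcc) (cw.mono hIcc)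
    (cw'.mono hIcc) (fun t ht => hd t (hIcc ht))
    (fun t ht y => hasDerivAt_along hζ (h.hasDerivAt_time (hIcc ht) y))
    (fun x => hb _) (fun x => hc _)

/-- Here `ζ` plays the role of `η_x`. Under `x = φ(t, y)`, `v' dx` becomes `ρ̇ dy`, so `v'(ζ_t + v
ζ_x)` becomes `ρ̇` times a time derivative. Integrating by parts produces `-ρ̈ ζ`, which combines
with the quadratic terms into `elDensity`. -/
theorem integral_weak_velocity (h : IsFlow s I φ a v σ) (hI' : I.OrdConnected)
    (hne : I.Nonempty) {ζ : ℝ → ℝ → ℝ} (hζ : IsTest I ζ) :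
    (∫ t in I, ∫ x in (0 : ℝ)..1, (dx v t x * dt ζ t x + v t x * dx v t x * dx ζ t x +
      (dx v t x ^ 2 / 2 + σ t x ^ 2 / 2) * ζ t x)) =
    ∫ t in I, ∫ y in (0 : ℝ)..1,
      1 / 2 * elDensity (dx φ) a t y * dx φ t y * ζ t (φ t y) := by
  obtain ⟨h1, h2, K, hK, hKI, h3⟩ := hζ
  obtain ⟨b, c, hbc, hKbc, hIcc⟩ := exists_Icc_subset h.isOpen hI' hne hK hKI
  have hp := h.isPair
  have hζ0 : ∀ t, t ∉ K → ζ t = fun _ => 0 := fun t ht => funext (h3 t ht)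
  have hdt0 : ∀ t, t ∉ K → ∀ x, dt ζ t x = 0 := fun t ht => dt_eq_zero_of_notMem hK h3 ht
  have hdx0 : ∀ t, t ∉ K → ∀ x, dx ζ t x = 0 := fun t ht x => by
    simp [dx, hζ0 t ht]
  rw [setIntegral_eq_intervalIntegral hbc.le hKbc hIcc fun t ht => by
      simp [hζ0 t ht, hdt0 t ht, hdx0 t ht],
    setIntegral_eq_intervalIntegral hbc.le hKbc hIcc fun t ht => by simp [hζ0 t ht]]
  have hI : ∀ {t : ℝ}, t ∈ uIcc b c → t ∈ I := fun {t} ht => hIcc (uIcc_of_le hbc.le ▸ ht)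
  have e1 : ∀ t ∈ uIcc b c, (∫ x in (0 : ℝ)..1, (dx v t x * dt ζ t x +
      v t x * dx v t x * dx ζ t x + (dx v t x ^ 2 / 2 + σ t x ^ 2 / 2) * ζ t x)) =
      ∫ y in (0 : ℝ)..1, (dt (dx φ) t y * (dt ζ t (φ t y) + dx ζ t (φ t y) * v t (φ t y)) +
        ((dt (dx φ) t y / dx φ t y) ^ 2 / 2 + dt a t y ^ 2 / 2) * dx φ t y * ζ t (φ t y)) := by
    intro t ht
    have htI := hI ht
    have c1 := h.continuous_velocity htI
    have c2 := h.continuous_dx_velocity htI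
    have c3 := h.continuous_velocity_fibre htI
    have p1 := h.periodic_velocity htI
    have p2 : Function.Periodic (dx v t) 1 := periodic_dx p1
    have p3 := h.periodic_velocity_fibre htI
    have sl : ∀ {f : ℝ → ℝ → ℝ}, (ContDiff ℝ (⊤ : ℕ∞) fun p : ℝ × ℝ => f p.1 p.2) →
        Continuous (f t) :=
      fun {f} hf => hf.continuous.comp (by fun_prop : Continuous fun x : ℝ => (t, x))
    have c4 := sl h1
    have c5 := sl (contDiff_dt h1)
    have c6 := sl (contDiff_dx h1)
    have p4 := h2 t
    have p5 : Function.Periodic (dt ζ t) 1 := fun x => by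
      unfold dt
      congr 1
      ext τ
      exact h2 τ x
    have p6 : Function.Periodic (dx ζ t) 1 := periodic_dx (h2 t)
    rw [(h.isCircleDiffeo htI).integral_comp (by fun_prop)
      (fun x => by simp only [p1 x, p2 x, p3 x, p4 x, p5 x, p6 x])]
    refine intervalIntegral.integral_congr fun y _ => ?_
    have hne : dx φ t y ≠ 0 := (h.pos t htI y).ne'
    simp only [h.dx_velocity_apply htI, ← h.velocity_fibre t htI]
    field_simp
  rw [intervalIntegral.integral_congr e1]
  have cq := hp.jointCont_quotient
  have cw : JointCont I (fun t y => ζ t (φ t y)) := h.jointCont_comp h1.continuous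
  have cw' := h.jointCont_dt_along h1
  have j1 : JointCont I (fun t y =>
      dt (dx φ) t y * (dt ζ t (φ t y) + dx ζ t (φ t y) * v t (φ t y))) :=
    hp.jointCont_dt_density.mul cw'
  have j2 : JointCont I (fun t y =>
      ((dt (dx φ) t y / dx φ t y) ^ 2 / 2 + dt a t y ^ 2 / 2) * dx φ t y * ζ t (φ t y)) :=
    (((((cq.pow 2).div_const 2).add ((hp.jointCont_dt_fibre.pow 2).div_const 2))).mul
      hp.jointCont_density).mul cw
  have j3 : JointCont I (fun t y => dt (dt (dx φ)) t y * ζ t (φ t y)) :=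
    hp.jointCont_dt_dt_density.mul cw
  have ibp := h.integral_mul_along hbc.le hIcc hp.jointCont_dt_density hp.jointCont_dt_dt_density
    (fun t ht x => hp.hasDerivAt_dt_density ht x) h1 (h3 b fun h => (hKbc h).1.false)
    (h3 c fun h => (hKbc h).2.false)
  have ii : ∀ {f : ℝ → ℝ → ℝ}, JointCont I f → ∀ t ∈ uIcc b c,
      IntervalIntegrable (f t) volume 0 1 :=
    fun {f} hf t ht => (hf.space (hI ht)).intervalIntegrable _ _
  have jj : ∀ {f : ℝ → ℝ → ℝ}, JointCont I f →
      IntervalIntegrable (fun t => ∫ x in (0 : ℝ)..1, f t x) volume b c :=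
    fun {f} hf => ((hf.integral 0 1).mono (by rwa [uIcc_of_le hbc.le])).intervalIntegrable
  rw [intervalIntegral.integral_congr fun t ht =>
      intervalIntegral.integral_add (ii j1 t ht) (ii j2 t ht),
    intervalIntegral.integral_add (jj j1) (jj j2), ibp, neg_add_eq_sub,
    ← intervalIntegral.integral_sub (jj j2) (jj j3)]
  refine intervalIntegral.integral_congr fun t ht => ?_
  rw [← intervalIntegral.integral_sub (ii j2 t ht) (ii j3 t ht)]
  refine intervalIntegral.integral_congr fun y _ => ?_
  have hne : dx φ t y ≠ 0 := (h.pos t (hI ht) y).ne'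
  simp only [elDensity]
  field_simp
  ring

/-- The same change of variables, applied to the momentum density `ȧρ`, whose time derivative is
`elFibre`. -/
theorem integral_weak_fibre (h : IsFlow s I φ a v σ) (hI' : I.OrdConnected)
    (hne : I.Nonempty) {ζ : ℝ → ℝ → ℝ} (hζ : IsTest I ζ) :
    (∫ t in I, ∫ x in (0 : ℝ)..1, (σ t x * dt ζ t x + σ t x * v t x * dx ζ t x)) =
    ∫ t in I, ∫ y in (0 : ℝ)..1, -elFibre (dx φ) a t y * ζ t (φ t y) := by
  obtain ⟨h1, h2, K, hK, hKI, h3⟩ := hζ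
  obtain ⟨b, c, hbc, hKbc, hIcc⟩ := exists_Icc_subset h.isOpen hI' hne hK hKI
  have hp := h.isPair
  have hζ0 : ∀ t, t ∉ K → ζ t = fun _ => 0 := fun t ht => funext (h3 t ht)
  have hdt0 : ∀ t, t ∉ K → ∀ x, dt ζ t x = 0 := fun t ht => dt_eq_zero_of_notMem hK h3 ht
  have hdx0 : ∀ t, t ∉ K → ∀ x, dx ζ t x = 0 := fun t ht x => by
    simp [dx, hζ0 t ht]
  rw [setIntegral_eq_intervalIntegral hbc.le hKbc hIcc fun t ht => by
      simp [hdt0 t ht, hdx0 t ht],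
    setIntegral_eq_intervalIntegral hbc.le hKbc hIcc fun t ht => by simp [hζ0 t ht]]
  have hI : ∀ {t : ℝ}, t ∈ uIcc b c → t ∈ I := fun {t} ht => hIcc (uIcc_of_le hbc.le ▸ ht)
  have e1 : ∀ t ∈ uIcc b c, (∫ x in (0 : ℝ)..1, (σ t x * dt ζ t x + σ t x * v t x * dx ζ t x)) =
      ∫ y in (0 : ℝ)..1,
        dt a t y * dx φ t y * (dt ζ t (φ t y) + dx ζ t (φ t y) * v t (φ t y)) := by
    intro t ht
    have htI := hI ht
    have c1 := h.continuous_velocity htI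
    have c3 := h.continuous_velocity_fibre htI
    have p1 := h.periodic_velocity htI
    have p3 := h.periodic_velocity_fibre htI
    have sl : ∀ {f : ℝ → ℝ → ℝ}, (ContDiff ℝ (⊤ : ℕ∞) fun p : ℝ × ℝ => f p.1 p.2) →
        Continuous (f t) :=
      fun {f} hf => hf.continuous.comp (by fun_prop : Continuous fun x : ℝ => (t, x))
    have c5 := sl (contDiff_dt h1)
    have c6 := sl (contDiff_dx h1)
    have p5 : Function.Periodic (dt ζ t) 1 := fun x => by
      unfold dt
      congr 1
      ext τ
      exact h2 τ x
    have p6 : Function.Periodic (dx ζ t) 1 := periodic_dx (h2 t)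
    rw [(h.isCircleDiffeo htI).integral_comp (by fun_prop)
      (fun x => by simp only [p1 x, p3 x, p5 x, p6 x])]
    refine intervalIntegral.integral_congr fun y _ => ?_
    simp only [← h.velocity_fibre t htI]
    ring
  rw [intervalIntegral.integral_congr e1, h.integral_mul_along (P := fun t y => dt a t y * dx φ t y)
    hbc.le hIcc (hp.jointCont_dt_fibre.mul hp.jointCont_density) hp.jointCont_elFibre
    (fun t ht x => hp.hasDerivAt_momentum ht x) h1 (h3 b fun h => (hKbc h).1.false)
    (h3 c fun h => (hKbc h).2.false), ← intervalIntegral.integral_neg]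
  refine intervalIntegral.integral_congr fun t _ => ?_
  rw [← intervalIntegral.integral_neg]
  simp only [neg_mul]

/-- The Eulerian velocity of a curve is a weak solution of the two-component Hunter–Saxton
equation if and only if the curve satisfies the Euler–Lagrange equations. -/
theorem isWeakSolution_iff_eulerLagrange (h : IsFlow s I φ a v σ) (hI' : I.OrdConnected)
    (hne : I.Nonempty) : IsWeakSolution I v σ ↔ EulerLagrange I (dx φ) a := by
  have hp := h.isPair
  constructor
  · intro hw
    -- Only functions `f` with a periodic primitive `F` can be reached, as the first equation is
    -- tested with `η_x`. This is why `elDensity` is determined up to a constant at each time.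
    have density_orth : ∀ {f F : ℝ → ℝ}, ContDiff ℝ (⊤ : ℕ∞) f → ContDiff ℝ (⊤ : ℕ∞) F →
        Function.Periodic F 1 → (∀ x, HasDerivAt F (f x) x) → ∀ t ∈ I,
        ∫ y in (0 : ℝ)..1, elDensity (dx φ) a t y * dx φ t y * f (φ t y) = 0 := by
      intro f F hf hF hFp hd t ht
      have hj : JointCont I (fun t y => elDensity (dx φ) a t y * dx φ t y * f (φ t y)) :=
        (hp.jointCont_elDensity.mul hp.jointCont_density).mul
          (hf.continuous.comp_continuousOn h.jointCont_time)
      refine eq_zero_of_integral_mul_eq_zero h.isOpen (hj.integral 0 1) (fun χ h1 h2 h3 => ?_) ht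
      have ht := isTest_mul h1 h2 h3 hF hFp
      have h4 := (hw _ ht).1
      rw [h.integral_weak_velocity hI' hne ht.dx] at h4
      have h5 : ∀ t x, dx (fun t x => χ t * F x) t x = χ t * f x := fun t x =>
        ((hd x).const_mul (χ t)).deriv
      simp only [h5] at h4
      have h6 : (1 / 2 : ℝ) * ∫ t in I, χ t * ∫ y in (0 : ℝ)..1,
          elDensity (dx φ) a t y * dx φ t y * f (φ t y) = 0 := by
        rw [← h4, ← integral_const_mul]
        congr 1
        ext t
        rw [← intervalIntegral.integral_const_mul, ← intervalIntegral.integral_const_mul]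
        congr 1
        ext y
        ring
      linarith
    have fibre_orth : ∀ {f : ℝ → ℝ}, ContDiff ℝ (⊤ : ℕ∞) f → Function.Periodic f 1 →
        ∀ t ∈ I, ∫ y in (0 : ℝ)..1, elFibre (dx φ) a t y * f (φ t y) = 0 := by
      intro f hf hfp t ht
      have hj : JointCont I (fun t y => elFibre (dx φ) a t y * f (φ t y)) :=
        hp.jointCont_elFibre.mul (hf.continuous.comp_continuousOn h.jointCont_time)
      refine eq_zero_of_integral_mul_eq_zero h.isOpen (hj.integral 0 1) (fun χ h1 h2 h3 => ?_) ht
      have ht := isTest_mul h1 h2 h3 hf hfp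
      have h4 := (hw _ ht).2
      rw [h.integral_weak_fibre hI' hne ht] at h4
      have h6 : (-1 : ℝ) * ∫ t in I, χ t * ∫ y in (0 : ℝ)..1,
          elFibre (dx φ) a t y * f (φ t y) = 0 := by
        rw [← h4, ← integral_const_mul]
        congr 1
        ext t
        rw [← intervalIntegral.integral_const_mul, ← intervalIntegral.integral_const_mul]
        congr 1
        ext y
        ring
      linarith
    intro t ht
    have hφ := h.isCircleDiffeo ht
    constructor
    · refine ⟨_, fun x => hφ.eq_mean_of_orthogonal (hp.jointCont_elDensity.space ht)
        (hp.periodic_elDensity ht) (fun n hn => ?_) (fun n hn => ?_) x⟩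
      · have hn' : (n : ℝ) ≠ 0 := by exact_mod_cast hn
        have hpi := Real.pi_ne_zero
        refine density_orth (contDiff_cosFun n) (F := fun x => sinFun n x / (2 * Real.pi * n))
          ((contDiff_sinFun n).div_const _) (fun x => by simp only [periodic_sinFun n x])
          (fun x => ((hasDerivAt_sinFun n x).div_const _).congr_deriv ?_) t ht
        field_simp
      · have hn' : (n : ℝ) ≠ 0 := by exact_mod_cast hn
        have hpi := Real.pi_ne_zero
        refine density_orth (contDiff_sinFun n) (F := fun x => -cosFun n x / (2 * Real.pi * n))
          ((contDiff_cosFun n).neg.div_const _) (fun x => by simp only [periodic_cosFun n x])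
          (fun x => ((hasDerivAt_cosFun n x).neg.div_const _).congr_deriv ?_) t ht
        field_simp
    · have hne' : ∀ x, dx φ t x ≠ 0 := fun x => (h.pos t ht x).ne'
      -- Division by the density supplies the Jacobian that the orthogonality lemma expects; the
      -- test function `1` then shows that the mean is zero.
      have hper : Function.Periodic (fun y => elFibre (dx φ) a t y / dx φ t y) 1 := fun y => by
        simp only [hp.periodic_elFibre ht y, hp.periodic_density ht y]
      have hq : ∀ (f : ℝ → ℝ) y, elFibre (dx φ) a t y / dx φ t y * dx φ t y * f (φ t y) =
          elFibre (dx φ) a t y * f (φ t y) := fun f y => by rw [div_mul_cancel₀ _ (hne' y)]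
      have key := hφ.eq_mean_of_orthogonal (G := fun y => elFibre (dx φ) a t y / dx φ t y)
        ((hp.jointCont_elFibre.space ht).div (hp.jointCont_density.space ht) hne') hper
        (fun n _ => by
          simp only [hq]
          exact fibre_orth (contDiff_cosFun n) (periodic_cosFun n) t ht)
        (fun n _ => by
          simp only [hq]
          exact fibre_orth (contDiff_sinFun n) (periodic_sinFun n) t ht)
      have h0 : ∫ y in (0 : ℝ)..1, elFibre (dx φ) a t y / dx φ t y * dx φ t y = 0 := by
        have := fibre_orth (f := fun _ => 1) contDiff_const (fun _ => rfl) t ht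
        simpa only [div_mul_cancel₀ _ (hne' _), mul_one] using this
      intro x
      have := key x
      rw [h0, div_eq_zero_iff] at this
      exact this.resolve_right (hne' x)
  · intro hEL η hη
    rw [h.integral_weak_velocity hI' hne hη.dx, h.integral_weak_fibre hI' hne hη]
    constructor
    · refine setIntegral_eq_zero_of_forall_eq_zero fun t ht => ?_
      obtain ⟨⟨c, hc⟩, -⟩ := hEL t ht
      have cη : Continuous (dx η t) :=
        (contDiff_dx hη.1).continuous.comp (by fun_prop : Continuous fun x : ℝ => (t, x))
      have e1 := (h.isCircleDiffeo ht).integral_comp cη (periodic_dx (hη.2.1 t))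
      -- The constant value of `elDensity` integrates to zero against the space derivative of a
      -- periodic function.
      have e2 : ∫ x in (0 : ℝ)..1, dx η t x = 0 := by
        rw [intervalIntegral.integral_eq_sub_of_hasDerivAt (f := η t)
          (fun x _ => by
            rw [show dx η t x = _ from (hasDerivAt_dx hη.1 t x).deriv]
            exact hasDerivAt_dx hη.1 t x)
          (cη.intervalIntegrable _ _)]
        have := hη.2.1 t 0
        rw [zero_add] at this
        rw [this, sub_self]
      rw [e1] at e2
      have e3 : (1 / 2 * c) * ∫ y in (0 : ℝ)..1, dx η t (φ t y) * dx φ t y = 0 := by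
        rw [e2, mul_zero]
      refine Eq.trans ?_ e3
      rw [← intervalIntegral.integral_const_mul]
      refine intervalIntegral.integral_congr fun y _ => ?_
      simp only [hc]
      ring
    · refine setIntegral_eq_zero_of_forall_eq_zero fun t ht => ?_
      simp [(hEL t ht).2]

end IsFlow

/-! ### Classical solutions -/

theorem IsCurve.hasDerivAt_along {k : ℕ} {s : WithTop ℝ} {I : Set ℝ} {u : ℝ → ℝ → ℝ}
    (hI : IsOpen I) (hs : ((1 / 2 : ℝ) : WithTop ℝ) < s) (h : IsCurve (k + 1) (s + 1) I u) {t : ℝ}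
    (ht : t ∈ I) {c : ℝ → ℝ} {c' : ℝ} (hc : HasDerivAt c c' t) :
    HasDerivAt (fun τ => u τ (c τ))
      (HunterSaxton.dt u t (c t) + HunterSaxton.dx u t (c t) * c') t := by
  have h1 := (h.hasStrictFDerivAt hI hs ht (c t)).hasFDerivAt.comp_hasDerivAt
    (f := fun τ => (τ, c τ)) t ((hasDerivAt_id t).prodMk hc)
  refine h1.congr_deriv ?_
  simp [mul_comm]

/-- The linear map `(a, b) ↦ (a, α a + β b)`. -/
def shearEquiv (α β : ℝ) (hβ : β ≠ 0) : (ℝ × ℝ) ≃L[ℝ] (ℝ × ℝ) :=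
  ContinuousLinearEquiv.equivOfInverse
    ((ContinuousLinearMap.fst ℝ ℝ ℝ).prod
      ((ContinuousLinearMap.toSpanSingleton ℝ α).coprod (ContinuousLinearMap.toSpanSingleton ℝ β)))
    ((ContinuousLinearMap.fst ℝ ℝ ℝ).prod ((ContinuousLinearMap.toSpanSingleton ℝ (-α / β)).coprod
      (ContinuousLinearMap.toSpanSingleton ℝ β⁻¹)))
    (fun p => by
      ext
      · simp
      · simp
        field_simp
        ring)
    (fun p => by
      ext
      · simp
      · simp
        field_simp
        ring)

theorem shearEquiv_apply (α β : ℝ) (hβ : β ≠ 0) (p : ℝ × ℝ) :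
    shearEquiv α β hβ p = (p.1, α * p.1 + β * p.2) := by
  ext <;> simp [shearEquiv, mul_comm]

theorem shearEquiv_symm_apply (α β : ℝ) (hβ : β ≠ 0) (p : ℝ × ℝ) :
    (shearEquiv α β hβ).symm p = (p.1, -α / β * p.1 + β⁻¹ * p.2) := by
  rw [ContinuousLinearEquiv.symm_apply_eq, shearEquiv_apply]
  ext
  · simp
  · simp only
    field_simp
    ring

namespace IsFlow

variable {s : WithTop ℝ} {I : Set ℝ} {φ a v σ : ℝ → ℝ → ℝ}

theorem anti {s' : WithTop ℝ} (h : IsFlow s I φ a v σ) (hs : ((1 / 2 : ℝ) : WithTop ℝ) < s')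
    (hss : s' ≤ s) : IsFlow s' I φ a v σ where
  isOpen := h.isOpen
  lt := hs
  curve := h.curve.anti (by gcongr)
  curve_fibre := h.curve_fibre.anti hss
  pos := h.pos
  velocity := h.velocity
  velocity_fibre := h.velocity_fibre

/-- The derivative is an invertible shear since `φ' > 0`, so the inverse function theorem applies to
`(t, y) ↦ (t, φ(t, y))`. -/
theorem hasStrictFDerivAt (h : IsFlow s I φ a v σ) {t : ℝ} (ht : t ∈ I) (y : ℝ) :
    HasStrictFDerivAt (fun p : ℝ × ℝ => (p.1, φ p.1 p.2))
      (shearEquiv (dt φ t y) (dx φ t y) (h.pos t ht y).ne' : ℝ × ℝ →L[ℝ] ℝ × ℝ) (t, y) := by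
  have h1 := (h.curve.hasStrictFDerivAt h.isOpen h.lt ht y).add
    (hasStrictFDerivAt_snd (𝕜 := ℝ) (E := ℝ) (F := ℝ) (p := (t, y)))
  have h2 : (fun p : ℝ × ℝ => φ p.1 p.2 - p.2 + p.2) = fun p => φ p.1 p.2 := by
    ext p
    ring
  have h3 := hasStrictFDerivAt_fst (𝕜 := ℝ) (E := ℝ) (F := ℝ) (p := (t, y)) |>.prodMk h1
  rw [dt_sub_id] at h3
  have h4 := dx_eq_of_curve h.lt h.curve ht y
  convert! h3 using 1
  · ext p <;> simp
  · ext <;> simp [shearEquiv_apply, h4]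

/-- The value is what differentiating `φ(t, φ⁻¹(t, x)) = x` predicts. Differentiability comes from
the local inverse of the space-time map, which agrees with the global inverse because each `φ t` is
injective. -/
theorem hasDerivAt_invFun_time (h : IsFlow s I φ a v σ) {t : ℝ} (ht : t ∈ I) (x : ℝ) :
    HasDerivAt (fun τ => Function.invFun (φ τ) x)
      (-v t x / dx φ t (Function.invFun (φ t) x)) t := by
  set y := Function.invFun (φ t) x with hy
  have hx : φ t y = x := (h.isCircleDiffeo ht).apply_invFun x
  have hst := h.hasStrictFDerivAt ht y
  have h1 := hst.to_localInverse
  have h2 := hst.eventually_right_inverse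
  simp only [hx] at h1 h2
  set g := hst.localInverse _ _ _ with hg
  have h3 := h1.hasFDerivAt.comp_hasDerivAt (f := fun τ => (τ, x)) t
    ((hasDerivAt_id t).prodMk (hasDerivAt_const t x))
  have h4 := (ContinuousLinearMap.snd ℝ ℝ ℝ).hasFDerivAt.comp_hasDerivAt t h3
  have h5 : HasDerivAt (fun τ => (g (τ, x)).2) (-v t x / dx φ t y) t := by
    refine h4.congr_deriv ?_
    have := h.velocity t ht y
    rw [hx] at this
    simp [shearEquiv_symm_apply, this]
  refine h5.congr_of_eventuallyEq ?_
  have h6 : Tendsto (fun τ : ℝ => (τ, x)) (𝓝 t) (𝓝 (t, x)) :=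
    (by fun_prop : Continuous fun τ : ℝ => (τ, x)).tendsto t
  filter_upwards [h6.eventually h2, h.isOpen.mem_nhds ht] with τ hτ hτI
  have e1 : (g (τ, x)).1 = τ := congrArg Prod.fst hτ
  have e2 : φ (g (τ, x)).1 (g (τ, x)).2 = x := congrArg Prod.snd hτ
  rw [e1] at e2
  rw [← (h.isCircleDiffeo hτI).invFun_apply (g (τ, x)).2, e2]

/-- The second space derivative of the velocity in Lagrangian coordinates. -/
def lagSecond (ρ : ℝ → ℝ → ℝ) (t y : ℝ) : ℝ :=
  (dx (dt ρ) t y * ρ t y - dt ρ t y * dx ρ t y) / ρ t y ^ 3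

theorem hasDerivAt_comp_invFun (h : IsFlow s I φ a v σ) {t : ℝ} (ht : t ∈ I) {f : ℝ → ℝ}
    {f' x : ℝ} (hf : HasDerivAt f f' (Function.invFun (φ t) x)) :
    HasDerivAt (fun x => f (Function.invFun (φ t) x))
      (f' / dx φ t (Function.invFun (φ t) x)) x := by
  rw [div_eq_mul_inv]
  exact hf.comp x ((h.isCircleDiffeo ht).hasDerivAt_invFun x)

theorem contDiff_invFun (h : IsFlow s I φ a v σ) {t : ℝ} (ht : t ∈ I) :
    ContDiff ℝ 1 (Function.invFun (φ t)) := by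
  have hφ := h.isCircleDiffeo ht
  rw [contDiff_one_iff_deriv]
  refine ⟨fun x => (hφ.hasDerivAt_invFun x).differentiableAt, ?_⟩
  have : deriv (Function.invFun (φ t)) = fun x => (dx φ t (Function.invFun (φ t) x))⁻¹ :=
    funext fun x => (hφ.hasDerivAt_invFun x).deriv
  rw [this]
  exact (hφ.continuous_deriv.comp hφ.continuous_invFun).inv₀ fun x => (hφ.pos _).ne'

section

variable {S : WithTop ℝ}

/-- The index `S + 2` with `S > 1/2` encodes `s > 5/2`: the density and its time derivative can then
be differentiated twice in space, which is what three derivatives of `v` need. -/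
theorem dx_dx_velocity (h : IsFlow (S + 1 + 1) I φ a v σ)
    (hS : ((1 / 2 : ℝ) : WithTop ℝ) < S) {t : ℝ} (ht : t ∈ I) (x : ℝ) :
    HasDerivAt (dx v t) (lagSecond (dx φ) t (Function.invFun (φ t) x)) x := by
  have hp := h.isPair
  have hS1 := half_lt_add_one hS
  rw [h.dx_velocity ht]
  have d1 := (hp.density.dt hp.isOpen).hasDerivAt_space hS1 ht (Function.invFun (φ t) x)
  have d2 := hp.density.hasDerivAt_space hS1 ht (Function.invFun (φ t) x)
  have hne := (h.pos t ht (Function.invFun (φ t) x)).ne'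
  refine (h.hasDerivAt_comp_invFun ht (d1.div d2 hne)).congr_deriv ?_
  rw [lagSecond]
  field_simp

theorem contDiff_lagSecond (h : IsFlow (S + 1 + 1) I φ a v σ)
    (hS : ((1 / 2 : ℝ) : WithTop ℝ) < S) {t : ℝ} (ht : t ∈ I) :
    ContDiff ℝ 1 (lagSecond (dx φ) t) := by
  have hp := h.isPair
  have hS1 := half_lt_add_one hS
  have c1 := hp.density.contDiff hS1 ht
  have c2 := (hp.density.dt hp.isOpen).contDiff hS1 ht
  have c3 := hp.density.dx.contDiff hS ht
  have c4 := (hp.density.dt hp.isOpen).dx.contDiff hS ht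
  exact ((c4.mul c1).sub (c2.mul c3)).div (c1.pow 3) fun y => pow_ne_zero 3 (h.pos t ht y).ne'

theorem contDiff_velocity (h : IsFlow (S + 1 + 1) I φ a v σ)
    (hS : ((1 / 2 : ℝ) : WithTop ℝ) < S) {t : ℝ} (ht : t ∈ I) : ContDiff ℝ 3 (v t) := by
  have h2 : dx (dx v) t = fun x => lagSecond (dx φ) t (Function.invFun (φ t) x) :=
    funext fun x => (h.dx_dx_velocity hS ht x).deriv
  have c1 : ContDiff ℝ 1 (dx (dx v) t) := by
    rw [h2]
    exact (h.contDiff_lagSecond hS ht).comp (h.contDiff_invFun ht)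
  have c2 : ContDiff ℝ (1 + 1) (dx v t) := contDiff_succ_iff_deriv.mpr
    ⟨fun x => (h.dx_dx_velocity hS ht x).differentiableAt, by simp, c1⟩
  rw [show (3 : WithTop ℕ∞) = 1 + 1 + 1 by norm_num]
  exact contDiff_succ_iff_deriv.mpr
    ⟨fun x => (h.hasDerivAt_velocity ht x).differentiableAt, by simp, c2⟩

theorem hasDerivAt_velocity_fibre (h : IsFlow (S + 1 + 1) I φ a v σ)
    (hS : ((1 / 2 : ℝ) : WithTop ℝ) < S) {t : ℝ} (ht : t ∈ I) (x : ℝ) :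
    HasDerivAt (σ t) (dx (dt a) t (Function.invFun (φ t) x) / dx φ t (Function.invFun (φ t) x))
      x := by
  have h1 : σ t = fun x => dt a t (Function.invFun (φ t) x) :=
    funext fun x => h.velocity_fibre_eq ht x
  rw [h1]
  exact h.hasDerivAt_comp_invFun ht
    ((h.curve_fibre.dt h.isOpen).hasDerivAt_space (half_lt_add_one hS) ht _)

theorem contDiff_velocity_fibre (h : IsFlow (S + 1 + 1) I φ a v σ)
    (hS : ((1 / 2 : ℝ) : WithTop ℝ) < S) {t : ℝ} (ht : t ∈ I) : ContDiff ℝ 1 (σ t) := by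
  have h1 : σ t = fun x => dt a t (Function.invFun (φ t) x) :=
    funext fun x => h.velocity_fibre_eq ht x
  rw [h1]
  exact ((h.curve_fibre.dt h.isOpen).contDiff (half_lt_add_one hS) ht).comp (h.contDiff_invFun ht)

/-- The space derivative of the Euler–Lagrange expression. -/
theorem hasDerivAt_elDensity (h : IsFlow (S + 1 + 1) I φ a v σ)
    (hS : ((1 / 2 : ℝ) : WithTop ℝ) < S) {t : ℝ} (ht : t ∈ I) (y : ℝ) :
    HasDerivAt (elDensity (dx φ) a t)
      (2 * dt a t y * dx (dt a) t y + 2 * (dt (dx φ) t y / dx φ t y) *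
        ((dx (dt (dx φ)) t y * dx φ t y - dt (dx φ) t y * dx (dx φ) t y) / dx φ t y ^ 2) -
        (2 * dx (dt (dt (dx φ))) t y * dx φ t y - 2 * dt (dt (dx φ)) t y * dx (dx φ) t y) /
          dx φ t y ^ 2) y := by
  have hp := h.isPair
  have hS1 := half_lt_add_one hS
  have d1 := (hp.fibre.dt hp.isOpen).hasDerivAt_space hS1 ht y
  have d2 := (hp.density.dt hp.isOpen).hasDerivAt_space hS1 ht y
  have d3 := hp.density.hasDerivAt_space hS1 ht y
  have d4 := ((hp.density.dt hp.isOpen).dt hp.isOpen).hasDerivAt_space hS1 ht y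
  have hne := (h.pos t ht y).ne'
  have := ((d1.pow 2).add ((d2.div d3 hne).pow 2)).sub ((d4.const_mul 2).div d3 hne)
  refine this.congr_deriv ?_
  simp

/-- The residual of the first equation in Lagrangian coordinates. -/
theorem hasDerivAt_dx_dx_velocity_time (h : IsFlow (S + 1 + 1) I φ a v σ)
    (hS : ((1 / 2 : ℝ) : WithTop ℝ) < S) {t : ℝ} (ht : t ∈ I) (y : ℝ) :
    HasDerivAt (fun τ => dx (dx v) τ (φ t y))
      (-2 * dx v t (φ t y) * dx (dx v) t (φ t y) - v t (φ t y) * dx (dx (dx v)) t (φ t y) +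
        σ t (φ t y) * dx σ t (φ t y) - deriv (elDensity (dx φ) a t) y / (2 * dx φ t y)) t := by
  have hp := h.isPair
  have hI := h.isOpen
  have hS1 := half_lt_add_one hS
  have hφ := h.isCircleDiffeo ht
  set x := φ t y with hx
  have hy : Function.invFun (φ t) x = y := hφ.invFun_apply y
  have hne := (h.pos t ht y).ne'
  have hc := h.hasDerivAt_invFun_time ht x
  have e1 := hp.density.hasDerivAt_along hI hS1 ht hc
  have e2 := (hp.density.dt hI).hasDerivAt_along hI hS1 ht hc
  have e3 := hp.density.dx.hasDerivAt_along hI hS ht hc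
  have e4 := (hp.density.dt hI).dx.hasDerivAt_along hI hS ht hc
  rw [hy] at e1 e2 e3 e4
  -- Time and space derivatives are brought into one order so that both sides involve the same
  -- quantities.
  rw [hp.density.dt_dx hI hS1 ht] at e3
  rw [(hp.density.dt hI).dt_dx hI hS1 ht] at e4
  have hlag : ∀ τ ∈ I, ∀ z, dx (dx v) τ z = lagSecond (dx φ) τ (Function.invFun (φ τ) z) :=
    fun τ hτ z => (h.dx_dx_velocity hS hτ z).deriv
  have E := ((e4.mul e1).sub (e2.mul e3)).div (e1.pow 3) (by
    simp only [Pi.pow_apply, hy]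
    exact pow_ne_zero 3 hne)
  have s1 := hp.density.hasDerivAt_space hS1 ht y
  have s2 := (hp.density.dt hI).hasDerivAt_space hS1 ht y
  have s3 := hp.density.dx.hasDerivAt_space hS ht y
  have s4 := (hp.density.dt hI).dx.hasDerivAt_space hS ht y
  have F := ((s4.mul s1).sub (s2.mul s3)).div (s1.pow 3) (pow_ne_zero 3 hne)
  have v1 : dx v t x = dt (dx φ) t y / dx φ t y := h.dx_velocity_apply ht y
  have v2 : dx (dx v) t x = lagSecond (dx φ) t y := by rw [hlag t ht, hy]
  have v3 : dx (dx (dx v)) t x = deriv (lagSecond (dx φ) t) y / dx φ t y := by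
    have h2 : dx (dx v) t = fun x => lagSecond (dx φ) t (Function.invFun (φ t) x) :=
      funext fun x => hlag t ht x
    have h3 := h.hasDerivAt_comp_invFun ht (x := x) (f := lagSecond (dx φ) t)
      ((h.contDiff_lagSecond hS ht).differentiable one_ne_zero _).hasDerivAt
    rw [hy] at h3
    rw [dx, h2]
    exact h3.deriv
  have v4 : deriv (lagSecond (dx φ) t) y = _ := F.deriv
  have v5 : σ t x = dt a t y := (h.velocity_fibre t ht y).symm
  have v6 : dx σ t x = dx (dt a) t y / dx φ t y := by
    have := (h.hasDerivAt_velocity_fibre hS ht x).deriv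
    rwa [hy] at this
  have v7 := (h.hasDerivAt_elDensity hS ht y).deriv
  refine (E.congr_of_eventuallyEq ?_).congr_deriv ?_
  · filter_upwards [hI.mem_nhds ht] with τ hτ
    exact hlag τ hτ x
  · rw [v1, v2, v3, v4, v5, v6, v7]
    simp only [lagSecond, Pi.pow_apply, Pi.mul_apply, Pi.sub_apply, hy]
    -- With each derivative replaced by a free variable, the claim is an identity of rational
    -- functions whose denominators are powers of `r`.
    generalize dx φ t y = r at hne ⊢
    generalize dt (dx φ) t y = p
    generalize dx (dx φ) t y = k
    generalize dx (dt (dx φ)) t y = l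
    generalize dt (dt (dx φ)) t y = m
    generalize dx (dt (dt (dx φ))) t y = n
    generalize dx (dx (dt (dx φ))) t y = l'
    generalize dx (dx (dx φ)) t y = k'
    generalize dx (dt a) t y = b'
    generalize dt a t y = b
    generalize v t x = w
    field_simp
    ring

/-- The residual of the second equation in Lagrangian coordinates is `elFibre` divided by the
density. -/
theorem hasDerivAt_velocity_fibre_time (h : IsFlow (S + 1 + 1) I φ a v σ)
    (hS : ((1 / 2 : ℝ) : WithTop ℝ) < S) {t : ℝ} (ht : t ∈ I) (y : ℝ) :
    HasDerivAt (fun τ => σ τ (φ t y))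
      (-deriv (fun x => σ t x * v t x) (φ t y) + elFibre (dx φ) a t y / dx φ t y) t := by
  have hI := h.isOpen
  have hS1 := half_lt_add_one hS
  have hφ := h.isCircleDiffeo ht
  set x := φ t y with hx
  have hy : Function.invFun (φ t) x = y := hφ.invFun_apply y
  have hne := (h.pos t ht y).ne'
  have E := (h.curve_fibre.dt hI).hasDerivAt_along hI hS1 ht (h.hasDerivAt_invFun_time ht x)
  rw [hy] at E
  have d := ((h.hasDerivAt_velocity_fibre hS ht x).mul (h.hasDerivAt_velocity ht x)).deriv
  rw [hy, ← h.velocity_fibre t ht y] at d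
  refine (E.congr_of_eventuallyEq ?_).congr_deriv ?_
  · filter_upwards [hI.mem_nhds ht] with τ hτ
    exact h.velocity_fibre_eq hτ x
  · have d' : deriv (fun x => σ t x * v t x) x = _ := d
    rw [d']
    simp only [elFibre]
    field_simp
    ring

/-- For regular flows, classical solutions correspond to solutions of the Euler–Lagrange
equations. -/
theorem isClassicalSolution_iff_eulerLagrange (h : IsFlow (S + 1 + 1) I φ a v σ)
    (hS : ((1 / 2 : ℝ) : WithTop ℝ) < S) :
    IsClassicalSolution I v σ ↔ EulerLagrange I (dx φ) a := by
  constructor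
  · intro hcl t ht
    obtain ⟨-, -, hx⟩ := hcl t ht
    constructor
    -- The pointwise equation forces the residual to vanish, and the residual is a nonzero multiple
    -- of this space derivative.
    · have hz : ∀ y, deriv (elDensity (dx φ) a t) y = 0 := by
        intro y
        have h1 := (hx (φ t y)).1.unique (h.hasDerivAt_dx_dx_velocity_time hS ht y)
        have h2 : deriv (elDensity (dx φ) a t) y / (2 * dx φ t y) = 0 := by linarith
        rw [div_eq_zero_iff] at h2
        exact h2.resolve_right (by linarith [h.pos t ht y] : (2 * dx φ t y) > 0).ne'
      exact ⟨_, fun y => is_const_of_deriv_eq_zero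
        (fun y => (h.hasDerivAt_elDensity hS ht y).differentiableAt) hz y 0⟩
    · intro y
      have h1 := (hx (φ t y)).2.unique (h.hasDerivAt_velocity_fibre_time hS ht y)
      have h2 : elFibre (dx φ) a t y / dx φ t y = 0 := by linarith
      rw [div_eq_zero_iff] at h2
      exact h2.resolve_right (h.pos t ht y).ne'
  · intro hEL t ht
    obtain ⟨⟨c, hc⟩, hW⟩ := hEL t ht
    refine ⟨h.contDiff_velocity hS ht, h.contDiff_velocity_fibre hS ht, fun x => ?_⟩
    obtain ⟨y, rfl⟩ := (h.isCircleDiffeo ht).surjective x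
    have hz : deriv (elDensity (dx φ) a t) y = 0 := by
      rw [show elDensity (dx φ) a t = fun _ => c from funext hc]
      simp
    have h1 := h.hasDerivAt_dx_dx_velocity_time hS ht y
    have h2 := h.hasDerivAt_velocity_fibre_time hS ht y
    rw [hz, zero_div, sub_zero] at h1
    rw [hW, zero_div, add_zero] at h2
    exact ⟨h1, h2⟩

end

end IsFlow

/-! ### Lifts of curves in the semidirect product -/

theorem continuous_of_mem_Hs {s : WithTop ℝ} (hs : ((1 / 2 : ℝ) : WithTop ℝ) < s) {f : ℝ → ℝ}
    (hf : f ∈ Hs s) : Continuous f := by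
  obtain ⟨r, -, h2⟩ := exists_exponent hs
  exact (mem_Hs.mp hf r h2).1

/-- Two continuous lifts of a map to the circle differ by a constant. -/
theorem exists_eq_add_const {f g : ℝ → ℝ} (hf : Continuous f) (hg : Continuous g)
    (h : ∀ x, ((f x : ℝ) : AddCircle (2 * Real.pi)) = ((g x : ℝ) : AddCircle (2 * Real.pi))) :
    ∃ c, ∀ x, f x = g x + c := by
  refine ⟨f 0 - g 0, fun x => ?_⟩
  have hpi : (2 * Real.pi) ≠ 0 := by positivity
  have hmem : ∀ y, (f y - g y) / (2 * Real.pi) ∈ range ((↑) : ℤ → ℝ) := fun y => by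
    have h1 : ((f y - g y : ℝ) : AddCircle (2 * Real.pi)) = 0 := by
      rw [AddCircle.coe_sub, h, sub_self]
    obtain ⟨n, hn⟩ := (AddCircle.coe_eq_zero_iff _).mp h1
    refine ⟨n, ?_⟩
    rw [← hn, zsmul_eq_mul]
    field_simp
  -- The difference of the lifts divided by `2π` is continuous and integer valued on a connected
  -- line, hence constant.
  have hdisc : DiscreteTopology (range ((↑) : ℤ → ℝ)) :=
    (Int.isClosedEmbedding_coe_real.isEmbedding.toHomeomorph.symm.isEmbedding).discreteTopology
  have h2 := isPreconnected_univ.constant_of_mapsTo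
    (f := fun y => (f y - g y) / (2 * Real.pi)) (T := range ((↑) : ℤ → ℝ))
    (isDiscrete_iff_discreteTopology.mpr hdisc) (Continuous.continuousOn (by fun_prop))
    (fun y _ => hmem y) (mem_univ x) (mem_univ 0)
  field_simp at h2
  linarith

/-- `toCotDens` picks a lift by choice; its coset does not depend on that choice. -/
theorem toCotDens_snd {s : WithTop ℝ} (hs : ((1 / 2 : ℝ) : WithTop ℝ) < s) {g : SemiDirect s}
    {b : Hs s} (hb : ∀ x, g.α x = (((b : ℝ → ℝ) x : ℝ) : AddCircle (2 * Real.pi))) :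
    g.toCotDens.2 = (constants s).mkQ b := by
  refine mkQ_eq_iff.mpr (exists_eq_add_const (continuous_of_mem_Hs hs (Subtype.mem _))
    (continuous_of_mem_Hs hs b.2) fun x => ?_)
  rw [← hb, g.exists_lift.choose_spec]

theorem dt_congr {I : Set ℝ} (hI : IsOpen I) {u w : ℝ → ℝ → ℝ} (h : ∀ t ∈ I, u t = w t) {t : ℝ}
    (ht : t ∈ I) : dt u t = dt w t := by
  ext x
  refine EventuallyEq.deriv_eq ?_
  filter_upwards [hI.mem_nhds ht] with τ hτ
  rw [h τ hτ]

theorem IsLift.congr {s : WithTop ℝ} {k : ℕ} {I : Set ℝ} {γ γ' : ℝ → CotDens s} {Θ : ℝ → Hs s}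
    (h : IsLift k I γ Θ) (hγ : ∀ t ∈ I, γ' t = γ t) : IsLift k I γ' Θ :=
  ⟨h.1.congr fun t ht => by rw [hγ t ht], h.2.1, fun t ht => by rw [hγ t ht, h.2.2 t ht]⟩

section

variable {s : WithTop ℝ} {I : Set ℝ} {g : ℝ → SemiDirect s} {a : ℝ → ℝ → ℝ}

theorem IsGroupCurve.exists_isLift {k : ℕ} (hs : ((1 / 2 : ℝ) : WithTop ℝ) < s)
    (h : IsGroupCurve k I g a) :
    ∃ Θ : ℝ → Hs s, IsLift k I (fun t => (g t).toCotDens) Θ ∧ ∀ t ∈ I, (Θ t : ℝ → ℝ) = a t := by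
  obtain ⟨h1, h2, h3⟩ := h
  classical
  -- Off `I` nothing is known about `a t`, so a default value is used there.
  have hex : ∀ t, ∃ θ : Hs s, t ∈ I → (θ : ℝ → ℝ) = a t := fun t => by
    by_cases ht : t ∈ I
    · exact ⟨⟨a t, h2.mem_Hs hs ht⟩, fun _ => rfl⟩
    · exact ⟨0, fun h => absurd h ht⟩
  choose Θ hΘ using hex
  refine ⟨Θ, ⟨isCurve_dx_of_curve (φ := fun t => (g t).φ) hs h1, h2.congr hΘ, fun t ht => ?_⟩, hΘ⟩
  refine (toCotDens_snd hs fun x => ?_).symm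
  rw [h3 t ht, hΘ t ht]

theorem IsGroupCurve.isCircleDiffeo {k : ℕ} (hs : ((1 / 2 : ℝ) : WithTop ℝ) < s)
    (h : IsGroupCurve k I g a) {t : ℝ} (ht : t ∈ I) :
    IsCircleDiffeo (g t).φ (dx (fun τ => (g τ).φ) t) :=
  isCircleDiffeo_of_curve (φ := fun t => (g t).φ) hs h.1 ht (g t).deriv_pos

/-- Whatever lift represents the velocity, normalizing it recovers the velocity of the normalized
lift. -/
theorem IsLift.velocity_normalized {γ : ℝ → CotDens s} (hI : IsOpen I)
    (hs : ((1 / 2 : ℝ) : WithTop ℝ) < s) {k : ℕ} {Θ : ℝ → Hs s} (h : IsLift (k + 1) I γ Θ) {t : ℝ}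
    (ht : t ∈ I)
    (hnorm : ∫ x in (0 : ℝ)..1, dt (fun τ => (Θ τ : ℝ → ℝ)) t x * (γ t).density x = 0)
    {Θ' : ℝ → Hs s} (h' : IsLift (k + 1) I γ Θ') :
    normalize (γ t).density (dt (fun τ => (Θ' τ : ℝ → ℝ)) t) =
      dt (fun τ => (Θ τ : ℝ → ℝ)) t := by
  obtain ⟨c, hc⟩ := h.exists_dt_eq hI hs h' ht
  rw [show dt (fun τ => (Θ' τ : ℝ → ℝ)) t = _ from funext hc,
    normalize_add_const (h.1.continuous hs ht) ((h.2.1.dt hI).continuous hs ht) (γ t).1.2.2]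
  ext x
  rw [normalize, hnorm, sub_zero]

/-- On vectors of mean zero, the right-invariant metric is the pullback of the
Sasaki–Fisher–Rao metric. -/
theorem IsGroupCurve.sasaki_eq_lenells (hI : IsOpen I) (hs : ((1 / 2 : ℝ) : WithTop ℝ) < s)
    (h : IsGroupCurve 1 I g a) {t : ℝ} (ht : t ∈ I) {ρd θd : ℝ → ℝ}
    (hv : IsVelocity I (fun τ => (g τ).toCotDens) t ρd θd)
    (h0 : ∫ x in (0 : ℝ)..1, dt a t (Function.invFun (g t).φ x) = 0) :
    sasaki (g t).toCotDens.density ρd θd =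
      lenells (g t).φ (dt (fun τ => (g τ).φ) t) (dt a t) := by
  obtain ⟨Θ, hΘ, hΘa⟩ := h.exists_isLift hs
  obtain ⟨Θ', hΘ', hρd, hθd⟩ := hv
  have hφ := h.isCircleDiffeo hs ht
  have hda : dt (fun τ => (Θ τ : ℝ → ℝ)) t = dt a t := dt_congr hI hΘa ht
  have cat : IsCurve 0 s I (dt a) := h.2.1.dt hI
  have cρ : IsCurve 1 s I (dx fun τ => (g τ).φ) :=
    isCurve_dx_of_curve (φ := fun t => (g t).φ) hs h.1
  have hnorm : ∫ x in (0 : ℝ)..1, dt a t x * dx (fun τ => (g τ).φ) t x = 0 := by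
    refine Eq.trans ?_ h0
    rw [hφ.integral_comp_invFun (cat.continuous hs ht) (cat.periodic hs ht)]
  have hθ : θd = dt a t := by
    rw [hθd, ← hda]
    refine hΘ.velocity_normalized (k := 0) hI hs ht ?_ hΘ'
    rw [hda]
    exact hnorm
  have hρ : ρd = dt (dx fun τ => (g τ).φ) t := hρd
  have hne : ∀ y, dx (fun τ => (g τ).φ) t y ≠ 0 := fun y => (hφ.pos y).ne'
  have cdφ : IsCurve 0 (s + 1) I (dt fun τ => (g τ).φ) := by
    have := h.1.dt (k := 0) hI
    rwa [dt_sub_id (fun τ => (g τ).φ)] at this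
  have hder : deriv (dt (fun τ => (g τ).φ) t ∘ Function.invFun (g t).φ) = fun x =>
      dt (dx fun τ => (g τ).φ) t (Function.invFun (g t).φ x) /
        dx (fun τ => (g τ).φ) t (Function.invFun (g t).φ x) := by
    ext x
    rw [dt_dx_of_curve (φ := fun t => (g t).φ) hI hs h.1 ht, div_eq_mul_inv]
    exact ((cdφ.hasDerivAt_space hs ht _).comp x (hφ.hasDerivAt_invFun x)).deriv
  have cdρ : IsCurve 0 s I (dt (dx fun τ => (g τ).φ)) := cρ.dt hI
  have cG : Continuous fun y => (dt (dx fun τ => (g τ).φ) t y / dx (fun τ => (g τ).φ) t y) ^ 2 +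
      dt a t y ^ 2 :=
    (((cdρ.continuous hs ht).div (cρ.continuous hs ht) hne).pow 2).add
      ((cat.continuous hs ht).pow 2)
  have pG : Function.Periodic (fun y =>
      (dt (dx fun τ => (g τ).φ) t y / dx (fun τ => (g τ).φ) t y) ^ 2 + dt a t y ^ 2) 1 :=
    fun y => by
      simp only [cdρ.periodic hs ht y, cρ.periodic hs ht y, cat.periodic hs ht y]
  have key := hφ.integral_comp_invFun cG pG
  unfold sasaki lenells lenellsOne
  rw [hder]
  simp only [Function.comp_apply]
  rw [key, hρ, hθ]
  congr 1
  refine intervalIntegral.integral_congr fun y _ => ?_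
  have h1 : (g t).toCotDens.density y = dx (fun τ => (g τ).φ) t y := rfl
  have h2 := hne y
  simp only [h1]
  field_simp

theorem IsEulerianVelocity.exists_isFlow (hI : IsOpen I) (hs : ((1 / 2 : ℝ) : WithTop ℝ) < s)
    {v σ : ℝ → ℝ → ℝ} (h : IsEulerianVelocity I v σ g a) :
    ∃ Θ : ℝ → Hs s, IsLift 2 I (fun t => (g t).toCotDens) Θ ∧
      IsFlow s I (fun t => (g t).φ) (fun t => (Θ t : ℝ → ℝ)) v σ := by
  obtain ⟨Θ, hΘ, hΘa⟩ := h.1.exists_isLift hs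
  exact ⟨Θ, hΘ, hI, hs, h.1.1, hΘ.2.1, fun t _ => (g t).deriv_pos, fun t ht x => (h.2 t ht x).1,
    fun t ht x => by rw [dt_congr hI hΘa ht, (h.2 t ht x).2]⟩

/-- Weak solutions of mean zero correspond to geodesics. -/
theorem IsEulerianVelocity.isWeakSolution_iff_isGeodesic (hI : IsOpen I) (hI' : I.OrdConnected)
    (hs : ((1 / 2 : ℝ) : WithTop ℝ) < s) {t₀ : ℝ} (ht₀ : t₀ ∈ I) {v σ : ℝ → ℝ → ℝ}
    (h : IsEulerianVelocity I v σ g a) :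
    (IsWeakSolution I v σ ∧ ∫ x in (0 : ℝ)..1, σ t₀ x = 0) ↔
      (IsGeodesic I (fun t => (g t).toCotDens) ∧ ∀ t ∈ I, ∫ x in (0 : ℝ)..1, σ t x = 0) := by
  obtain ⟨Θ, hΘ, hf⟩ := h.exists_isFlow hI hs
  have hp := hf.isPair
  rw [hf.isWeakSolution_iff_eulerLagrange hI' ⟨t₀, ht₀⟩]
  have geo : (∀ t ∈ I, ∫ x in (0 : ℝ)..1, σ t x = 0) →
      (IsGeodesic I (fun t => (g t).toCotDens) ↔
        EulerLagrange I (dx fun t => (g t).φ) (fun t => (Θ t : ℝ → ℝ))) := fun h0 =>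
    isGeodesic_iff_eulerLagrange hI hI' hs hΘ fun t ht =>
      (hf.integral_velocity_fibre ht).symm.trans (h0 t ht)
  constructor
  · rintro ⟨hEL, h0⟩
    -- The momentum density `θ̇ρ` is constant in time at every point, and its integral is `∫ σ`.
    have h1 : ∀ t ∈ I, ∫ x in (0 : ℝ)..1, σ t x = 0 := by
      intro t ht
      refine Eq.trans ?_ h0
      rw [hf.integral_velocity_fibre ht, hf.integral_velocity_fibre ht₀]
      congr 1
      ext x
      exact hI.is_const_of_deriv_eq_zero hI'.isPreconnected
        (fun τ hτ => (hp.hasDerivAt_momentum hτ x).differentiableAt.differentiableWithinAt)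
        (fun τ hτ => by rw [(hp.hasDerivAt_momentum hτ x).deriv, (hEL τ hτ).2 x]; rfl) ht ht₀
    exact ⟨(geo h1).mpr hEL, h1⟩
  · rintro ⟨hgeo, h0⟩
    exact ⟨(geo h0).mp hgeo, h0 t₀ ht₀⟩

theorem IsEulerianVelocity.isWeakSolution_iff_isClassicalSolution (hI : IsOpen I)
    (hI' : I.OrdConnected) (hne : I.Nonempty) (hs : ((1 / 2 : ℝ) : WithTop ℝ) < s)
    {v σ : ℝ → ℝ → ℝ} (h : IsEulerianVelocity I v σ g a) (hs' : ((5 / 2 : ℝ) : WithTop ℝ) < s) :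
    IsWeakSolution I v σ ↔ IsClassicalSolution I v σ := by
  obtain ⟨Θ, -, hf⟩ := h.exists_isFlow hI hs
  obtain ⟨r, hr, hrs⟩ := exists_exponent hs'
  -- The flow is viewed at the finite exponent `r = (r - 2) + 1 + 1 ≤ s`; neither equation refers to
  -- the exponent.
  have hS : ((1 / 2 : ℝ) : WithTop ℝ) < ((r - 2 : ℝ) : WithTop ℝ) :=
    WithTop.coe_lt_coe.mpr (by linarith)
  have hle : ((r - 2 : ℝ) : WithTop ℝ) + 1 + 1 ≤ s := by
    refine le_trans (le_of_eq ?_) hrs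
    exact_mod_cast (by ring : r - 2 + 1 + 1 = r)
  have hf' := hf.anti (half_lt_add_one (half_lt_add_one hS)) hle
  rw [hf.isWeakSolution_iff_eulerLagrange hI' hne, hf'.isClassicalSolution_iff_eulerLagrange hS]

end

/-! ### Reconstruction of a curve from a geodesic -/

section

variable {s : WithTop ℝ}

/-- The diffeomorphism fixing `x₀` with derivative `ρ`. -/
def reconstructMap (x₀ : ℝ) (ρ : ℝ → ℝ) (x : ℝ) : ℝ := x + (primitive ρ x - primitive ρ x₀)

theorem hasDerivAt_reconstructMap (x₀ : ℝ) {ρ : ℝ → ℝ} (hρ : Continuous ρ)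
    (h1 : ∫ x in (0 : ℝ)..1, ρ x = 1) (x : ℝ) : HasDerivAt (reconstructMap x₀ ρ) (ρ x) x := by
  have h := (hasDerivAt_id x).add ((hasDerivAt_primitive hρ x).sub_const (primitive ρ x₀))
  refine h.congr_deriv ?_
  rw [h1]
  ring

theorem reconstructMap_mem {ρ : ℝ → ℝ} (x₀ : ℝ) (hρ : ρ ∈ Hs s) :
    (fun x => reconstructMap x₀ ρ x - x) ∈ Hs (s + 1) := by
  have h : (fun x => reconstructMap x₀ ρ x - x) = primitive ρ + fun _ => -primitive ρ x₀ := by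
    ext x
    simp only [reconstructMap, Pi.add_apply]
    ring
  rw [h]
  exact (Hs (s + 1)).add_mem (primitive_mem_Hs hρ) (const_mem_Hs _ _)

/-- The element of the semidirect product over a density and a function. -/
def reconstruct (hs : ((1 / 2 : ℝ) : WithTop ℝ) < s) (x₀ : ℝ) (ρ : Dens s) (θ : Hs s) :
    SemiDirect s where
  φ := reconstructMap x₀ ((ρ : Hs s) : ℝ → ℝ)
  contDiff_φ := by
    have hc := continuous_of_mem_Hs hs ρ.1.2
    have hd := hasDerivAt_reconstructMap x₀ hc ρ.2.2
    rw [contDiff_one_iff_deriv]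
    refine ⟨fun x => (hd x).differentiableAt, ?_⟩
    rwa [show deriv (reconstructMap x₀ ((ρ : Hs s) : ℝ → ℝ)) = _ from funext fun x => (hd x).deriv]
  periodic_φ := by
    obtain ⟨r, -, h2⟩ := exists_exponent (half_lt_add_one hs)
    exact (mem_Hs.mp (reconstructMap_mem x₀ ρ.1.2) r h2).2.1
  mem_φ := reconstructMap_mem x₀ ρ.1.2
  deriv_pos x := by
    rw [(hasDerivAt_reconstructMap x₀ (continuous_of_mem_Hs hs ρ.1.2) ρ.2.2 x).deriv]
    exact ρ.2.1 x
  α x := (((θ : ℝ → ℝ) x : ℝ) : AddCircle (2 * Real.pi))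
  exists_lift := ⟨θ, fun _ => rfl⟩

theorem reconstruct_density (hs : ((1 / 2 : ℝ) : WithTop ℝ) < s) (x₀ : ℝ) (ρ : Dens s)
    (θ : Hs s) : deriv (reconstruct hs x₀ ρ θ).φ = ((ρ : Hs s) : ℝ → ℝ) :=
  funext fun x => (hasDerivAt_reconstructMap x₀ (continuous_of_mem_Hs hs ρ.1.2) ρ.2.2 x).deriv

theorem toCotDens_reconstruct (hs : ((1 / 2 : ℝ) : WithTop ℝ) < s) (x₀ : ℝ) (ρ : Dens s)
    (θ : Hs s) : (reconstruct hs x₀ ρ θ).toCotDens = (ρ, (constants s).mkQ θ) :=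
  Prod.ext (Subtype.ext (Subtype.ext (reconstruct_density hs x₀ ρ θ)))
    (toCotDens_snd hs fun _ => rfl)

variable {I : Set ℝ} {γ : ℝ → CotDens s}

/-- Every curve in the cotangent bundle has a normalized lift. -/
theorem IsLift.exists_normalized (hI : IsOpen I) (hI' : I.OrdConnected)
    (hs : ((1 / 2 : ℝ) : WithTop ℝ) < s) {t₀ : ℝ} (ht₀ : t₀ ∈ I) {Θ₀ : ℝ → Hs s}
    (h : IsLift 2 I γ Θ₀) :
    ∃ Θ : ℝ → Hs s, IsLift 2 I γ Θ ∧
      ∀ t ∈ I, ∫ x in (0 : ℝ)..1, dt (fun τ => (Θ τ : ℝ → ℝ)) t x * (γ t).density x = 0 := by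
  obtain ⟨h1, h2, h3⟩ := h
  have cdt : IsCurve 1 s I (dt fun t => (Θ₀ t : ℝ → ℝ)) := h2.dt hI
  set m : ℝ → ℝ := fun t =>
    ∫ x in (0 : ℝ)..1, dt (fun τ => (Θ₀ τ : ℝ → ℝ)) t x * (γ t).density x with hm
  have cm : ContDiffOn ℝ (1 : ℕ) m I := cdt.integral_mul hs (h1.of_le one_le_two)
  -- Subtracting `M(t)` lowers the mean of the lift's velocity against the density by `m(t)`, since
  -- the density has mass `1`. As `m` is `C¹`, `M` is `C²` and the new lift keeps its regularity.
  set M : ℝ → ℝ := fun t => ∫ τ in t₀..t, m τ with hM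
  have dM : ∀ t ∈ I, HasDerivAt M (m t) t := fun t ht => by
    have hsub : uIcc t₀ t ⊆ I := hI'.uIcc_subset ht₀ ht
    exact intervalIntegral.integral_hasDerivAt_right
      (cm.continuousOn.mono hsub).intervalIntegrable
      (cm.continuousOn.stronglyMeasurableAtFilter hI t ht)
      (cm.continuousOn.continuousAt (hI.mem_nhds ht))
  have cM : ContDiffOn ℝ (2 : ℕ) M I := by
    have : ContDiffOn ℝ (1 + 1) M I := by
      rw [contDiffOn_succ_iff_deriv_of_isOpen hI]
      refine ⟨fun t ht => (dM t ht).differentiableAt.differentiableWithinAt, by simp, ?_⟩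
      refine ContDiffOn.congr ?_ fun t ht => (dM t ht).deriv
      exact_mod_cast cm
    refine this.of_le ?_
    norm_num
  set Θ : ℝ → Hs s := fun t => Θ₀ t + ⟨fun _ => -M t, const_mem_Hs s _⟩ with hΘ
  have hΘx : ∀ t x, (Θ t : ℝ → ℝ) x = (Θ₀ t : ℝ → ℝ) x + -M t := fun t x => rfl
  refine ⟨Θ, ⟨h1, (h2.add (isCurve_scalar (c := fun t => -M t) cM.neg)).congr
    fun t _ => funext (hΘx t), fun t ht => ?_⟩, fun t ht => ?_⟩
  · rw [← h3 t ht]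
    exact mkQ_eq_iff.mpr ⟨-M t, hΘx t⟩
  · have d : ∀ x, dt (fun τ => (Θ τ : ℝ → ℝ)) t x =
        dt (fun τ => (Θ₀ τ : ℝ → ℝ)) t x + -m t := fun x =>
      ((h2.hasDerivAt hI hs ht x).add (dM t ht).neg).deriv
    have c1 := cdt.continuous hs ht
    have c2 : Continuous (γ t).density := h1.continuous hs ht
    have e : (fun x => dt (fun τ => (Θ τ : ℝ → ℝ)) t x * (γ t).density x) = fun x =>
        dt (fun τ => (Θ₀ τ : ℝ → ℝ)) t x * (γ t).density x + -m t * (γ t).density x := by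
      ext x
      rw [d]
      ring
    have e1 : ∫ x in (0 : ℝ)..1, (γ t).density x = 1 := (γ t).1.2.2
    rw [e, intervalIntegral.integral_add, intervalIntegral.integral_const_mul, e1]
    · simp [hm]
    all_goals
      apply Continuous.intervalIntegrable
      fun_prop

theorem isEulerianVelocity_reconstruct (hs : ((1 / 2 : ℝ) : WithTop ℝ) < s)
    (x₀ : ℝ) {Θ : ℝ → Hs s} (h : IsLift 2 I γ Θ) :
    IsEulerianVelocity I
      (fun t x => dt (fun τ => (reconstruct hs x₀ (γ τ).1 (Θ τ)).φ) t
        (Function.invFun (reconstruct hs x₀ (γ t).1 (Θ t)).φ x))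
      (fun t x => dt (fun τ => (Θ τ : ℝ → ℝ)) t
        (Function.invFun (reconstruct hs x₀ (γ t).1 (Θ t)).φ x))
      (fun t => reconstruct hs x₀ (γ t).1 (Θ t)) (fun t => (Θ t : ℝ → ℝ)) := by
  have hg : IsGroupCurve 2 I (fun t => reconstruct hs x₀ (γ t).1 (Θ t))
      (fun t => (Θ t : ℝ → ℝ)) := by
    refine ⟨?_, h.2.1, fun t _ x => rfl⟩
    have h1 := h.1.primitive hs
    have h2 : ContDiffOn ℝ (2 : ℕ) (fun t => -primitive ((γ t).density) x₀) I :=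
      (h1.eval (half_lt_add_one hs) x₀).neg
    refine (h1.add (isCurve_scalar h2)).congr fun t _ => funext fun x => ?_
    change reconstructMap x₀ (γ t).density x - x = _
    rw [reconstructMap]
    ring
  refine ⟨hg, fun t ht x => ?_⟩
  have := (hg.isCircleDiffeo hs ht).invFun_apply x
  simp only [this, and_self]

/-- Every geodesic comes from exactly one mean zero weak solution. -/
theorem IsGeodesic.exists_solution (hI : IsOpen I) (hI' : I.OrdConnected)
    (hs : ((1 / 2 : ℝ) : WithTop ℝ) < s) (x₀ : ℝ) {t₀ : ℝ} (ht₀ : t₀ ∈ I)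
    (h : IsGeodesic I γ) :
    ∃ (v σ : ℝ → ℝ → ℝ) (g : ℝ → SemiDirect s) (a : ℝ → ℝ → ℝ),
      (IsEulerianVelocity I v σ g a ∧ (∀ t ∈ I, (g t).φ x₀ = x₀) ∧
        ∀ t ∈ I, (g t).toCotDens = γ t) ∧
      IsWeakSolution I v σ ∧ (∀ t ∈ I, ∫ x in (0 : ℝ)..1, σ t x = 0) ∧
      ∀ (v' σ' : ℝ → ℝ → ℝ) (g' : ℝ → SemiDirect s) (a' : ℝ → ℝ → ℝ),
        IsEulerianVelocity I v' σ' g' a' → (∀ t ∈ I, (g' t).φ x₀ = x₀) →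
        (∀ t ∈ I, (g' t).toCotDens = γ t) → (∀ t ∈ I, ∫ x in (0 : ℝ)..1, σ' t x = 0) →
        ∀ t ∈ I, v' t = v t ∧ σ' t = σ t := by
  obtain ⟨Θ₀, hΘ₀, -⟩ := id h
  obtain ⟨Θ, hΘ, hnorm⟩ := hΘ₀.exists_normalized hI hI' hs ht₀
  have hEL := (isGeodesic_iff_eulerLagrange hI hI' hs hΘ hnorm).mp h
  have hE := isEulerianVelocity_reconstruct hs x₀ hΘ
  set g : ℝ → SemiDirect s := fun t => reconstruct hs x₀ (γ t).1 (Θ t) with hg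
  set v : ℝ → ℝ → ℝ := fun t x => dt (fun τ => (g τ).φ) t (Function.invFun (g t).φ x) with hv
  set σ : ℝ → ℝ → ℝ := fun t x => dt (fun τ => (Θ τ : ℝ → ℝ)) t (Function.invFun (g t).φ x)
    with hσ
  have hγ : ∀ t ∈ I, (g t).toCotDens = γ t := fun t ht => by
    rw [hg, toCotDens_reconstruct, hΘ.2.2 t ht]
  have hfix : ∀ t ∈ I, (g t).φ x₀ = x₀ := fun t _ => by
    change reconstructMap x₀ _ x₀ = x₀
    simp [reconstructMap]
  have hflow : IsFlow s I (fun t => (g t).φ) (fun t => (Θ t : ℝ → ℝ)) v σ :=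
    ⟨hI, hs, hE.1.1, hΘ.2.1, fun t _ => (g t).deriv_pos, fun t ht x => (hE.2 t ht x).1,
      fun t ht x => (hE.2 t ht x).2⟩
  have hdens : (dx fun t => (g t).φ) = fun t => (γ t).density :=
    funext fun t => reconstruct_density hs x₀ (γ t).1 (Θ t)
  refine ⟨v, σ, g, _, ⟨hE, hfix, hγ⟩, ?_, fun t ht => ?_, ?_⟩
  · rw [hflow.isWeakSolution_iff_eulerLagrange hI' ⟨t₀, ht₀⟩, hdens]
    exact hEL
  · rw [hflow.integral_velocity_fibre ht, hdens]
    exact hnorm t ht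
  · intro v' σ' g' a' hE' hfix' hγ' h0' t ht
    obtain ⟨Θ', hΘ', hflow'⟩ := hE'.exists_isFlow hI hs
    -- Both diffeomorphisms have derivative equal to the density of `γ t` and both fix `x₀`.
    have hφ : ∀ t ∈ I, (g' t).φ = (g t).φ := by
      intro t ht
      have hd : ∀ x, deriv (fun x => (g' t).φ x - (g t).φ x) x = 0 := fun x => by
        have d1 := ((g' t).contDiff_φ.differentiable one_ne_zero x).hasDerivAt
        have d2 := ((g t).contDiff_φ.differentiable one_ne_zero x).hasDerivAt
        have e : deriv (g' t).φ x = deriv (g t).φ x :=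
          congrArg (fun p : CotDens s => p.density x) ((hγ' t ht).trans (hγ t ht).symm)
        have d3 : HasDerivAt (fun x => (g' t).φ x - (g t).φ x) _ x := d1.sub d2
        rw [d3.deriv, e, sub_self]
      ext x
      have := is_const_of_deriv_eq_zero (((g' t).contDiff_φ.differentiable one_ne_zero).sub
        ((g t).contDiff_φ.differentiable one_ne_zero)) hd x x₀
      simp only [Pi.sub_apply, hfix t ht, hfix' t ht, sub_self] at this
      linarith
    have hdt : dt (fun t => (g' t).φ) t = dt (fun t => (g t).φ) t := dt_congr hI hφ ht
    have hsurj := (hflow.isCircleDiffeo ht).surjective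
    have hΘγ : IsLift 2 I γ Θ' := hΘ'.congr fun t ht => (hγ' t ht).symm
    have hn' := hflow'.integral_velocity_fibre ht
    rw [h0' t ht] at hn'
    have hd' : dx (fun t => (g' t).φ) t = (γ t).density :=
      congrArg CotDens.density (hγ' t ht)
    rw [hd'] at hn'
    -- Both are lifts of `γ` with normalized velocity, and each coset has only one normalized
    -- representative.
    have hdΘ : dt (fun τ => (Θ' τ : ℝ → ℝ)) t = dt (fun τ => (Θ τ : ℝ → ℝ)) t := by
      rw [← hΘ.velocity_normalized hI hs ht (hnorm t ht) hΘγ]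
      ext x
      rw [normalize, ← hn', sub_zero]
    constructor
    · ext z
      obtain ⟨x, rfl⟩ := hsurj z
      rw [← hflow.velocity t ht x, ← hdt, hflow'.velocity t ht x, hφ t ht]
    · ext z
      obtain ⟨x, rfl⟩ := hsurj z
      rw [← hflow.velocity_fibre t ht x, ← hdΘ, hflow'.velocity_fibre t ht x, hφ t ht]

end

end HunterSaxton

end

/-! ### The proposition -/

open HunterSaxton in
theorem proposition3p5 (s : WithTop ℝ) (hs : ((1 / 2 : ℝ) : WithTop ℝ) < s) (x₀ : ℝ)
    (I : Set ℝ) (hI : IsOpen I) (hI' : I.OrdConnected) (t₀ : ℝ) (ht₀ : t₀ ∈ I) :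
    -- on vectors of mean zero, the metric of the semidirect product is the pullback
    (∀ (g : ℝ → SemiDirect s) (a : ℝ → ℝ → ℝ), IsGroupCurve 1 I g a →
      IsCotCurve 1 I (fun t => (g t).toCotDens) ∧
      ∀ t ∈ I, ∀ ρd θd : ℝ → ℝ, IsVelocity I (fun τ => (g τ).toCotDens) t ρd θd →
        ∫ x in (0 : ℝ)..1, dt a t (Function.invFun (g t).φ x) = 0 →
        sasaki (g t).toCotDens.density ρd θd =
          lenells (g t).φ (dt (fun τ => (g τ).φ) t) (dt a t)) ∧
    -- mean-zero solutions correspond to geodesics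
    (∀ (v σ : ℝ → ℝ → ℝ) (g : ℝ → SemiDirect s) (a : ℝ → ℝ → ℝ), IsEulerianVelocity I v σ g a →
      ((IsWeakSolution I v σ ∧ ∫ x in (0 : ℝ)..1, σ t₀ x = 0) ↔
        (IsGeodesic I (fun t => (g t).toCotDens) ∧ ∀ t ∈ I, ∫ x in (0 : ℝ)..1, σ t x = 0)) ∧
      (((5 / 2 : ℝ) : WithTop ℝ) < s → (IsWeakSolution I v σ ↔ IsClassicalSolution I v σ))) ∧
    -- every geodesic comes from exactly one such solution
    (∀ γ : ℝ → CotDens s, IsGeodesic I γ →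
      ∃ (v σ : ℝ → ℝ → ℝ) (g : ℝ → SemiDirect s) (a : ℝ → ℝ → ℝ),
        (IsEulerianVelocity I v σ g a ∧ (∀ t ∈ I, (g t).φ x₀ = x₀) ∧
          ∀ t ∈ I, (g t).toCotDens = γ t) ∧
        IsWeakSolution I v σ ∧ (∀ t ∈ I, ∫ x in (0 : ℝ)..1, σ t x = 0) ∧
        ∀ (v' σ' : ℝ → ℝ → ℝ) (g' : ℝ → SemiDirect s) (a' : ℝ → ℝ → ℝ),
          IsEulerianVelocity I v' σ' g' a' → (∀ t ∈ I, (g' t).φ x₀ = x₀) →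
          (∀ t ∈ I, (g' t).toCotDens = γ t) → (∀ t ∈ I, ∫ x in (0 : ℝ)..1, σ' t x = 0) →
          ∀ t ∈ I, v' t = v t ∧ σ' t = σ t) := by
  exact ⟨fun g a h => ⟨by
      obtain ⟨Θ, hΘ, -⟩ := h.exists_isLift hs
      exact ⟨Θ, hΘ⟩, fun t ht ρd θd hv h0 => h.sasaki_eq_lenells hI hs ht hv h0⟩,
    fun v σ g a h => ⟨h.isWeakSolution_iff_isGeodesic hI hI' hs ht₀, fun hs' =>
      h.isWeakSolution_iff_isClassicalSolution hI hI' ⟨t₀, ht₀⟩ hs hs'⟩,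
    fun γ h => h.exists_solution hI hI' hs x₀ ht₀⟩
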